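/- Let $\alpha$ be irrational (so that, by Dirichlet, $|\alpha-a/q|<1/q^2$ with $a\in\mathbb Z$, $q\in\mathbb N$, $(a,q)=1$ has solutions with arbitrarily large $q$), let $\beta\in\mathbb R$, $b\in\mathbb Z$, and let $\theta,\rho$ be real constants with $0<\theta<\frac1{200}$, $\rho>32\theta$ and $\rho+4\theta<\frac{11}{54}$. For large real $x$ put $$K=K(x)=x^{\theta}\log^2x,\qquad \Delta=\Delta(x)=x^{\rho},\qquad D=D(x)=\frac{x^{1/2}}{\Delta K^4}.$$ A positive integer $d$ is called well-separable of level $D\ge 1$ if for all real $H,S\ge 1$ with $HS=D$ there are positive integers $h\le H$, $s\le S$ with $d=hs$. For every $x$ let $\lambda(d)=\lambda_x(d)$ $(1\le d\le D)$ and $c(k)=c_x(k)$ $(k\in\mathbb Z,\ 0<|k|\le K)$ be complex numbers such that, for all sufficiently large $x$ and with implied constants independent of $x,d,k$: $\lambda(d)\ll\tau(d)$, where $\tau$ is the divisor function; $\lambda(d)\ne 0$ only if $d$ is well-separable of level $D$; and $c(k)\ll 1$. Let $$W(x)=\sum_{d\le D}\lambda(d)\sum_{1\le|k|\le K}c(k)\sum_{\substack{x/2\le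 n<x\\ n\equiv b\,(\mathrm{mod}\ d)}}e\big((\alpha n^2+\beta)k\big)\Lambda(n),\qquad e(y)=e^{2\pi i y},$$ with $\Lambda$ the von Mangoldt function. Then there is a sequence $x_j\to\infty$ such that for every fixed $\omega$ with $0<\omega<\frac{\rho}{32}-\theta$ $$W(x_j)\ll x_j^{1-\omega}\qquad\text{for all } j,$$ where the implied constant does not depend on $j$. -/

import Mathlib

open Filter Topology

namespace WellSep

noncomputable section

/-- `d` is well-separable of level `D`: for all real `H, S ≥ 1` with `H * S = D`
one can write `d = h * s` with positive integers `h ≤ H` and `s ≤ S`. -/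
def WellSeparable (D : ℝ) (d : ℕ) : Prop :=
  ∀ H S : ℝ, 1 ≤ H → 1 ≤ S → H * S = D →
    ∃ h s : ℕ, 0 < h ∧ 0 < s ∧ (h : ℝ) ≤ H ∧ (s : ℝ) ≤ S ∧ d = h * s

/-- `δ(x) = x ^ (-θ)`. -/
def delta (θ x : ℝ) : ℝ := x ^ (-θ)

/-- `K = δ⁻¹ log² x`. -/
def K (θ x : ℝ) : ℝ := (delta θ x)⁻¹ * Real.log x ^ 2

/-- `Δ = x ^ ρ`. -/
def Delta (ρ x : ℝ) : ℝ := x ^ ρ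

/-- `D = x ^ (1/2) / (Δ K⁴)`. -/
def D (θ ρ x : ℝ) : ℝ := x ^ (1 / 2 : ℝ) / (Delta ρ x * K θ x ^ 4)

/-- `e(y) = exp(2πiy)`. -/
def e (y : ℝ) : ℂ := Complex.exp (2 * Real.pi * Complex.I * y)

/-- The integers `k` with `1 ≤ |k| ≤ K`. -/
def frequencies (K : ℝ) : Finset ℤ :=
  (Finset.Icc (-⌊K⌋) ⌊K⌋).filter fun k => k ≠ 0

open Classical in
/-- The integers `n` with `x / 2 ≤ n < x` and `n ≡ b (mod d)`. -/
def progression (x : ℝ) (b : ℤ) (d : ℕ) : Finset ℕ :=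
  (Finset.range ⌈x⌉₊).filter fun n => x / 2 ≤ (n : ℝ) ∧ (n : ℤ) ≡ b [ZMOD (d : ℤ)]

/-- The sum
`W(x) = ∑_{d ≤ D} lam(d) ∑_{1 ≤ |k| ≤ K} c(k) ∑_{n ∼ x, n ≡ b (d)} e((α n² + β) k) Λ(n)`,
with `D = D(x)`, `K = K(x)`; the weights `lam`, `c` are those belonging to `x`. -/
def W (α β θ ρ : ℝ) (b : ℤ) (lam : ℕ → ℂ) (c : ℤ → ℂ) (x : ℝ) : ℂ :=
  ∑ d ∈ Finset.Icc 1 ⌊D θ ρ x⌋₊, lam d *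
    ∑ k ∈ frequencies (K θ x), c k *
      ∑ n ∈ progression x b d,
        e ((α * (n : ℝ) ^ 2 + β) * (k : ℝ)) * ((ArithmeticFunction.vonMangoldt n : ℝ) : ℂ)

end

end WellSep

/-! The sequence is the sequence of denominators `q` of good approximations to `α`, so that `x = q`
is both the length of the sum and the quality of the approximation. Put `t = q ^ (ρ / 80)` and let
`F = q ^ ε` bound divisor functions and logarithms. The level condition becomes `D ^ 2 * t ^ 160 ≤
q`, and the aim is to save `√t ^ 5 = q ^ (ρ / 32)` over `K q`, which is the trivial bound up to
powers of `F`. As `K` costs `q ^ θ`, this leaves every exponent `ω < ρ / 32 - θ`.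

Moduli not coprime to `b` meet only proper prime powers and contribute about `√q`
(`twistedSum_not_coprime_le`). For the others Vaughan's identity with cut `U` near `2 t ^ 20` gives
linear sums, with one variable at most `U ^ 2` and the other smooth, and bilinear sums with both
variables at least `2 t ^ 20`.

In the bilinear sums the smaller variable `l` lies in a dyadic range `l ∼ L` with `L ^ 2 ≤ q`.
Well-separability gives `d = h s`, where the bound for `h` is `L / t ^ 20`, or `D` if that is
smaller. Cauchy's inequality over `(k, h, m)` keeps `h` outside the square, and only the cofactor
and `l` are doubled. In a pair `(d₁, l₁)`, `(d₂, l₂)` the variable `m` runs through a class modulo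
`lcm(d₁, d₂) = h s`, and `h ∣ l₁ - l₂`, because both `m l₁` and `m l₂` are `b` modulo `h`
(`dvd_sub_of_mem_pairRange`). The diagonal is harmless since `h` is smaller than `l` by a power of
`t`. Off the diagonal, Weyl differencing in `m` gives the phase `2 α k (l₁² - l₂²) (h s)² u = 2 α h³
s² w u`: two factors `h` come from the modulus and the third from `l₁ - l₂` (`near_shape`). The
linear sums lead to the same phase with `h = 1`, `s = d m` and `w = |k|`.

Everything thus rests on `mixedCount_mul_le`: few triples `(h, s, w)` have `α h³ s² w` near an
integer. If `s` is short it is frozen; if it is long it is differenced once, and its square joins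
`w`. There remains a count for `α g h³ y`. If `h` is short it is frozen too; if it is long it is
differenced twice, and all variables merge into one by the divisor bound (`cubicCount_mul_le`,
`cubicCount_pow_mul_le`). What is left is a linear count along multiples of `α g`, settled by the
spacing of the multiples of a number close to `a / q` (`sum_near_mul_le`). The tightest case of the
count needs `t ^ 392 ≤ q`, and this is where `ρ < 11 / 54` enters. -/

namespace WellSep

noncomputable section

/-! ### Spacing of the multiples of a well approximated number. -/

/-- Distance to the nearest integer. -/
def circNorm (y : ℝ) : ℝ := |y - round y|

lemma circNorm_eq (y : ℝ) : circNorm y = ‖(y : UnitAddCircle)‖ := (UnitAddCircle.norm_eq).symm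

lemma circNorm_neg (y : ℝ) : circNorm (-y) = circNorm y := by
  simp [circNorm_eq]

lemma circNorm_sub_le (y z : ℝ) : circNorm (y - z) ≤ circNorm y + circNorm z := by
  simp only [circNorm_eq, AddCircle.coe_sub]; exact norm_sub_le _ _

lemma circNorm_le_abs_sub_int (y : ℝ) (n : ℤ) : circNorm y ≤ |y - n| := round_le y n

/-- Indicator of the event that `y` is within `κ` of an integer. -/
def near (κ y : ℝ) : ℝ := if circNorm y ≤ κ then 1 else 0

lemma near_nonneg (κ y : ℝ) : 0 ≤ near κ y := by unfold near; split_ifs <;> norm_num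

lemma sum_near_eq_card {ι : Type*} (s : Finset ι) (f : ι → ℝ) (κ : ℝ) :
    ∑ i ∈ s, near κ (f i) = ((s.filter fun i => circNorm (f i) ≤ κ).card : ℝ) := by
  simp [near]

/-- Multiples of a number with a good rational approximation are well spaced. -/
lemma circNorm_mul_ge {γ : ℝ} {a : ℤ} {q : ℕ} (hq : 0 < q) (hcop : IsCoprime a (q : ℤ))
    (hγ : |γ - a / q| ≤ 1 / (q : ℝ) ^ 2) {n : ℕ} (hn : 0 < n) (hn2 : 2 * n < q + 1) :
    1 / (2 * (q : ℝ)) ≤ circNorm (γ * n) := by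
  by_contra hlt
  push Not at hlt
  set z := round (γ * n)
  have hqR : (0 : ℝ) < q := by exact_mod_cast hq
  have hnR : (n : ℝ) ≤ q / 2 := by
    have : (2 * n : ℕ) ≤ q := by omega
    have : (2 * n : ℝ) ≤ q := by exact_mod_cast this
    linarith
  have h1 : |(a : ℝ) / q * n - z| < 1 / q := by
    have e1 : (a : ℝ) / q * n - z = (γ * n - z) - (γ - a / q) * n := by ring
    rw [e1]
    have h2 : |(γ - a / q) * n| ≤ 1 / (2 * q) := by
      rw [abs_mul, Nat.abs_cast]
      calc |γ - a / q| * n ≤ 1 / (q : ℝ) ^ 2 * (q / 2) := by gcongr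
        _ = 1 / (2 * q) := by field_simp
    calc |γ * n - z - (γ - a / q) * n| ≤ |γ * n - z| + |(γ - a / q) * n| := abs_sub _ _
      _ < 1 / (2 * q) + 1 / (2 * q) := by
        have : |γ * n - z| < 1 / (2 * q) := hlt
        linarith
      _ = 1 / q := by field_simp; norm_num
  have h3 : |((a * n - z * q : ℤ) : ℝ)| < 1 := by
    push_cast
    have : (a : ℝ) * n - z * q = ((a : ℝ) / q * n - z) * q := by field_simp
    rw [this, abs_mul, abs_of_pos hqR]
    calc _ < 1 / (q : ℝ) * q := by gcongr
      _ = 1 := by field_simp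
  have h4 : a * n - z * q = 0 := by
    rw [← Int.abs_lt_one_iff]; exact_mod_cast h3
  have h5 : (q : ℤ) ∣ a * n := ⟨z, by linarith⟩
  have h6 : (q : ℤ) ∣ n := (hcop.symm).dvd_of_dvd_mul_left h5
  have h7 : q ∣ n := by exact_mod_cast h6
  have := Nat.le_of_dvd hn h7
  omega

/-- In a short block, a `1 / (2 q)`-spaced sequence meets a short arc rarely. -/
lemma card_near_block {γ δ : ℝ} {a : ℤ} {q : ℕ} (hq : 0 < q) (hcop : IsCoprime a (q : ℤ))
    (hγ : |γ - a / q| ≤ 1 / (q : ℝ) ^ 2) {κ : ℝ} (hκ : 0 ≤ κ) (s : Finset ℕ) (c : ℕ)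
    (hs : ∀ v ∈ s, c ≤ v ∧ 2 * v < 2 * c + q + 1) (hs' : ∀ v ∈ s, circNorm (γ * v + δ) ≤ κ) :
    (s.card : ℝ) ≤ 4 * q * κ + 1 := by
  have hqR : (0 : ℝ) < q := by exact_mod_cast hq
  set r : ℕ → ℝ := fun v => γ * v + δ - round (γ * v + δ)
  have hr : ∀ v ∈ s, 0 ≤ (r v + κ) * (2 * q) ∧ (r v + κ) * (2 * q) ≤ 4 * q * κ := by
    intro v hv
    have := abs_le.1 (hs' v hv)
    constructor
    · have : 0 ≤ r v + κ := by simp only [r]; linarith [this.1]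
      positivity
    · have : r v + κ ≤ 2 * κ := by simp only [r]; linarith [this.2]
      nlinarith
  -- Shifted by `κ` and scaled by `2 q`, the signed residues are at least 1 apart and lie in `[0, 4
  -- q κ]`, so their integer parts are distinct.
  have hinj : Set.InjOn (fun v => ⌊(r v + κ) * (2 * q)⌋₊) (s : Set ℕ) := by
    have key : ∀ v ∈ s, ∀ w ∈ s, v < w →
        ⌊(r v + κ) * (2 * q)⌋₊ = ⌊(r w + κ) * (2 * q)⌋₊ → False := by
      intro v hv w hw hvw heq
      have h1 := circNorm_mul_ge hq hcop hγ (n := w - v) (by omega)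
        (by have := hs v hv; have := hs w hw; omega)
      have h2 : circNorm (γ * ((w - v : ℕ) : ℝ)) ≤ |r w - r v| := by
        have := circNorm_le_abs_sub_int (γ * ((w - v : ℕ) : ℝ))
          (round (γ * w + δ) - round (γ * v + δ))
        refine this.trans (le_of_eq ?_)
        rw [Nat.cast_sub hvw.le]
        simp only [r]; push_cast; congr 1; ring
      have h3 : |(r w + κ) * (2 * q) - (r v + κ) * (2 * q)| < 1 := by
        apply Int.abs_sub_lt_one_of_floor_eq_floor
        have a1 := Int.natCast_floor_eq_floor (hr w hw).1
        have a2 := Int.natCast_floor_eq_floor (hr v hv).1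
        rw [← a1, ← a2, heq]
      have h4 : (r w + κ) * (2 * q) - (r v + κ) * (2 * q) = (r w - r v) * (2 * q) := by ring
      rw [h4, abs_mul, abs_of_pos (by positivity : (0 : ℝ) < 2 * q)] at h3
      have h5 : 1 / (2 * (q : ℝ)) * (2 * q) ≤ |r w - r v| * (2 * q) := by
        gcongr; exact h1.trans h2
      have h6 : 1 / (2 * (q : ℝ)) * (2 * q) = 1 := by field_simp
      linarith
    intro v hv w hw heq
    rcases lt_trichotomy v w with h | h | h
    · exact (key v hv w hw h heq).elim
    · exact h
    · exact (key w hw v hv h heq.symm).elim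
  have hcard : s.card ≤ (Finset.range (⌊4 * q * κ⌋₊ + 1)).card := by
    refine Finset.card_le_card_of_injOn _ ?_ hinj
    intro v hv
    simp only [Finset.coe_range, Set.mem_Iio]
    have := Nat.floor_le_floor (hr v hv).2
    omega
  rw [Finset.card_range] at hcard
  have h1 : ((⌊4 * q * κ⌋₊ : ℕ) : ℝ) ≤ 4 * q * κ := Nat.floor_le (by positivity)
  have h2 : (s.card : ℝ) ≤ (⌊4 * q * κ⌋₊ : ℕ) + 1 := by exact_mod_cast hcard
  linarith

/-- The range splits into at most `2 V / q + 1` blocks on each of which the points are `1 / (2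
q)`-spaced, and `card_near_block` applies to each block. -/
lemma sum_near_le_of_approx {γ : ℝ} {a : ℤ} {q : ℕ} (hq : 0 < q) (hcop : IsCoprime a (q : ℤ))
    (hγ : |γ - a / q| ≤ 1 / (q : ℝ) ^ 2) {κ : ℝ} (hκ : 0 ≤ κ) (V : ℕ) :
    ∑ v ∈ Finset.Icc 1 V, near κ (γ * v) ≤ (2 * V / q + 1) * (4 * q * κ + 1) := by
  have hqR : (0 : ℝ) < q := by exact_mod_cast hq
  rw [sum_near_eq_card]
  set A := (Finset.Icc 1 V).filter fun v : ℕ => circNorm (γ * v) ≤ κ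
  -- Two members of a block of this length differ by at most the integer part of `q / 2`, the range
  -- in which `circNorm_mul_ge` is valid.
  set B := q / 2 + 1
  have hmaps : ∀ v ∈ A, (v - 1) / B ∈ Finset.range (V / B + 1) := by
    intro v hv
    have hv := Finset.mem_Icc.1 (Finset.mem_filter.1 hv).1
    rw [Finset.mem_range, Nat.lt_add_one_iff]
    apply Nat.div_le_div_right; omega
  have hsum := Finset.card_eq_sum_card_fiberwise hmaps
  rw [hsum]; push_cast
  have hfib : ∀ i ∈ Finset.range (V / B + 1),
      ((A.filter fun v => (v - 1) / B = i).card : ℝ) ≤ 4 * q * κ + 1 := by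
    intro i _
    refine card_near_block (δ := 0) hq hcop hγ hκ _ (B * i + 1) ?_ ?_
    · intro v hv
      simp only [A, Finset.mem_filter, Finset.mem_Icc] at hv
      obtain ⟨⟨⟨h1, h2⟩, -⟩, h3⟩ := hv
      have hBpos : 0 < B := by omega
      have h4 := Nat.div_add_mod (v - 1) B
      have h5 := Nat.mod_lt (v - 1) hBpos
      rw [h3] at h4
      omega
    · intro v hv
      simp only [A, Finset.mem_filter, Finset.mem_Icc] at hv
      simpa using hv.1.2
  refine (Finset.sum_le_sum hfib).trans ?_
  rw [Finset.sum_const, Finset.card_range, nsmul_eq_mul]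
  gcongr
  push_cast
  have h1 : ((V / B : ℕ) : ℝ) ≤ V / B := Nat.cast_div_le
  have h2 : (q : ℝ) / 2 ≤ B := by
    have : q ≤ 2 * B := by omega
    have : (q : ℝ) ≤ 2 * B := by exact_mod_cast this
    linarith
  have h3 : (V : ℝ) / B ≤ V / (q / 2) := by gcongr
  have h4 : (V : ℝ) / (q / 2) = 2 * V / q := by field_simp
  linarith

/-- A multiple `α g` of a number approximated with denominator `q` is approximated with a
denominator in `[q / (2 g), 2 q]`. -/
lemma exists_approx_mul {α : ℝ} {a : ℤ} {q : ℕ} (hq : 0 < q) (hcop : IsCoprime a (q : ℤ))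
    (hα : |α - a / q| ≤ 1 / (q : ℝ) ^ 2) {g : ℕ} (hg : 0 < g) :
    ∃ (a' : ℤ) (q' : ℕ), 0 < q' ∧ IsCoprime a' (q' : ℤ) ∧
      |α * g - a' / q'| ≤ 1 / (q' : ℝ) ^ 2 ∧ q' ≤ 2 * q ∧ q ≤ 2 * g * q' := by
  -- Denominators up to `2 q`, not `q`: the approximation error then contributes `q / (2 q + 1) < 1
  -- / 2` below, and at least `1 / 2` is left for `g * r.den / q`.
  obtain ⟨r, hr1, hr2⟩ := Real.exists_rat_abs_sub_le_and_den_le (α * g) (n := 2 * q) (by omega)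
  have hqR : (0 : ℝ) < q := by exact_mod_cast hq
  have hgR : (0 : ℝ) < g := by exact_mod_cast hg
  have hdR : (0 : ℝ) < r.den := by exact_mod_cast r.den_pos
  have hrcast : (r : ℝ) = (r.num : ℝ) / r.den := by exact_mod_cast (Rat.num_div_den r).symm
  refine ⟨r.num, r.den, r.den_pos, ?_, ?_, hr2, ?_⟩
  · rw [Int.isCoprime_iff_gcd_eq_one]; exact r.reduced
  · rw [hrcast] at hr1
    refine hr1.trans ?_
    have : (r.den : ℝ) ≤ 2 * q := by exact_mod_cast hr2
    rw [pow_two]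
    gcongr
    push_cast
    linarith
  -- Either `r` equals `g a / q`, and then `q ∣ g * r.den`, or the two fractions differ by at least
  -- `1 / (q * r.den)`.
  · by_cases hE : a * (g * r.den) = r.num * q
    · have h1 : (q : ℤ) ∣ a * (g * r.den) := ⟨r.num, by linarith⟩
      have h2 : (q : ℤ) ∣ g * r.den := hcop.symm.dvd_of_dvd_mul_left h1
      have h3 : q ∣ g * r.den := by exact_mod_cast h2
      have h4 := Nat.le_of_dvd (Nat.mul_pos hg r.den_pos) h3
      nlinarith
    · have h1 : (1 : ℝ) ≤ |((a * (g * r.den) - r.num * q : ℤ) : ℝ)| := by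
        have : 1 ≤ |a * (g * r.den) - r.num * q| := Int.one_le_abs (sub_ne_zero.2 hE)
        exact_mod_cast this
      have h2 : ((a * (g * r.den) - r.num * q : ℤ) : ℝ)
          = ((α * g - r) - (α - a / q) * g) * (q * r.den) := by
        rw [hrcast]; push_cast; field_simp; ring
      have h3 : |(α * g - r) - (α - a / q) * g| ≤
          1 / ((2 * q + 1) * r.den) + 1 / (q : ℝ) ^ 2 * g := by
        refine (abs_sub _ _).trans ?_
        rw [abs_mul, Nat.abs_cast]
        gcongr
        push_cast at hr1; exact hr1
      rw [h2, abs_mul, abs_of_pos (by positivity : (0 : ℝ) < q * r.den)] at h1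
      have h4 : (1 : ℝ) ≤ (1 / ((2 * q + 1) * r.den) + 1 / (q : ℝ) ^ 2 * g) * (q * r.den) :=
        h1.trans (by gcongr)
      have h5 : (1 / ((2 * q + 1) * r.den) + 1 / (q : ℝ) ^ 2 * g) * (q * r.den)
          = q / (2 * q + 1) + g * r.den / q := by field_simp
      rw [h5] at h4
      have h6 : (q : ℝ) / (2 * q + 1) ≤ 1 / 2 := by
        rw [div_le_div_iff₀ (by positivity) (by norm_num)]; linarith
      have h7 : (1 : ℝ) / 2 ≤ g * r.den / q := by linarith
      rw [le_div_iff₀ hqR] at h7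
      have : (q : ℝ) ≤ 2 * g * r.den := by linarith
      exact_mod_cast this

/-- Passing from `α` to `α g` costs little: the lower bound for the new denominator controls `V /
q'` at the price of a factor `g`, and the upper bound controls `q' κ` without any loss in `g`. -/
lemma sum_near_mul_le {α : ℝ} {a : ℤ} {q : ℕ} (hq : 0 < q) (hcop : IsCoprime a (q : ℤ))
    (hα : |α - a / q| ≤ 1 / (q : ℝ) ^ 2) {g : ℕ} (hg : 0 < g) {κ : ℝ} (hκ : 0 ≤ κ) (V : ℕ) :
    ∑ v ∈ Finset.Icc 1 V, near κ (α * g * v) ≤ 8 * V * κ + 4 * g * V / q + 8 * q * κ + 1 := by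
  obtain ⟨a', q', hq', hcop', hα', h1, h2⟩ := exists_approx_mul hq hcop hα hg
  refine (sum_near_le_of_approx hq' hcop' hα' hκ V).trans ?_
  have hqR : (0 : ℝ) < q := by exact_mod_cast hq
  have hqR' : (0 : ℝ) < q' := by exact_mod_cast hq'
  have h1' : (q' : ℝ) ≤ 2 * q := by exact_mod_cast h1
  have h2' : (q : ℝ) ≤ 2 * g * q' := by exact_mod_cast h2
  have e : (2 * (V : ℝ) / q' + 1) * (4 * q' * κ + 1)
      = 8 * V * κ + 2 * V / q' + 4 * q' * κ + 1 := by field_simp; ring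
  rw [e]
  have h3 : 2 * (V : ℝ) / q' ≤ 4 * g * V / q := by
    rw [div_le_div_iff₀ hqR' hqR]
    nlinarith [mul_le_mul_of_nonneg_left h2' (by positivity : (0 : ℝ) ≤ 2 * V)]
  have h4 : 4 * (q' : ℝ) * κ ≤ 8 * q * κ := by nlinarith
  linarith

/-! ### Weyl differencing for sets where a polynomial is near an integer. -/

/-- Squaring the cardinality of a set counts its differences. -/
lemma card_sq_le_sum_shift {B : Finset ℕ} {a X : ℕ} (hB : B ⊆ Finset.Ico a (a + X)) :
    (B.card : ℝ) ^ 2 ≤ X + 2 * ∑ u ∈ Finset.Icc 1 X, ((B.filter fun s => s + u ∈ B).card : ℝ) := by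
  have hlt : ((B ×ˢ B).filter fun p => p.1 < p.2).card
      = ∑ u ∈ Finset.Icc 1 X, (B.filter fun s => s + u ∈ B).card := by
    rw [Finset.card_eq_sum_card_fiberwise (f := fun p : ℕ × ℕ => p.2 - p.1) (t := Finset.Icc 1 X)]
    · refine Finset.sum_congr rfl fun u hu => ?_
      refine Finset.card_bij' (fun p _ => p.1) (fun s _ => (s, s + u)) ?_ ?_ ?_ ?_
      · rintro ⟨p1, p2⟩ hp
        simp only [Finset.mem_filter, Finset.mem_product] at hp ⊢
        obtain ⟨⟨⟨h1, h2⟩, h3⟩, h4⟩ := hp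
        refine ⟨h1, ?_⟩
        have : p1 + u = p2 := by omega
        rwa [this]
      · intro s hs
        simp only [Finset.mem_filter, Finset.mem_product] at hs ⊢
        have := (Finset.mem_Icc.1 hu).1
        refine ⟨⟨⟨hs.1, hs.2⟩, by omega⟩, by omega⟩
      · rintro ⟨p1, p2⟩ hp
        simp only [Finset.mem_filter, Finset.mem_product] at hp
        ext
        · rfl
        · simp only; omega
      · intro s hs; rfl
    · rintro ⟨p1, p2⟩ hp
      rw [Finset.mem_coe] at hp ⊢
      simp only [Finset.mem_filter, Finset.mem_product] at hp
      have h1 := Finset.mem_Ico.1 (hB hp.1.1)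
      have h2 := Finset.mem_Ico.1 (hB hp.1.2)
      rw [Finset.mem_Icc]
      have := hp.2
      change 1 ≤ p2 - p1 ∧ p2 - p1 ≤ X
      omega
  have hgt : ((B ×ˢ B).filter fun p => p.2 < p.1).card
      = ((B ×ˢ B).filter fun p => p.1 < p.2).card := by
    refine Finset.card_bij' (fun p _ => p.swap) (fun p _ => p.swap) ?_ ?_ ?_ ?_ <;>
      simp +contextual
  have heq : ((B ×ˢ B).filter fun p => p.1 = p.2).card ≤ X := by
    calc _ ≤ (Finset.Ico a (a + X)).card := by
          refine Finset.card_le_card_of_injOn (fun p => p.1) ?_ ?_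
          · rintro ⟨p1, p2⟩ hp
            simp only [Finset.coe_filter, Finset.mem_product, Set.mem_ofPred_eq] at hp
            exact hB hp.1.1
          · rintro ⟨p1, p2⟩ hp ⟨p3, p4⟩ hp' h
            simp only [Finset.coe_filter, Finset.mem_product, Set.mem_ofPred_eq] at hp hp' h
            ext <;> simp <;> omega
      _ = X := by simp
  have htot : B.card ^ 2 ≤ ((B ×ˢ B).filter fun p => p.1 = p.2).card
      + ((B ×ˢ B).filter fun p => p.1 < p.2).card + ((B ×ˢ B).filter fun p => p.2 < p.1).card := by
    rw [pow_two, ← Finset.card_product]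
    refine le_trans (Finset.card_le_card ?_) (Finset.card_union_le _ _ |>.trans
      (Nat.add_le_add_right (Finset.card_union_le _ _) _))
    intro p hp
    simp only [Finset.mem_union, Finset.mem_filter]
    rcases lt_trichotomy p.1 p.2 with h | h | h <;> simp [hp, h]
  rw [hgt, hlt] at htot
  have : B.card ^ 2 ≤ X + 2 * ∑ u ∈ Finset.Icc 1 X, (B.filter fun s => s + u ∈ B).card := by omega
  exact_mod_cast this

/-- Subtracting the least element cancels `δ` and doubles the tolerance; the 1 counts the least
element itself. -/
lemma card_linear_le (β δ κ : ℝ) (a X : ℕ) :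
    (((Finset.Ico a (a + X)).filter fun s : ℕ => circNorm (β * s + δ) ≤ κ).card : ℝ)
      ≤ 1 + ∑ v ∈ Finset.Icc 1 X, near (2 * κ) (β * v) := by
  set T := (Finset.Ico a (a + X)).filter fun s : ℕ => circNorm (β * s + δ) ≤ κ with hT
  rw [sum_near_eq_card]
  rcases T.eq_empty_or_nonempty with h | h
  · rw [h]; simp; positivity
  · set m := T.min' h
    have hm := T.min'_mem h
    have h1 : (T.erase m).card ≤
        ((Finset.Icc 1 X).filter fun v : ℕ => circNorm (β * v) ≤ 2 * κ).card := by
      refine Finset.card_le_card_of_injOn (fun s => s - m) ?_ ?_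
      · intro s hs
        simp only [Finset.coe_erase, Set.mem_sdiff, Finset.mem_coe, Set.mem_singleton_iff] at hs
        have hms : m ≤ s := T.min'_le s hs.1
        have hs1 := Finset.mem_filter.1 hs.1
        have hm1 := Finset.mem_filter.1 hm
        have hs2 := Finset.mem_Ico.1 hs1.1
        have hm2 : a ≤ m ∧ m < a + X := Finset.mem_Ico.1 hm1.1
        simp only [Finset.coe_filter, Finset.mem_Icc, Set.mem_ofPred_eq]
        refine ⟨by have := hs.2; omega, ?_⟩
        have e : β * ((s - m : ℕ) : ℝ) = (β * s + δ) - (β * m + δ) := by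
          rw [Nat.cast_sub hms]; ring
        rw [e]
        have h3 : circNorm (β * m + δ) ≤ κ := hm1.2
        exact (circNorm_sub_le _ _).trans (by linarith [hs1.2])
      · intro s hs s' hs' heq
        simp only [Finset.coe_erase, Set.mem_sdiff, Finset.mem_coe, Set.mem_singleton_iff] at hs hs'
        have := T.min'_le s hs.1
        have := T.min'_le s' hs'.1
        simp only at heq
        omega
    have h2 : T.card = (T.erase m).card + 1 := (Finset.card_erase_add_one hm).symm
    rw [h2]; push_cast
    have : ((T.erase m).card : ℝ) ≤
        (((Finset.Icc 1 X).filter fun v : ℕ => circNorm (β * v) ≤ 2 * κ).card : ℝ) := by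
      exact_mod_cast h1
    linarith

/-- Weyl differencing for the set where a quadratic polynomial is near an integer. -/
lemma card_quadratic_sq_le (A β δ κ : ℝ) (a X : ℕ) :
    (((Finset.Ico a (a + X)).filter fun s : ℕ =>
        circNorm (A * (s : ℝ) ^ 2 + β * s + δ) ≤ κ).card : ℝ) ^ 2
      ≤ 3 * X + 2 * ∑ u ∈ Finset.Icc 1 X, ∑ v ∈ Finset.Icc 1 X,
          near (4 * κ) (2 * A * (u * v : ℕ)) := by
  set B := (Finset.Ico a (a + X)).filter fun s : ℕ =>
    circNorm (A * (s : ℝ) ^ 2 + β * s + δ) ≤ κ with hBdef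
  refine (card_sq_le_sum_shift (Finset.filter_subset _ _)).trans ?_
  have h1 : ∀ u ∈ Finset.Icc 1 X, ((B.filter fun s => s + u ∈ B).card : ℝ) ≤
      1 + ∑ v ∈ Finset.Icc 1 X, near (4 * κ) (2 * A * (u * v : ℕ)) := by
    intro u _
    -- The difference of two `κ`-close values is `2 κ`-close, and the linear step doubles the
    -- tolerance once more.
    have h2 := card_linear_le (2 * A * u) (A * u ^ 2 + β * u) (2 * κ) a X
    have h3 : ∀ v : ℕ, near (4 * κ) (2 * A * (u * v : ℕ)) = near (2 * (2 * κ)) (2 * A * u * v) := by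
      intro v; push_cast; congr 1 <;> ring
    simp only [h3]
    refine le_trans ?_ h2
    apply Nat.cast_le.2
    apply Finset.card_le_card
    intro s hs
    simp only [hBdef, Finset.mem_filter] at hs ⊢
    refine ⟨hs.1.1, ?_⟩
    have e : 2 * A * u * s + (A * u ^ 2 + β * u)
        = (A * ((s + u : ℕ) : ℝ) ^ 2 + β * ((s + u : ℕ) : ℝ) + δ)
          - (A * (s : ℝ) ^ 2 + β * s + δ) := by push_cast; ring
    rw [e]
    exact (circNorm_sub_le _ _).trans (by linarith [hs.1.2, hs.2.2])
  have h4 := Finset.sum_le_sum h1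
  rw [Finset.sum_add_distrib] at h4
  simp only [Finset.sum_const, Nat.card_Icc, nsmul_eq_mul, mul_one, Nat.add_sub_cancel] at h4
  linarith

/-- Two Weyl differencings for the set where a cubic monomial is near an integer. -/
lemma card_cubic_pow_le (γ κ : ℝ) (a : ℕ) {X : ℕ} (hX : 1 ≤ X) :
    (((Finset.Ico a (a + X)).filter fun s : ℕ =>
        circNorm (γ * (s : ℝ) ^ 3) ≤ κ).card : ℝ) ^ 4
      ≤ 26 * (X : ℝ) ^ 3 + 16 * X * ∑ w ∈ Finset.Icc 1 X, ∑ u ∈ Finset.Icc 1 X,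
        ∑ v ∈ Finset.Icc 1 X, near (8 * κ) (6 * γ * (w * (u * v) : ℕ)) := by
  set B := (Finset.Ico a (a + X)).filter fun s : ℕ => circNorm (γ * (s : ℝ) ^ 3) ≤ κ with hBdef
  set Q : ℕ → ℝ := fun w => (((Finset.Ico a (a + X)).filter fun s : ℕ =>
    circNorm ((3 * γ * w) * (s : ℝ) ^ 2 + (3 * γ * w ^ 2) * s + γ * w ^ 3) ≤ 2 * κ).card : ℝ)
    with hQ
  set G : ℕ → ℝ := fun w => ∑ u ∈ Finset.Icc 1 X,
        ∑ v ∈ Finset.Icc 1 X, near (8 * κ) (6 * γ * (w * (u * v) : ℕ)) with hG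
  have hXR : (1 : ℝ) ≤ X := by exact_mod_cast hX
  have hQ2 : ∀ w, Q w ^ 2 ≤ 3 * X + 2 * G w := by
    intro w
    refine (card_quadratic_sq_le _ _ _ _ _ _).trans (le_of_eq ?_)
    simp only [hG]
    congr 2
    refine Finset.sum_congr rfl fun u _ => Finset.sum_congr rfl fun v _ => ?_
    push_cast; congr 1 <;> ring
  -- The first differencing turns the cubic, for a fixed shift `w`, into the quadratic counted by `Q
  -- w`.
  have hBQ : (B.card : ℝ) ^ 2 ≤ X + 2 * ∑ w ∈ Finset.Icc 1 X, Q w := by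
    refine (card_sq_le_sum_shift (Finset.filter_subset _ _)).trans ?_
    gcongr with w hw
    simp only [hQ]
    apply Nat.cast_le.2
    apply Finset.card_le_card
    intro s hs
    simp only [Finset.mem_filter] at hs ⊢
    refine ⟨hs.1.1, ?_⟩
    have e : (3 * γ * w) * (s : ℝ) ^ 2 + (3 * γ * w ^ 2) * s + γ * w ^ 3
        = γ * ((s + w : ℕ) : ℝ) ^ 3 - γ * (s : ℝ) ^ 3 := by push_cast; ring
    rw [e]
    exact (circNorm_sub_le _ _).trans (by linarith [hs.1.2, hs.2.2])
  -- Only `Q w ^ 2` is controlled by the second differencing, hence a Cauchy inequality over the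
  -- shifts.
  have hsumQ : (∑ w ∈ Finset.Icc 1 X, Q w) ^ 2 ≤ X * ∑ w ∈ Finset.Icc 1 X, Q w ^ 2 := by
    have := sq_sum_le_card_mul_sum_sq (s := Finset.Icc 1 X) (f := Q)
    simpa using this
  have hsumQ2 : ∑ w ∈ Finset.Icc 1 X, Q w ^ 2 ≤ 3 * X ^ 2 + 2 * ∑ w ∈ Finset.Icc 1 X, G w := by
    refine (Finset.sum_le_sum fun w _ => hQ2 w).trans (le_of_eq ?_)
    rw [Finset.sum_add_distrib, Finset.mul_sum]
    simp; ring
  set SQ := ∑ w ∈ Finset.Icc 1 X, Q w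
  have hSQ0 : 0 ≤ SQ := Finset.sum_nonneg fun w _ => by positivity
  calc (B.card : ℝ) ^ 4 = ((B.card : ℝ) ^ 2) ^ 2 := by ring
    _ ≤ (X + 2 * SQ) ^ 2 := by gcongr
    _ ≤ 2 * X ^ 2 + 8 * SQ ^ 2 := by nlinarith [sq_nonneg ((X : ℝ) - 2 * SQ)]
    _ ≤ 2 * X ^ 2 + 8 * (X * (3 * X ^ 2 + 2 * ∑ w ∈ Finset.Icc 1 X, G w)) := by
        gcongr; exact hsumQ.trans (by gcongr)
    _ ≤ _ := by nlinarith [mul_nonneg (sq_nonneg (X : ℝ)) (sub_nonneg.2 hXR)]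

/-! ### Merging variables by the divisor bound, and the standing parameters. -/

/-- Products `u v` with `u ≤ A`, `v ≤ B` take each value at most `F` times. -/
lemma sum_mul_le_divisor_bound {F : ℝ} {A B : ℕ} (f : ℕ → ℝ) (hf : ∀ n, 0 ≤ f n)
    (hF : ∀ n : ℕ, 1 ≤ n → n ≤ A * B → (n.divisors.card : ℝ) ≤ F) :
    ∑ u ∈ Finset.Icc 1 A, ∑ v ∈ Finset.Icc 1 B, f (u * v)
      ≤ F * ∑ n ∈ Finset.Icc 1 (A * B), f n := by
  rw [← Finset.sum_product']
  have hmaps : ∀ p ∈ Finset.Icc 1 A ×ˢ Finset.Icc 1 B, p.1 * p.2 ∈ Finset.Icc 1 (A * B) := by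
    rintro ⟨u, v⟩ hp
    simp only [Finset.mem_product, Finset.mem_Icc] at hp ⊢
    exact ⟨Nat.mul_pos hp.1.1 hp.2.1, Nat.mul_le_mul hp.1.2 hp.2.2⟩
  rw [← Finset.sum_fiberwise_of_maps_to hmaps, Finset.mul_sum]
  refine Finset.sum_le_sum fun n hn => ?_
  have hn := Finset.mem_Icc.1 hn
  calc _ = ∑ p ∈ (Finset.Icc 1 A ×ˢ Finset.Icc 1 B).filter (fun p => p.1 * p.2 = n), f n := by
        refine Finset.sum_congr rfl fun p hp => ?_
        rw [(Finset.mem_filter.1 hp).2]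
    _ ≤ F * f n := by
        rw [Finset.sum_const, nsmul_eq_mul]
        gcongr
        · exact hf n
        refine le_trans ?_ (hF n hn.1 hn.2)
        norm_cast
        refine Finset.card_le_card_of_injOn (fun p => p.1) ?_ ?_
        · rintro ⟨u, v⟩ hp
          simp only [Finset.coe_filter, Set.mem_ofPred_eq] at hp
          simp only [Finset.mem_coe, Nat.mem_divisors]
          exact ⟨⟨v, hp.2.symm⟩, by omega⟩
        · rintro ⟨u, v⟩ hp ⟨u', v'⟩ hp' h
          simp only [Finset.coe_filter, Set.mem_ofPred_eq] at hp hp' h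
          subst h
          have h1 : u * v = u * v' := hp.2.trans hp'.2.symm
          have hu : 0 < u := by
            have := hp.1; simp at this; omega
          rw [Nat.eq_of_mul_eq_mul_left hu h1]

/-- The quantities of the argument: `α` is approximated with denominator `q`, which is also the
length of the sums; `t ^ 80` is the loss in the level, and `F` bounds divisor functions and
logarithms. -/
structure Setting (α : ℝ) (q : ℕ) (t F : ℝ) : Prop where
  q_pos : 0 < q
  approx : ∃ a : ℤ, IsCoprime a (q : ℤ) ∧ |α - a / q| ≤ 1 / (q : ℝ) ^ 2
  le_F : 1000000 ≤ F
  F_pow_le : F ^ 1000 ≤ t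
  t_pow_le : t ^ 392 ≤ q
  divisors_le : ∀ n : ℕ, 1 ≤ n → (n : ℝ) ≤ (q : ℝ) ^ 10 → (n.divisors.card : ℝ) ≤ F
  log_le : 100 * Real.log q ≤ F

namespace Setting

variable {α : ℝ} {q : ℕ} {t F : ℝ}

lemma F_pos (h : Setting α q t F) : 0 < F := by linarith [h.le_F]

lemma one_le_F (h : Setting α q t F) : 1 ≤ F := by linarith [h.le_F]

lemma one_le_t (h : Setting α q t F) : 1 ≤ t :=
  (one_le_pow₀ h.one_le_F).trans h.F_pow_le

lemma t_pos (h : Setting α q t F) : 0 < t := by linarith [h.one_le_t]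

lemma F_pow_le_t (h : Setting α q t F) {n : ℕ} (hn : n ≤ 1000) : F ^ n ≤ t :=
  (pow_le_pow_right₀ h.one_le_F hn).trans h.F_pow_le

lemma q_posR (h : Setting α q t F) : (0 : ℝ) < q := by exact_mod_cast h.q_pos

lemma one_le_q (h : Setting α q t F) : (1 : ℝ) ≤ q := by exact_mod_cast h.q_pos

lemma t_pow_le_q (h : Setting α q t F) {n : ℕ} (hn : n ≤ 392) : t ^ n ≤ q :=
  (pow_le_pow_right₀ h.one_le_t hn).trans h.t_pow_le

lemma sum_near_le (h : Setting α q t F) {g : ℕ} (hg : 0 < g) {κ : ℝ} (hκ : 0 ≤ κ) (V : ℕ) :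
    ∑ v ∈ Finset.Icc 1 V, near κ (α * g * v) ≤ 8 * V * κ + 4 * g * V / q + 8 * q * κ + 1 := by
  obtain ⟨a, h1, h2⟩ := h.approx
  exact sum_near_mul_le h.q_pos h1 h2 hg hκ V

end Setting

/-! ### The count for `α g h³ y`. -/

/-- The number of `(y, h)` with `y ≤ Y`, `h ∼ X` and `α g h³ y` within `κ` of an integer. -/
def cubicCount (α κ : ℝ) (g X Y : ℕ) : ℝ :=
  ∑ y ∈ Finset.Icc 1 Y, ∑ h ∈ Finset.Ico X (X + X), near κ (α * (g * h ^ 3 : ℕ) * y)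

lemma cubicCount_nonneg (α κ : ℝ) (g X Y : ℕ) : 0 ≤ cubicCount α κ g X Y :=
  Finset.sum_nonneg fun _ _ => Finset.sum_nonneg fun _ _ => near_nonneg _ _

section

variable {α : ℝ} {q : ℕ} {t F : ℝ}

/-- With `h` frozen the phase is linear in `y` with multiplier `g h³ ≤ 8 g X³`. No saving is lost to
Cauchy's inequality, but the bound is useful only while `X³` is small compared with `q`. -/
lemma cubicCount_le_of_fixed (hs : Setting α q t F) {κ : ℝ} (hκ : 0 ≤ κ) {g : ℕ} (hg : 0 < g)
    (X Y : ℕ) :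
    cubicCount α κ g X Y ≤ X * (8 * Y * κ + 32 * g * X ^ 3 * Y / q + 8 * q * κ + 1) := by
  have hq := hs.q_posR
  unfold cubicCount
  rw [Finset.sum_comm]
  have : ∀ h ∈ Finset.Ico X (X + X), ∑ y ∈ Finset.Icc 1 Y, near κ (α * (g * h ^ 3 : ℕ) * y)
      ≤ 8 * Y * κ + 32 * g * X ^ 3 * Y / q + 8 * q * κ + 1 := by
    intro h hh
    have hh := Finset.mem_Ico.1 hh
    refine (hs.sum_near_le (Nat.mul_pos hg (pow_pos (by omega) 3)) hκ Y).trans ?_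
    have h1 : (h : ℝ) ≤ 2 * X := by
      have : h ≤ 2 * X := by omega
      exact_mod_cast this
    have h2 : 4 * ((g * h ^ 3 : ℕ) : ℝ) * Y ≤ 32 * g * X ^ 3 * Y := by
      push_cast
      calc 4 * ((g : ℝ) * h ^ 3) * Y ≤ 4 * ((g : ℝ) * (2 * X) ^ 3) * Y := by gcongr
        _ = _ := by ring
    gcongr
  refine (Finset.sum_le_sum this).trans (le_of_eq ?_)
  simp
  ring

/-- Hölder's inequality in `y` allows `card_cubic_pow_le` for each `y`. The variables `y, w, u, v`
are then merged into one integer up to `Y X³`; each of the three merges costs a divisor bound `F`,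
and a linear count with multiplier `6 g` and tolerance `8 κ` is left. -/
lemma cubicCount_pow_le (hs : Setting α q t F) {κ : ℝ} (hκ : 0 ≤ κ) {g X Y : ℕ} (hg : 0 < g)
    (hX : 0 < X) (hXY : (Y : ℝ) * X ^ 3 ≤ (q : ℝ) ^ 10) :
    cubicCount α κ g X Y ^ 4 ≤ (Y : ℝ) ^ 3 * (26 * Y * X ^ 3 + 16 * X * (F ^ 3 *
      (64 * (Y * X ^ 3) * κ + 24 * g * (Y * X ^ 3) / q + 64 * q * κ + 1))) := by
  have hF := hs.F_pos
  set b : ℕ → ℝ := fun y => ∑ h ∈ Finset.Ico X (X + X), near κ (α * (g * h ^ 3 : ℕ) * y) with hb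
  have hb0 : ∀ y, 0 ≤ b y := fun y => Finset.sum_nonneg fun _ _ => near_nonneg _ _
  have h1 : cubicCount α κ g X Y ^ 4 ≤ (Y : ℝ) ^ 3 * ∑ y ∈ Finset.Icc 1 Y, b y ^ 4 := by
    have h2 := sq_sum_le_card_mul_sum_sq (s := Finset.Icc 1 Y) (f := b)
    have h3 := sq_sum_le_card_mul_sum_sq (s := Finset.Icc 1 Y) (f := fun y => b y ^ 2)
    simp only [Nat.card_Icc, Nat.add_sub_cancel] at h2 h3
    have h4 : cubicCount α κ g X Y = ∑ y ∈ Finset.Icc 1 Y, b y := rfl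
    rw [h4]
    calc (∑ y ∈ Finset.Icc 1 Y, b y) ^ 4 = ((∑ y ∈ Finset.Icc 1 Y, b y) ^ 2) ^ 2 := by ring
      _ ≤ (Y * ∑ y ∈ Finset.Icc 1 Y, b y ^ 2) ^ 2 := by gcongr
      _ = Y ^ 2 * (∑ y ∈ Finset.Icc 1 Y, b y ^ 2) ^ 2 := by ring
      _ ≤ Y ^ 2 * (Y * ∑ y ∈ Finset.Icc 1 Y, (b y ^ 2) ^ 2) := by gcongr
      _ = _ := by simp only [← pow_mul]; ring
  set G : ℕ → ℝ := fun n => near (8 * κ) (α * (6 * g : ℕ) * n) with hG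
  have hG0 : ∀ n, 0 ≤ G n := fun n => near_nonneg _ _
  have h2 : ∀ y ∈ Finset.Icc 1 Y, b y ^ 4 ≤ 26 * (X : ℝ) ^ 3 + 16 * X *
      ∑ w ∈ Finset.Icc 1 X, ∑ u ∈ Finset.Icc 1 X, ∑ v ∈ Finset.Icc 1 X, G (y * (w * (u * v))) := by
    intro y _
    have h3 := card_cubic_pow_le (α * g * y) κ X (X := X) hX
    have h4 : b y = (((Finset.Ico X (X + X)).filter fun s : ℕ =>
        circNorm (α * g * y * (s : ℝ) ^ 3) ≤ κ).card : ℝ) := by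
      simp only [hb]
      rw [← sum_near_eq_card]
      refine Finset.sum_congr rfl fun h _ => ?_
      push_cast; congr 1; ring
    rw [h4]
    refine h3.trans (le_of_eq ?_)
    congr 2
    refine Finset.sum_congr rfl fun w _ => Finset.sum_congr rfl fun u _ =>
      Finset.sum_congr rfl fun v _ => ?_
    simp only [hG]; push_cast; congr 1; ring
  have hN : ((Y * (X * (X * X)) : ℕ) : ℝ) = Y * X ^ 3 := by push_cast; ring
  have hdiv : ∀ n : ℕ, 1 ≤ n → n ≤ Y * (X * (X * X)) → (n.divisors.card : ℝ) ≤ F := by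
    intro n hn hn2
    refine hs.divisors_le n hn (le_trans ?_ (hN.trans_le hXY))
    exact_mod_cast hn2
  have h5 : ∑ y ∈ Finset.Icc 1 Y, ∑ w ∈ Finset.Icc 1 X, ∑ u ∈ Finset.Icc 1 X,
      ∑ v ∈ Finset.Icc 1 X, G (y * (w * (u * v)))
      ≤ F ^ 3 * ∑ n ∈ Finset.Icc 1 (Y * (X * (X * X))), G n := by
    have s1 : ∀ y ∈ Finset.Icc 1 Y, ∀ w ∈ Finset.Icc 1 X, ∑ u ∈ Finset.Icc 1 X,
      ∑ v ∈ Finset.Icc 1 X, G (y * (w * (u * v)))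
      ≤ F * ∑ n ∈ Finset.Icc 1 (X * X), G (y * (w * n)) := by
      intro y hy w hw
      refine sum_mul_le_divisor_bound (fun n => G (y * (w * n))) (fun _ => hG0 _) ?_
      intro n hn hn2
      have hy := (Finset.mem_Icc.1 hy).1.trans (Finset.mem_Icc.1 hy).2
      refine hdiv n hn (hn2.trans ?_)
      have h3 : 1 ≤ Y * X := Nat.mul_pos hy hX
      nlinarith [Nat.mul_le_mul_right (X * X) h3]
    have s2 : ∀ y ∈ Finset.Icc 1 Y, ∑ w ∈ Finset.Icc 1 X,
      ∑ n ∈ Finset.Icc 1 (X * X), G (y * (w * n))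
      ≤ F * ∑ n ∈ Finset.Icc 1 (X * (X * X)), G (y * n) := by
      intro y hy
      refine sum_mul_le_divisor_bound (fun n => G (y * n)) (fun _ => hG0 _) ?_
      intro n hn hn2
      have hy := (Finset.mem_Icc.1 hy).1.trans (Finset.mem_Icc.1 hy).2
      exact hdiv n hn (hn2.trans (Nat.le_mul_of_pos_left _ hy))
    have s3 := sum_mul_le_divisor_bound (A := Y) (B := X * (X * X)) G hG0 hdiv
    calc _ ≤ ∑ y ∈ Finset.Icc 1 Y, ∑ w ∈ Finset.Icc 1 X,
          F * ∑ n ∈ Finset.Icc 1 (X * X), G (y * (w * n)) :=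
          Finset.sum_le_sum fun y hy => Finset.sum_le_sum fun w hw => s1 y hy w hw
      _ = F * ∑ y ∈ Finset.Icc 1 Y, ∑ w ∈ Finset.Icc 1 X,
          ∑ n ∈ Finset.Icc 1 (X * X), G (y * (w * n)) := by simp only [Finset.mul_sum]
      _ ≤ F * ∑ y ∈ Finset.Icc 1 Y, (F * ∑ n ∈ Finset.Icc 1 (X * (X * X)), G (y * n)) := by
          gcongr with y hy
          exact s2 y hy
      _ = F * (F * ∑ y ∈ Finset.Icc 1 Y, ∑ n ∈ Finset.Icc 1 (X * (X * X)), G (y * n)) := by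
          simp only [Finset.mul_sum]
      _ ≤ F * (F * (F * ∑ n ∈ Finset.Icc 1 (Y * (X * (X * X))), G n)) := by gcongr
      _ = _ := by ring
  have h6 := hs.sum_near_le (g := 6 * g) (by omega) (κ := 8 * κ) (by positivity)
    (Y * (X * (X * X)))
  rw [hN] at h6
  have h7 : ∑ n ∈ Finset.Icc 1 (Y * (X * (X * X))), G n ≤
      64 * (Y * X ^ 3) * κ + 24 * g * (Y * X ^ 3) / q + 64 * q * κ + 1 := by
    refine h6.trans (le_of_eq ?_)
    push_cast; ring
  refine h1.trans ?_
  gcongr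
  refine (Finset.sum_le_sum h2).trans ?_
  rw [Finset.sum_add_distrib]
  have h8 : (∑ _y ∈ Finset.Icc 1 Y, (26 * (X : ℝ) ^ 3 : ℝ) : ℝ) = 26 * Y * X ^ 3 := by
    rw [Finset.sum_const, Nat.card_Icc, Nat.add_sub_cancel, nsmul_eq_mul]; ring
  rw [h8, ← Finset.mul_sum]
  gcongr
  exact h5.trans (by gcongr)

/-- Saving in the cubic count for short ranges of the cubed variable. -/
lemma cubicCount_mul_le (hs : Setting α q t F) {κ B : ℝ} (hκ : 0 ≤ κ) {g X Y : ℕ} (hg : 0 < g)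
    (hXt : (X : ℝ) ≤ t ^ 88) (hB : 0 < B) (hκB : κ * B ≤ 4)
    (hgB : g * t ^ 284 * B ≤ 4 * q) (hqκ : 1 ≤ q * κ)
    (hΩ : q ^ 2 * κ ≤ 4 * t ^ 20 * (g * Y * X ^ 3)) :
    cubicCount α κ g X Y * B ≤ 304 * (X * Y) := by
  have hq := hs.q_posR
  have ht := hs.one_le_t
  have htp := hs.t_pos
  have h0 := cubicCount_le_of_fixed hs hκ hg X Y
  -- Here `264 = 3 * 88`; with the `t ^ 20` lost in `hΩ` it makes the exponent 284 of `hgB`.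
  have hX3 : (X : ℝ) ^ 3 ≤ t ^ 264 := by
    calc (X : ℝ) ^ 3 ≤ (t ^ 88) ^ 3 := by gcongr
      _ = t ^ 264 := by ring
  have e1 : 8 * Y * κ * B ≤ 32 * Y := by nlinarith [(Nat.cast_nonneg Y : (0 : ℝ) ≤ Y)]
  have e2 : 32 * g * X ^ 3 * Y / q * B ≤ 128 * (Y : ℝ) := by
    rw [div_mul_eq_mul_div, div_le_iff₀ hq]
    have : (g : ℝ) * X ^ 3 * B ≤ 4 * q := by
      refine le_trans ?_ hgB
      gcongr
      exact hX3.trans (pow_le_pow_right₀ ht (by norm_num))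
    nlinarith [(Nat.cast_nonneg Y : (0 : ℝ) ≤ Y)]
  -- This part does not grow with `Y`; it is absorbed because `hΩ` makes `g Y X³` at least about `q²
  -- κ / t ^ 20`.
  have e3 : (8 * q * κ + 1) * B ≤ 144 * Y := by
    have h1 : (8 * q * κ + 1) * B ≤ 9 * (q * κ) * B := by gcongr; linarith
    have h2 : q * κ * B * q ≤ 16 * Y * q := by
      calc q * κ * B * q = q ^ 2 * κ * B := by ring
        _ ≤ 4 * t ^ 20 * (g * Y * X ^ 3) * B := by gcongr
        _ ≤ 4 * t ^ 20 * (g * Y * t ^ 264) * B := by gcongr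
        _ = 4 * Y * (g * t ^ 284 * B) := by ring
        _ ≤ 4 * Y * (4 * q) := by gcongr
        _ = _ := by ring
    have h3 := le_of_mul_le_mul_right h2 hq
    linarith
  calc cubicCount α κ g X Y * B
      ≤ X * (8 * Y * κ + 32 * g * X ^ 3 * Y / q + 8 * q * κ + 1) * B := by gcongr
    _ = X * (8 * Y * κ * B + 32 * g * X ^ 3 * Y / q * B + (8 * q * κ + 1) * B) := by ring
    _ ≤ X * (32 * Y + 128 * Y + 144 * Y) := by gcongr
    _ = _ := by ring

/-- Saving in the cubic count for long ranges of the cubed variable. -/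
lemma cubicCount_pow_mul_le (hs : Setting α q t F) {κ B : ℝ} (hκ : 0 ≤ κ) {g X Y : ℕ}
    (hg : 0 < g) (hX : 0 < X) (hXB : B ≤ X) (hB : 0 < B) (hκB : κ * B ≤ 4)
    (hgB : g * t ^ 284 * B ≤ 4 * q) (hqκ : 1 ≤ q * κ) (hXY : (Y : ℝ) * X ^ 3 ≤ (q : ℝ) ^ 10)
    (hΩ : q ^ 2 * κ ≤ 4 * t ^ 20 * (g * Y * X ^ 3)) :
    cubicCount α κ g X Y ^ 4 * B ≤ 23000 * F ^ 3 * (X * Y) ^ 4 := by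
  have hq := hs.q_posR
  have ht := hs.one_le_t
  have htp := hs.t_pos
  have hF := hs.one_le_F
  have h0 := cubicCount_pow_le hs hκ hg hX hXY
  have hX0 : (0 : ℝ) < X := by exact_mod_cast hX
  set P : ℝ := Y * X ^ 3 with hP
  have hP0 : 0 ≤ P := by positivity
  have hgB' : g * t ^ 20 * B ≤ 4 * q := by
    refine le_trans ?_ hgB
    gcongr
    norm_num
  -- The diagonal terms of the differencing save only a factor `X`, whence the requirement `B ≤ X`.
  have e1 : 26 * Y * X ^ 3 * B ≤ 26 * (Y * X ^ 4 : ℝ) := by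
    calc 26 * Y * X ^ 3 * B ≤ 26 * Y * X ^ 3 * (X : ℝ) := by gcongr
      _ = _ := by ring
  have e2 : 64 * P * κ * B ≤ 256 * P := by nlinarith
  have e3 : 24 * g * P / q * B ≤ 96 * P := by
    rw [div_mul_eq_mul_div, div_le_iff₀ hq]
    have : (g : ℝ) * B ≤ 4 * q := by
      refine le_trans ?_ hgB'
      have : (1 : ℝ) ≤ t ^ 20 := one_le_pow₀ ht
      have h3 : (0 : ℝ) ≤ g * B := by positivity
      nlinarith
    nlinarith
  have e4 : (64 * q * κ + 1) * B ≤ 1040 * P := by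
    have h1 : (64 * q * κ + 1) * B ≤ 65 * (q * κ) * B := by gcongr; linarith
    have h2 : q * κ * B * q ≤ 16 * P * q := by
      calc q * κ * B * q = q ^ 2 * κ * B := by ring
        _ ≤ 4 * t ^ 20 * (g * Y * X ^ 3) * B := by gcongr
        _ = 4 * P * (g * t ^ 20 * B) := by rw [hP]; ring
        _ ≤ 4 * P * (4 * q) := by gcongr
        _ = _ := by ring
    have h3 := le_of_mul_le_mul_right h2 hq
    linarith
  calc cubicCount α κ g X Y ^ 4 * B ≤ (Y : ℝ) ^ 3 * (26 * Y * X ^ 3 + 16 * X * (F ^ 3 *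
      (64 * P * κ + 24 * g * P / q + 64 * q * κ + 1))) * B := by gcongr
    _ = (Y : ℝ) ^ 3 * (26 * Y * X ^ 3 * B + 16 * X * (F ^ 3 *
      (64 * P * κ * B + 24 * g * P / q * B + (64 * q * κ + 1) * B))) := by ring
    _ ≤ (Y : ℝ) ^ 3 * (26 * (Y * X ^ 4 : ℝ) + 16 * X * (F ^ 3 *
      (256 * P + 96 * P + 1040 * P))) := by gcongr
    _ = (26 + 22272 * F ^ 3) * (X * Y) ^ 4 := by rw [hP]; ring
    _ ≤ 23000 * F ^ 3 * (X * Y) ^ 4 := by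
        have : 1 ≤ F ^ 3 := one_le_pow₀ hF
        gcongr; linarith

end

/-! ### The count for `α h³ s² w`. -/

/-- The number of `(h, s, w)` with `h ∼ H`, `s ∼ S`, `w ≤ W` and `α h³ s² w` within `κ` of an
integer. -/
def mixedCount (α κ : ℝ) (H S W : ℕ) : ℝ :=
  ∑ h ∈ Finset.Ico H (H + H), ∑ s ∈ Finset.Ico S (S + S), ∑ w ∈ Finset.Icc 1 W,
    near κ (α * (h ^ 3 * s ^ 2 * w : ℕ))

lemma mixedCount_nonneg (α κ : ℝ) (H S W : ℕ) : 0 ≤ mixedCount α κ H S W :=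
  Finset.sum_nonneg fun _ _ => Finset.sum_nonneg fun _ _ => Finset.sum_nonneg fun _ _ =>
    near_nonneg _ _

section

variable {α : ℝ} {q : ℕ} {t F : ℝ}

lemma mixedCount_eq_sum_cubicCount (α κ : ℝ) (H S W : ℕ) :
    mixedCount α κ H S W = ∑ s ∈ Finset.Ico S (S + S), cubicCount α κ (s ^ 2) H W := by
  unfold mixedCount cubicCount
  rw [Finset.sum_comm]
  refine Finset.sum_congr rfl fun s _ => ?_
  rw [Finset.sum_comm]
  refine Finset.sum_congr rfl fun w _ => Finset.sum_congr rfl fun h _ => ?_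
  push_cast; congr 1; ring

/-- The square variable is differenced. -/
lemma mixedCount_sq_le (hs : Setting α q t F) (κ : ℝ) {H S W : ℕ}
    (hsize : (W : ℝ) * S ^ 2 ≤ (q : ℝ) ^ 10) (hW : 0 < W) :
    mixedCount α κ H S W ^ 2 ≤ H * W * (3 * S * (H * W) +
      2 * (F ^ 2 * cubicCount α (4 * κ) 2 H (W * (S * S)))) := by
  have hF := hs.F_pos
  set b : ℕ → ℕ → ℝ := fun h w => ∑ s ∈ Finset.Ico S (S + S), near κ (α * (h ^ 3 * s ^ 2 * w : ℕ))
    with hb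
  have e1 : mixedCount α κ H S W
      = ∑ p ∈ Finset.Ico H (H + H) ×ˢ Finset.Icc 1 W, b p.1 p.2 := by
    unfold mixedCount
    rw [Finset.sum_product]
    refine Finset.sum_congr rfl fun h _ => ?_
    rw [Finset.sum_comm]
  have h1 : mixedCount α κ H S W ^ 2
      ≤ H * W * ∑ p ∈ Finset.Ico H (H + H) ×ˢ Finset.Icc 1 W, b p.1 p.2 ^ 2 := by
    have := sq_sum_le_card_mul_sum_sq (s := Finset.Ico H (H + H) ×ˢ Finset.Icc 1 W)
      (f := fun p => b p.1 p.2)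
    rw [e1]
    simpa using this
  set G : ℕ → ℕ → ℝ := fun h n => near (4 * κ) (α * (2 * h ^ 3 : ℕ) * n) with hG
  have hG0 : ∀ h n, 0 ≤ G h n := fun h n => near_nonneg _ _
  have h2 : ∀ h w, b h w ^ 2 ≤ 3 * S + 2 * ∑ u ∈ Finset.Icc 1 S, ∑ v ∈ Finset.Icc 1 S,
      G h (w * (u * v)) := by
    -- Squaring is Cauchy's inequality over `(h, w)`, and one differencing replaces `s²` by `2 u v`.
    -- Below, `w u v` becomes a single `y ≤ W S²`, which produces the cubic count with `g = 2`.
    intro h w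
    have h3 := card_quadratic_sq_le (α * (h ^ 3 * w)) 0 0 κ S S
    have h4 : b h w = (((Finset.Ico S (S + S)).filter fun s : ℕ =>
        circNorm (α * (h ^ 3 * w) * (s : ℝ) ^ 2 + 0 * s + 0) ≤ κ).card : ℝ) := by
      simp only [hb]
      rw [← sum_near_eq_card]
      refine Finset.sum_congr rfl fun s _ => ?_
      push_cast; congr 1; ring
    rw [h4]
    refine h3.trans (le_of_eq ?_)
    congr 2
    refine Finset.sum_congr rfl fun u _ => Finset.sum_congr rfl fun v _ => ?_
    simp only [hG]; push_cast; congr 1; ring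
  have hdiv : ∀ n : ℕ, 1 ≤ n → n ≤ W * (S * S) → (n.divisors.card : ℝ) ≤ F := by
    intro n hn hn2
    refine hs.divisors_le n hn (le_trans ?_ hsize)
    have : (n : ℝ) ≤ (W * (S * S) : ℕ) := by exact_mod_cast hn2
    refine this.trans (le_of_eq ?_)
    push_cast; ring
  have h5 : ∀ h, ∑ w ∈ Finset.Icc 1 W, ∑ u ∈ Finset.Icc 1 S, ∑ v ∈ Finset.Icc 1 S,
      G h (w * (u * v)) ≤ F ^ 2 * ∑ y ∈ Finset.Icc 1 (W * (S * S)), G h y := by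
    intro h
    have s1 : ∀ w ∈ Finset.Icc 1 W, ∑ u ∈ Finset.Icc 1 S, ∑ v ∈ Finset.Icc 1 S,
        G h (w * (u * v)) ≤ F * ∑ n ∈ Finset.Icc 1 (S * S), G h (w * n) := by
      intro w _
      refine sum_mul_le_divisor_bound (fun n => G h (w * n)) (fun _ => hG0 _ _) ?_
      intro n hn hn2
      exact hdiv n hn (hn2.trans (Nat.le_mul_of_pos_left _ hW))
    have s2 := sum_mul_le_divisor_bound (A := W) (B := S * S) (G h) (hG0 h) hdiv
    calc _ ≤ ∑ w ∈ Finset.Icc 1 W, F * ∑ n ∈ Finset.Icc 1 (S * S), G h (w * n) :=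
          Finset.sum_le_sum s1
      _ = F * ∑ w ∈ Finset.Icc 1 W, ∑ n ∈ Finset.Icc 1 (S * S), G h (w * n) := by
          rw [Finset.mul_sum]
      _ ≤ F * (F * ∑ y ∈ Finset.Icc 1 (W * (S * S)), G h y) := by gcongr
      _ = _ := by ring
  have h6 : ∑ p ∈ Finset.Ico H (H + H) ×ˢ Finset.Icc 1 W, b p.1 p.2 ^ 2 ≤
      3 * S * (H * W) + 2 * (F ^ 2 * cubicCount α (4 * κ) 2 H (W * (S * S))) := by
    have e2 : cubicCount α (4 * κ) 2 H (W * (S * S))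
        = ∑ h ∈ Finset.Ico H (H + H), ∑ y ∈ Finset.Icc 1 (W * (S * S)), G h y := by
      unfold cubicCount
      rw [Finset.sum_comm]
    rw [Finset.sum_product, e2, Finset.mul_sum, Finset.mul_sum]
    have h7 : ∀ h ∈ Finset.Ico H (H + H), ∑ w ∈ Finset.Icc 1 W, b h w ^ 2 ≤ 3 * S * W +
        2 * (F ^ 2 * ∑ y ∈ Finset.Icc 1 (W * (S * S)), G h y) := by
      intro h _
      refine (Finset.sum_le_sum fun w _ => h2 h w).trans ?_
      rw [Finset.sum_add_distrib, ← Finset.mul_sum, Finset.sum_const, Nat.card_Icc,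
        Nat.add_sub_cancel, nsmul_eq_mul, ← Finset.mul_sum]
      have := h5 h
      linarith
    refine (Finset.sum_le_sum h7).trans (le_of_eq ?_)
    rw [Finset.sum_add_distrib, Finset.sum_const, Nat.card_Ico, Nat.add_sub_cancel, nsmul_eq_mul,
      ← Finset.mul_sum]
    ring
  exact h1.trans (by gcongr)

/-- For short `S` the variable `s` is frozen, and `s²` is the multiplier `g` of a cubic count in
`(w, h)`. That count is asked to save `B = t ^ 60`, by freezing `h` if `H ≤ t ^ 88` and by
differencing it otherwise. -/
lemma mixedCount_mul_le_of_small (hs : Setting α q t F) {κ : ℝ} (hκ : 0 ≤ κ) {H S W : ℕ}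
    (hH : 0 < H) (hS : 0 < S) (hSt : (S : ℝ) ≤ t ^ 24) (hκt : κ * t ^ 60 ≤ 1)
    (hqκ : 1 ≤ q * κ) (hsize : (W : ℝ) * H ^ 3 ≤ (q : ℝ) ^ 10)
    (hΩ : q ^ 2 * κ ≤ 4 * t ^ 20 * (H ^ 3 * S ^ 2 * W)) :
    mixedCount α κ H S W * t ^ 10 ≤ H * S * W := by
  have ht := hs.one_le_t
  have htp := hs.t_pos
  have hF1 := hs.one_le_F
  have hF := hs.le_F
  have hFt := hs.F_pow_le_t (n := 10) (by norm_num)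
  have hbig : 304 ≤ t ^ 50 := by
    calc (304 : ℝ) ≤ F := by linarith
      _ = F ^ 1 := (pow_one _).symm
      _ ≤ t := hs.F_pow_le_t (by norm_num)
      _ ≤ t ^ 50 := le_self_pow₀ ht (by norm_num)
  have hbig2 : 23000 * F ^ 3 ≤ t ^ 20 := by
    calc 23000 * F ^ 3 ≤ F * F ^ 3 := by gcongr; linarith
      _ = F ^ 4 := by ring
      _ ≤ t := hs.F_pow_le_t (by norm_num)
      _ ≤ t ^ 20 := le_self_pow₀ ht (by norm_num)
  have key : ∀ s ∈ Finset.Ico S (S + S), cubicCount α κ (s ^ 2) H W * t ^ 10 ≤ H * W := by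
    intro s hs'
    have hs' := Finset.mem_Ico.1 hs'
    have hsS : (S : ℝ) ≤ s := by exact_mod_cast hs'.1
    have hs2 : (s : ℝ) ≤ 2 * S := by
      have : s ≤ 2 * S := by omega
      exact_mod_cast this
    have hspos : 0 < s ^ 2 := pow_pos (by omega) 2
    have hc0 := cubicCount_nonneg α κ (s ^ 2) H W
    have hgB : ((s ^ 2 : ℕ) : ℝ) * t ^ 284 * t ^ 60 ≤ 4 * q := by
      -- The tightest use of `t ^ 392 ≤ q`: `392 = 2 * 24 + 284 + 60`.
      push_cast
      calc (s : ℝ) ^ 2 * t ^ 284 * t ^ 60 ≤ (2 * t ^ 24) ^ 2 * t ^ 284 * t ^ 60 := by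
            gcongr; linarith
        _ = 4 * t ^ 392 := by ring
        _ ≤ 4 * q := by have := hs.t_pow_le; linarith
    have hΩ' : q ^ 2 * κ ≤ 4 * t ^ 20 * (((s ^ 2 : ℕ) : ℝ) * W * H ^ 3) := by
      refine hΩ.trans ?_
      push_cast
      calc 4 * t ^ 20 * ((H : ℝ) ^ 3 * S ^ 2 * W) ≤ 4 * t ^ 20 * ((H : ℝ) ^ 3 * s ^ 2 * W) := by
            gcongr
        _ = _ := by ring
    by_cases hHt : (H : ℝ) ≤ t ^ 88
    · have h1 := cubicCount_mul_le hs hκ hspos hHt (B := t ^ 60) (by positivity) (by linarith)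
        hgB hqκ hΩ'
      have h2 : cubicCount α κ (s ^ 2) H W * t ^ 10 * t ^ 50 ≤ H * W * t ^ 50 := by
        calc _ = cubicCount α κ (s ^ 2) H W * t ^ 60 := by ring
          _ ≤ 304 * (H * W) := h1
          _ ≤ t ^ 50 * (H * W) := by gcongr
          _ = _ := by ring
      exact le_of_mul_le_mul_right h2 (by positivity)
    · push Not at hHt
      have h1 := cubicCount_pow_mul_le hs hκ hspos hH (B := t ^ 60)
        ((pow_le_pow_right₀ ht (by norm_num)).trans hHt.le) (by positivity) (by linarith)
        hgB hqκ hsize hΩ'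
      -- The saving sits on a fourth power: `60 = 4 * 10 + 20`, and the spare `t ^ 20` absorbs
      -- `23000 * F ^ 3`.
      have h2 : (cubicCount α κ (s ^ 2) H W * t ^ 10) ^ 4 * t ^ 20 ≤ (H * W) ^ 4 * t ^ 20 := by
        calc _ = cubicCount α κ (s ^ 2) H W ^ 4 * t ^ 60 := by ring
          _ ≤ 23000 * F ^ 3 * (H * W) ^ 4 := h1
          _ ≤ t ^ 20 * (H * W) ^ 4 := by gcongr
          _ = _ := by ring
      exact (pow_le_pow_iff_left₀ (by positivity) (by positivity) (by norm_num)).1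
        (le_of_mul_le_mul_right h2 (by positivity))
  rw [mixedCount_eq_sum_cubicCount, Finset.sum_mul]
  refine (Finset.sum_le_sum key).trans (le_of_eq ?_)
  simp; ring

/-- For long `S` differencing in `s` is profitable: its diagonal already saves `S > t ^ 24`, and its
main term is a cubic count with the small multiplier `g = 2`. Since the mixed count is squared, a
saving slightly above `t ^ 20` is needed from the cubic count. -/
lemma mixedCount_mul_le_of_large (hs : Setting α q t F) {κ : ℝ} (hκ : 0 ≤ κ) {H S W : ℕ}
    (hH : 0 < H) (hW : 0 < W) (hSt : t ^ 24 < (S : ℝ)) (hκt : κ * t ^ 60 ≤ 1)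
    (hκt' : κ * t ^ 120 ≤ 1 ∨ H = 1)
    (hqκ : 1 ≤ q * κ) (hsize : (W : ℝ) * S ^ 2 * H ^ 3 ≤ (q : ℝ) ^ 10)
    (hΩ : q ^ 2 * κ ≤ 2 * t ^ 20 * (H ^ 3 * S ^ 2 * W)) :
    mixedCount α κ H S W * t ^ 10 ≤ H * S * W := by
  have ht := hs.one_le_t
  have htp := hs.t_pos
  have hF1 := hs.one_le_F
  have hF := hs.le_F
  have hq := hs.q_posR
  have hHR : (1 : ℝ) ≤ H := by exact_mod_cast hH
  have hSR : 0 < (S : ℝ) := lt_trans (by positivity) hSt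
  have hFt : 1000000 * F ^ 3 ≤ t := by
    calc 1000000 * F ^ 3 ≤ F * F ^ 3 := by gcongr
      _ = F ^ 4 := by ring
      _ ≤ t := hs.F_pow_le_t (by norm_num)
  have hF3 : 1 ≤ F ^ 3 := one_le_pow₀ hF1
  set E := cubicCount α (4 * κ) 2 H (W * (S * S)) with hE
  have hE0 : 0 ≤ E := cubicCount_nonneg _ _ _ _ _
  have hcast : ((W * (S * S) : ℕ) : ℝ) = W * S ^ 2 := by push_cast; ring
  have hΩ' : (q : ℝ) ^ 2 * (4 * κ) ≤ 4 * t ^ 20 * (((2 : ℕ) : ℝ) * (W * (S * S) : ℕ) * H ^ 3) := by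
    rw [hcast]; push_cast; linarith
  have hqκ' : 1 ≤ q * (4 * κ) := by nlinarith
  have hgB : ∀ n ≤ 108, ((2 : ℕ) : ℝ) * t ^ 284 * t ^ n ≤ 4 * q := by
    intro n hn
    have : t ^ 284 * t ^ n ≤ q := by
      rw [← pow_add]; exact hs.t_pow_le_q (by omega)
    push_cast; linarith
  have key : E * t ^ 21 ≤ H * (W * S ^ 2) := by
    by_cases hHt : (H : ℝ) ≤ t ^ 88
    · have h1 := cubicCount_mul_le hs (κ := 4 * κ) (by positivity) (g := 2) (Y := W * (S * S))
        (by norm_num) hHt (B := t ^ 60) (by positivity) (by linarith) (hgB 60 (by norm_num)) hqκ' hΩ'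
      rw [hcast] at h1
      have h2 : E * t ^ 21 * t ^ 39 ≤ H * (W * S ^ 2) * t ^ 39 := by
        have : (304 : ℝ) ≤ t ^ 39 := by
          refine le_trans ?_ (le_self_pow₀ ht (by norm_num))
          linarith
        calc _ = E * t ^ 60 := by ring
          _ ≤ 304 * (H * (W * S ^ 2)) := h1
          _ ≤ t ^ 39 * (H * (W * S ^ 2)) := by gcongr
          _ = _ := by ring
      exact le_of_mul_le_mul_right h2 (by positivity)
    · push Not at hHt
      have hκ2 : κ * t ^ 120 ≤ 1 := by
        rcases hκt' with h | h
        · exact h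
        · rw [h] at hHt
          have : (1 : ℝ) ≤ t ^ 88 := one_le_pow₀ ht
          push_cast at hHt; linarith
      have hκ88 : κ * t ^ 88 ≤ 1 := by
        refine le_trans ?_ hκ2
        gcongr
        norm_num
      have h1 := cubicCount_pow_mul_le hs (κ := 4 * κ) (by positivity) (g := 2)
        (Y := W * (S * S)) (by norm_num) hH (B := t ^ 88) hHt.le (by positivity) (by linarith)
        (hgB 88 (by norm_num)) hqκ' (by rw [hcast]; exact hsize) hΩ'
      rw [hcast] at h1
      -- The fourth power again: `88 = 4 * 21 + 4`, which is why the long range starts at `H > t ^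
      -- 88`.
      have h2 : (E * t ^ 21) ^ 4 * t ^ 4 ≤ (H * (W * S ^ 2)) ^ 4 * t ^ 4 := by
        have : 23000 * F ^ 3 ≤ t ^ 4 := by
          refine le_trans ?_ (le_self_pow₀ ht (by norm_num))
          linarith
        calc _ = E ^ 4 * t ^ 88 := by ring
          _ ≤ 23000 * F ^ 3 * (H * (W * S ^ 2)) ^ 4 := h1
          _ ≤ t ^ 4 * (H * (W * S ^ 2)) ^ 4 := by gcongr
          _ = _ := by ring
      exact (pow_le_pow_iff_left₀ (by positivity) (by positivity) (by norm_num)).1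
        (le_of_mul_le_mul_right h2 (by positivity))
  have hsize' : (W : ℝ) * S ^ 2 ≤ (q : ℝ) ^ 10 := by
    refine le_trans ?_ hsize
    exact le_mul_of_one_le_right (by positivity) (one_le_pow₀ hHR)
  have h0 := mixedCount_sq_le hs κ (H := H) hsize' hW
  -- The diagonal of the differencing, beaten because `S > t ^ 24 ≥ 6 t ^ 20`.
  have h1 : 3 * S * (H * W) * t ^ 20 ≤ 1 / 2 * (H * W * S ^ 2 : ℝ) := by
    have : 6 * t ^ 20 ≤ (S : ℝ) := by
      refine le_trans ?_ hSt.le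
      have h6 : 6 ≤ t ^ 4 := by
        refine le_trans ?_ (le_self_pow₀ ht (by norm_num))
        linarith
      calc 6 * t ^ 20 ≤ t ^ 4 * t ^ 20 := by gcongr
        _ = _ := by ring
    calc 3 * (S : ℝ) * (H * W) * t ^ 20 = 1 / 2 * ((H : ℝ) * W * S * (6 * t ^ 20)) := by ring
      _ ≤ 1 / 2 * ((H : ℝ) * W * S * S) := by gcongr
      _ = _ := by ring
  have h2 : 2 * (F ^ 2 * E) * t ^ 20 ≤ 1 / 2 * (H * W * S ^ 2 : ℝ) := by
    have h3 : 2 * (F ^ 2 * E) * t ^ 20 * t ≤ 1 / 2 * (H * W * S ^ 2 : ℝ) * t := by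
      have : 4 * F ^ 2 ≤ t := by
        have : F ^ 2 ≤ F ^ 3 := pow_le_pow_right₀ hF1 (by norm_num)
        linarith
      calc _ = 1 / 2 * (4 * F ^ 2) * (E * t ^ 21) := by ring
        _ ≤ 1 / 2 * t * (H * (W * S ^ 2)) := by gcongr
        _ = _ := by ring
    exact le_of_mul_le_mul_right h3 htp
  have h3 : (mixedCount α κ H S W * t ^ 10) ^ 2 ≤ (H * S * W : ℝ) ^ 2 := by
    calc _ = mixedCount α κ H S W ^ 2 * t ^ 20 := by ring
      _ ≤ H * W * (3 * S * (H * W) + 2 * (F ^ 2 * E)) * t ^ 20 := by gcongr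
      _ = H * W * (3 * S * (H * W) * t ^ 20 + 2 * (F ^ 2 * E) * t ^ 20) := by ring
      _ ≤ H * W * (1 / 2 * (H * W * S ^ 2 : ℝ) + 1 / 2 * (H * W * S ^ 2 : ℝ)) := by gcongr
      _ = _ := by ring
  exact (pow_le_pow_iff_left₀ (mul_nonneg (mixedCount_nonneg _ _ _ _ _) (by positivity))
    (by positivity) (by norm_num)).1 h3

/-- Few `(h, s, w)` have `α h³ s² w` close to an integer. -/
lemma mixedCount_mul_le (hs : Setting α q t F) {κ : ℝ} (hκ : 0 ≤ κ) {H S W : ℕ}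
    (hH : 0 < H) (hS : 0 < S) (hW : 0 < W) (hκt : κ * t ^ 60 ≤ 1)
    (hκt' : κ * t ^ 120 ≤ 1 ∨ (S : ℝ) ≤ t ^ 24 ∨ H = 1)
    (hqκ : 1 ≤ q * κ) (hsize : (W : ℝ) * S ^ 2 * H ^ 3 ≤ (q : ℝ) ^ 10)
    (hΩ : q ^ 2 * κ ≤ 2 * t ^ 20 * (H ^ 3 * S ^ 2 * W)) :
    mixedCount α κ H S W * t ^ 10 ≤ H * S * W := by
  have htp := hs.t_pos
  by_cases hSt : (S : ℝ) ≤ t ^ 24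
  · have hSR : (1 : ℝ) ≤ S := by exact_mod_cast hS
    refine mixedCount_mul_le_of_small hs hκ hH hS hSt hκt hqκ ?_ ?_
    · refine le_trans ?_ hsize
      gcongr
      exact le_mul_of_one_le_right (by positivity) (one_le_pow₀ hSR)
    · have : 0 ≤ t ^ 20 * ((H : ℝ) ^ 3 * S ^ 2 * W) := by positivity
      linarith
  · exact mixedCount_mul_le_of_large hs hκ hH hW (not_le.1 hSt) hκt (by tauto) hqκ hsize hΩ

end

/-! ### Weyl's inequality for quadratic phases. -/

lemma e_add (y z : ℝ) : e (y + z) = e y * e z := by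
  unfold e; rw [← Complex.exp_add]; push_cast; congr 1; ring

lemma e_eq (y : ℝ) : e y = Complex.exp (Complex.I * (2 * Real.pi * y : ℝ)) := by
  unfold e; push_cast; congr 1; ring

lemma norm_e (y : ℝ) : ‖e y‖ = 1 := by
  rw [e_eq, mul_comm]; exact Complex.norm_exp_ofReal_mul_I _

lemma conj_e (y : ℝ) : (starRingEnd ℂ) (e y) = e (-y) := by
  unfold e; rw [← Complex.exp_conj]
  have h2 : (starRingEnd ℂ) 2 = 2 := map_ofNat _ 2
  congr 1; simp [h2]

lemma e_nat_mul (γ : ℝ) (n : ℕ) : e (γ * n) = e γ ^ n := by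
  unfold e; rw [← Complex.exp_nat_mul]; push_cast; congr 1; ring

/-- The chord has length `2 |sin (π r)|`, and Jordan's inequality gives `sin (π r) ≥ 2 r` for `0 ≤ r
≤ 1 / 2`. -/
lemma four_mul_circNorm_le (γ : ℝ) : 4 * circNorm γ ≤ ‖e γ - 1‖ := by
  set r := γ - round γ with hr
  have h1 : e γ = e r := by
    have h2 : γ = r + (round γ : ℤ) := by simp [hr]
    have h3 : e ((round γ : ℤ) : ℝ) = 1 := by
      unfold e
      rw [Complex.exp_eq_one_iff]
      exact ⟨round γ, by push_cast; ring⟩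
    conv_lhs => rw [h2, e_add, h3, mul_one]
  have h4 : circNorm γ = |r| := rfl
  have h5 : |r| ≤ 1 / 2 := abs_sub_round γ
  rw [h1, h4, e_eq, Complex.norm_exp_I_mul_ofReal_sub_one]
  have e1 : 2 * Real.pi * r / 2 = Real.pi * r := by ring
  rw [e1, norm_mul, Real.norm_eq_abs, Real.norm_eq_abs, abs_two]
  have h6 : |Real.sin (Real.pi * r)| = Real.sin (Real.pi * |r|) := by
    have hpos : 0 ≤ Real.sin (Real.pi * |r|) := by
      apply Real.sin_nonneg_of_nonneg_of_le_pi (by positivity)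
      nlinarith [Real.pi_pos]
    rcases abs_choice r with h | h
    · rw [h] at hpos ⊢; exact abs_of_nonneg hpos
    · have : Real.sin (Real.pi * r) = - Real.sin (Real.pi * |r|) := by
        rw [h, mul_neg, Real.sin_neg, neg_neg]
      rw [this, abs_neg, abs_of_nonneg hpos]
  rw [h6]
  have h7 := Real.mul_le_sin (x := Real.pi * |r|) (by positivity) (by nlinarith [Real.pi_pos])
  have h8 : 2 / Real.pi * (Real.pi * |r|) = 2 * |r| := by field_simp
  linarith

/-- A two-valued form of the bound `min (N, 1 / ‖γ‖)`: the trivial bound if `γ` is `κ`-close to an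
integer, the geometric series otherwise. Sums of this bound become counts of near-integers. -/
lemma norm_sum_e_linear_le (γ : ℝ) {κ : ℝ} (hκ : 0 < κ) {m N : ℕ} (hm : m ≤ N) :
    ‖∑ n ∈ Finset.range m, e (γ * n)‖ ≤ 1 / κ + N * near κ γ := by
  by_cases h : circNorm γ ≤ κ
  · have : ‖∑ n ∈ Finset.range m, e (γ * n)‖ ≤ m := by
      refine (norm_sum_le _ _).trans ?_
      simp [norm_e]
    have hmN : (m : ℝ) ≤ N := by exact_mod_cast hm
    have h0 : 0 < 1 / κ := by positivity
    simp only [near, h, if_true]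
    linarith
  · simp only [near, h, if_false, mul_zero, add_zero]
    push Not at h
    have h4 := four_mul_circNorm_le γ
    have hpos : 0 < ‖e γ - 1‖ := by linarith
    have hgeom : (∑ n ∈ Finset.range m, e (γ * n)) * (e γ - 1) = e γ ^ m - 1 := by
      simp only [e_nat_mul]; exact geom_sum_mul _ _
    have h5 : ‖∑ n ∈ Finset.range m, e (γ * n)‖ * ‖e γ - 1‖ ≤ 2 := by
      rw [← norm_mul, hgeom]
      refine (norm_sub_le _ _).trans ?_
      rw [norm_pow, norm_e]; norm_num
    rw [le_div_iff₀ hκ]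
    have h6 := norm_nonneg (∑ n ∈ Finset.range m, e (γ * n))
    nlinarith [mul_le_mul_of_nonneg_left (show 4 * κ ≤ ‖e γ - 1‖ by linarith) h6]

/-- The off-diagonal pairs are grouped by their difference `u + 1`, and the two orders of a pair are
conjugate. In the induction the new term `f m` meets each earlier term exactly once, one for each
shift. -/
lemma norm_sq_sum_range (f : ℕ → ℂ) (m : ℕ) :
    ‖∑ n ∈ Finset.range m, f n‖ ^ 2 = ∑ n ∈ Finset.range m, ‖f n‖ ^ 2 +
      2 * (∑ u ∈ Finset.range m, ∑ n ∈ Finset.range (m - 1 - u),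
        f (n + (u + 1)) * (starRingEnd ℂ) (f n)).re := by
  induction m with
  | zero => simp
  | succ m ih =>
    have h1 : ∑ u ∈ Finset.range (m + 1), ∑ n ∈ Finset.range (m + 1 - 1 - u),
        f (n + (u + 1)) * (starRingEnd ℂ) (f n)
        = (∑ u ∈ Finset.range m, ∑ n ∈ Finset.range (m - 1 - u),
          f (n + (u + 1)) * (starRingEnd ℂ) (f n))
          + f m * (starRingEnd ℂ) (∑ n ∈ Finset.range m, f n) := by
      rw [Finset.sum_range_succ, map_sum,
        ← Finset.sum_range_reflect (fun n => (starRingEnd ℂ) (f n)) m, Finset.mul_sum,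
        ← Finset.sum_add_distrib]
      simp only [Nat.add_sub_cancel, Nat.sub_self, Finset.range_zero, Finset.sum_empty, add_zero]
      refine Finset.sum_congr rfl fun u hu => ?_
      have hu := Finset.mem_range.1 hu
      have e1 : m - u = (m - 1 - u) + 1 := by omega
      rw [e1, Finset.sum_range_succ]
      congr 3
      omega
    rw [h1, Finset.sum_range_succ, Finset.sum_range_succ, Complex.add_re, mul_add, ← add_assoc]
    have h2 : ‖∑ n ∈ Finset.range m, f n + f m‖ ^ 2 = ‖∑ n ∈ Finset.range m, f n‖ ^ 2 + ‖f m‖ ^ 2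
        + 2 * (f m * (starRingEnd ℂ) (∑ n ∈ Finset.range m, f n)).re := by
      simp only [Complex.sq_norm, Complex.normSq_apply, Complex.add_re, Complex.add_im,
        Complex.mul_re, Complex.conj_re, Complex.conj_im]
      ring
    rw [h2, ih]; ring

/-- Weyl's inequality for quadratic phases, in terms of the near-integer count. -/
lemma norm_sq_sum_e_quadratic_le (β γ : ℝ) {κ : ℝ} (hκ : 0 < κ) (hκ1 : κ ≤ 1) {m N : ℕ}
    (hm : m ≤ N) :
    ‖∑ n ∈ Finset.range m, e (β * (n : ℝ) ^ 2 + γ * n)‖ ^ 2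
      ≤ 3 * N / κ + 2 * N * ∑ u ∈ Finset.Icc 1 N, near κ (2 * β * u) := by
  set f : ℕ → ℂ := fun n => e (β * (n : ℝ) ^ 2 + γ * n) with hf
  have hmN : (m : ℝ) ≤ N := by exact_mod_cast hm
  have h1 : ∀ u, ‖∑ n ∈ Finset.range (m - 1 - u), f (n + (u + 1)) * (starRingEnd ℂ) (f n)‖
      ≤ 1 / κ + N * near κ (2 * β * ((u + 1 : ℕ) : ℝ)) := by
    intro u
    have h2 : ∀ n : ℕ, f (n + (u + 1)) * (starRingEnd ℂ) (f n)
        = e (β * (u + 1) ^ 2 + γ * (u + 1)) * e (2 * β * ((u + 1 : ℕ) : ℝ) * n) := by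
      intro n
      simp only [hf]
      rw [conj_e, ← e_add, ← e_add]
      congr 1; push_cast; ring
    simp only [h2]
    rw [← Finset.mul_sum, norm_mul, norm_e, one_mul]
    exact norm_sum_e_linear_le _ hκ (by omega)
  rw [norm_sq_sum_range]
  have h3 : ∑ n ∈ Finset.range m, ‖f n‖ ^ 2 = m := by simp [hf, norm_e]
  have h4 : (∑ u ∈ Finset.range m, ∑ n ∈ Finset.range (m - 1 - u),
        f (n + (u + 1)) * (starRingEnd ℂ) (f n)).re
      ≤ ∑ u ∈ Finset.range N, (1 / κ + N * near κ (2 * β * ((u + 1 : ℕ) : ℝ))) := by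
    refine (Complex.re_le_norm _).trans ((norm_sum_le _ _).trans ?_)
    refine (Finset.sum_le_sum fun u _ => h1 u).trans ?_
    refine Finset.sum_le_sum_of_subset_of_nonneg (Finset.range_mono hm) fun u _ _ => ?_
    have := near_nonneg κ (2 * β * ((u + 1 : ℕ) : ℝ))
    positivity
  have h5 : ∑ u ∈ Finset.Icc 1 N, near κ (2 * β * u)
      = ∑ u ∈ Finset.range N, near κ (2 * β * ((u + 1 : ℕ) : ℝ)) := by
    rw [Finset.range_eq_Ico, Finset.sum_Ico_add' (fun u : ℕ => near κ (2 * β * u)) 0 N 1]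
    rfl
  rw [Finset.sum_add_distrib, ← Finset.mul_sum, ← h5] at h4
  simp only [Finset.sum_const, Finset.card_range, nsmul_eq_mul] at h4
  rw [h3]
  have h6 : (N : ℝ) ≤ N / κ := by
    rw [le_div_iff₀ hκ]; nlinarith [(Nat.cast_nonneg N : (0 : ℝ) ≤ N)]
  have e1 : 3 * (N : ℝ) / κ = N / κ + 2 * (N * (1 / κ)) := by ring
  rw [e1]
  linarith

/-- Weyl's inequality along an interval of a residue class. -/
lemma norm_sq_sum_e_progression_le (β : ℝ) {κ : ℝ} (hκ : 0 < κ) (hκ1 : κ ≤ 1) {r N : ℕ}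
    (hr : 0 < r) (A : Finset ℕ) (hmod : ∀ m ∈ A, ∀ m' ∈ A, m ≡ m' [MOD r])
    (hconv : ∀ m₁ ∈ A, ∀ m₂ ∈ A, ∀ m, m₁ ≤ m → m ≤ m₂ → m ≡ m₁ [MOD r] → m ∈ A)
    (hlen : ∀ m ∈ A, m < r * N) :
    ‖∑ m ∈ A, e (β * (m : ℝ) ^ 2)‖ ^ 2
      ≤ 3 * N / κ + 2 * N * ∑ u ∈ Finset.Icc 1 N, near κ (2 * (β * (r : ℝ) ^ 2) * u) := by
  rcases A.eq_empty_or_nonempty with h | h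
  · rw [h]
    have : 0 ≤ ∑ u ∈ Finset.Icc 1 N, near κ (2 * (β * (r : ℝ) ^ 2) * u) :=
      Finset.sum_nonneg fun _ _ => near_nonneg _ _
    rw [Finset.sum_empty, norm_zero, zero_pow two_ne_zero]
    positivity
  set a := A.min' h
  set b := A.max' h
  have ha : a ∈ A := A.min'_mem h
  have hb : b ∈ A := A.max'_mem h
  have hab : a ≤ b := A.min'_le b hb
  set k := (b - a) / r + 1 with hk
  -- The hypotheses force `A` to be the full progression of step `r` from its minimum to its
  -- maximum.
  have hsum : ∑ m ∈ A, e (β * (m : ℝ) ^ 2)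
      = ∑ n ∈ Finset.range k, e (β * ((a + r * n : ℕ) : ℝ) ^ 2) := by
    symm
    refine Finset.sum_bij (fun n _ => a + r * n) ?_ ?_ ?_ ?_
    · intro n hn
      have hn := Finset.mem_range.1 hn
      refine hconv a ha b hb _ (by omega) ?_ ?_
      · have h1 : r * n ≤ r * ((b - a) / r) := Nat.mul_le_mul_left _ (by omega)
        have h2 : r * ((b - a) / r) ≤ b - a := Nat.mul_div_le _ _
        omega
      · simp [Nat.ModEq]
    · intro n _ n' _ (h : a + r * n = a + r * n')
      exact Nat.eq_of_mul_eq_mul_left hr (by omega)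
    · intro m hm
      have ham : a ≤ m := A.min'_le m hm
      have hmb : m ≤ b := A.le_max' m hm
      have hd := (Nat.modEq_iff_dvd' ham).1 (hmod a ha m hm)
      refine ⟨(m - a) / r, ?_, ?_⟩
      · rw [Finset.mem_range]
        have : (m - a) / r ≤ (b - a) / r := Nat.div_le_div_right (by omega)
        omega
      · rw [Nat.mul_div_cancel' hd]; omega
    · intro n _; rfl
  have hkN : k ≤ N := by
    have h1 : (b - a) / r < N := by
      rw [Nat.div_lt_iff_lt_mul hr]
      have := hlen b hb
      rw [mul_comm]; omega
    omega
  have h2 : ∀ n : ℕ, e (β * ((a + r * n : ℕ) : ℝ) ^ 2)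
      = e (β * (a : ℝ) ^ 2) * e (β * (r : ℝ) ^ 2 * (n : ℝ) ^ 2 + 2 * β * a * r * n) := by
    intro n
    rw [← e_add]; congr 1; push_cast; ring
  rw [hsum]
  simp only [h2]
  rw [← Finset.mul_sum, norm_mul, norm_e, one_mul]
  exact norm_sq_sum_e_quadratic_le _ _ hκ hκ1 hkN

/-! ### Averaging Weyl's inequality over a family of sums; dyadic decomposition. -/

lemma sum_comp_le_of_card_fiber_le {ι τ : Type*} [DecidableEq τ] {P : Finset ι} {B : Finset τ}
    {ψ : ι → τ} {Φ : ℝ} (hψ : ∀ p ∈ P, ψ p ∈ B)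
    (hfib : ∀ x ∈ B, ((P.filter fun p => ψ p = x).card : ℝ) ≤ Φ) (g : τ → ℝ) (hg : ∀ x, 0 ≤ g x) :
    ∑ p ∈ P, g (ψ p) ≤ Φ * ∑ x ∈ B, g x := by
  rw [← Finset.sum_fiberwise_of_maps_to hψ, Finset.mul_sum]
  refine Finset.sum_le_sum fun x hx => ?_
  calc _ = ∑ p ∈ P.filter (fun p => ψ p = x), g x := by
        refine Finset.sum_congr rfl fun p hp => ?_
        rw [(Finset.mem_filter.1 hp).2]
    _ ≤ Φ * g x := by
        rw [Finset.sum_const, nsmul_eq_mul]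
        exact mul_le_mul_of_nonneg_right (hfib x hx) (hg x)

/-- Absorbs the factor 2 that differencing puts into the phase; odd values are added by positivity.
-/
lemma sum_two_mul_le (f : ℕ → ℝ) (hf : ∀ n, 0 ≤ f n) (X : ℕ) :
    ∑ n ∈ Finset.Icc 1 X, f (2 * n) ≤ ∑ n ∈ Finset.Icc 1 (2 * X), f n := by
  rw [← Finset.sum_image (s := Finset.Icc 1 X) (g := fun n => 2 * n) (f := f)
    (fun a _ b _ h => by simpa using h)]
  refine Finset.sum_le_sum_of_subset_of_nonneg ?_ fun _ _ _ => hf _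
  intro n hn
  simp only [Finset.mem_image, Finset.mem_Icc] at hn ⊢
  omega

/-- Averaging of quadratic sums whose leading coefficients are `2 α h³ s² w`. -/
lemma sum_mul_le_of_mixed (α : ℝ) {q : ℕ} {t F : ℝ} (hs : Setting α q t F) {ι : Type*}
    (P : Finset ι) (ψ : ι → ℕ × ℕ × ℕ) (T : ι → ℝ) (hT0 : ∀ p, 0 ≤ T p) {H S W N : ℕ} {Φ : ℝ}
    (hH : 0 < H) (hS : 0 < S) (hW : 0 < W)
    (hψ : ∀ p ∈ P, ψ p ∈ Finset.Ico H (H + H) ×ˢ Finset.Ico S (S + S) ×ˢ Finset.Icc 1 W)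
    (hΦ : 0 ≤ Φ) (hfib : ∀ x ∈ Finset.Ico H (H + H) ×ˢ Finset.Ico S (S + S) ×ˢ Finset.Icc 1 W,
      ((P.filter fun p => ψ p = x).card : ℝ) ≤ Φ)
    (hT : ∀ κ : ℝ, 0 < κ → κ ≤ 1 → ∀ p ∈ P, T p ^ 2 ≤ 3 * N / κ + 2 * N * ∑ u ∈ Finset.Icc 1 N,
      near κ (α * ((ψ p).1 ^ 3 * (ψ p).2.1 ^ 2 * (2 * ((ψ p).2.2 * u)) : ℕ)))
    (hNt : t ^ 80 ≤ N) (hcase : t ^ 140 ≤ (N : ℝ) ∨ (S : ℝ) ≤ t ^ 24 ∨ H = 1)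
    (hNq : (N : ℝ) ≤ 2 * q) (hΩ : (q : ℝ) ^ 2 ≤ H ^ 3 * S ^ 2 * W * N ^ 2)
    (hsize : 2 * (W * N : ℝ) * S ^ 2 * H ^ 3 ≤ (q : ℝ) ^ 10) :
    (∑ p ∈ P, T p) * t ^ 5 ≤ Φ * F * (H * S * W * N) := by
  have ht := hs.one_le_t
  have htp := hs.t_pos
  have hF := hs.le_F
  have hFp := hs.F_pos
  have hq := hs.q_posR
  have hN : (0 : ℝ) < N := lt_of_lt_of_le (by positivity) hNt
  have hN' : 0 < N := by exact_mod_cast hN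
  have hHR : (1 : ℝ) ≤ H := by exact_mod_cast hH
  have hSR : (1 : ℝ) ≤ S := by exact_mod_cast hS
  have hWR : (1 : ℝ) ≤ W := by exact_mod_cast hW
  -- This makes the term `3 N / κ` equal to `3 N² / t ^ 20`, while `κ t ^ 60 ≤ 1` and `κ t ^ 120 ≤
  -- 1` become `t ^ 80 ≤ N` and `t ^ 140 ≤ N`.
  set κ : ℝ := t ^ 20 / N with hκdef
  have hκ : 0 < κ := by positivity
  have hκ60 : κ * t ^ 60 ≤ 1 := by
    rw [hκdef, div_mul_eq_mul_div, div_le_one hN, ← pow_add]; exact hNt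
  have hκ1 : κ ≤ 1 := by
    have : (1 : ℝ) ≤ t ^ 60 := one_le_pow₀ ht
    nlinarith
  have hκcase : κ * t ^ 120 ≤ 1 ∨ (S : ℝ) ≤ t ^ 24 ∨ H = 1 := by
    rcases hcase with h | h
    · left
      rw [hκdef, div_mul_eq_mul_div, div_le_one hN, ← pow_add]; exact h
    · exact Or.inr h
  have hqκ : 1 ≤ q * κ := by
    rw [hκdef, ← mul_div_assoc, le_div_iff₀ hN]
    have h1 : 2 ≤ t ^ 20 := by
      calc (2 : ℝ) ≤ F := by linarith
        _ = F ^ 1 := (pow_one _).symm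
        _ ≤ t := hs.F_pow_le_t (by norm_num)
        _ ≤ t ^ 20 := le_self_pow₀ ht (by norm_num)
    nlinarith
  have hΩ' : q ^ 2 * κ ≤ 2 * t ^ 20 * (H ^ 3 * S ^ 2 * ((2 * (W * N) : ℕ) : ℝ)) := by
    rw [hκdef, ← mul_div_assoc, div_le_iff₀ hN]
    push_cast
    calc (q : ℝ) ^ 2 * t ^ 20 ≤ (H ^ 3 * S ^ 2 * W * N ^ 2) * t ^ 20 := by gcongr
      _ ≤ 4 * ((H ^ 3 * S ^ 2 * W * N ^ 2) * t ^ 20) := by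
          have : (0 : ℝ) ≤ (H ^ 3 * S ^ 2 * W * N ^ 2) * t ^ 20 := by positivity
          linarith
      _ = _ := by ring
  have hcount := mixedCount_mul_le hs hκ.le hH hS (W := 2 * (W * N)) (by positivity) hκ60 hκcase hqκ
    (by push_cast; exact hsize) hΩ'
  set M := mixedCount α κ H S (2 * (W * N)) with hM
  set B := Finset.Ico H (H + H) ×ˢ Finset.Ico S (S + S) ×ˢ Finset.Icc 1 W with hB
  have hcard : (P.card : ℝ) ≤ Φ * (H * S * W) := by
    have := sum_comp_le_of_card_fiber_le hψ hfib (fun _ => (1 : ℝ)) (fun _ => zero_le_one)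
    simp only [hB, Finset.sum_const, Finset.card_product, Nat.card_Ico, Nat.card_Icc,
      Nat.add_sub_cancel, nsmul_eq_mul, mul_one] at this
    refine this.trans (le_of_eq ?_)
    push_cast; ring
  have hdiv : ∀ n : ℕ, 1 ≤ n → n ≤ W * N → (n.divisors.card : ℝ) ≤ F := by
    intro n hn hn2
    refine hs.divisors_le n hn (le_trans ?_ hsize)
    have h1 : (n : ℝ) ≤ W * N := by exact_mod_cast hn2
    have h2 : (1 : ℝ) ≤ S ^ 2 * H ^ 3 := one_le_mul_of_one_le_of_one_le (one_le_pow₀ hSR)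
      (one_le_pow₀ hHR)
    calc (n : ℝ) ≤ W * N := h1
      _ ≤ 2 * (W * N) * 1 := by
          have : (0 : ℝ) ≤ W * N := by positivity
          linarith
      _ ≤ 2 * (W * N) * (S ^ 2 * H ^ 3) := by gcongr
      _ = _ := by ring
  have hnear : ∑ p ∈ P, ∑ u ∈ Finset.Icc 1 N,
      near κ (α * ((ψ p).1 ^ 3 * (ψ p).2.1 ^ 2 * (2 * ((ψ p).2.2 * u)) : ℕ)) ≤ Φ * (F * M) := by
    refine (sum_comp_le_of_card_fiber_le hψ hfib (fun x => ∑ u ∈ Finset.Icc 1 N,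
      near κ (α * (x.1 ^ 3 * x.2.1 ^ 2 * (2 * (x.2.2 * u)) : ℕ)))
      (fun _ => Finset.sum_nonneg fun _ _ => near_nonneg _ _)).trans ?_
    gcongr
    rw [hB, Finset.sum_product, hM, mixedCount, Finset.mul_sum]
    refine Finset.sum_le_sum fun h _ => ?_
    rw [Finset.sum_product, Finset.mul_sum]
    refine Finset.sum_le_sum fun s _ => ?_
    have h1 := sum_mul_le_divisor_bound (A := W) (B := N) (F := F)
      (fun n => near κ (α * (h ^ 3 * s ^ 2 * (2 * n) : ℕ))) (fun _ => near_nonneg _ _) hdiv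
    refine h1.trans ?_
    gcongr
    exact sum_two_mul_le (fun n => near κ (α * (h ^ 3 * s ^ 2 * n : ℕ))) (fun _ => near_nonneg _ _) _
  have hsq : ∑ p ∈ P, T p ^ 2 ≤ P.card * (3 * N / κ) + 2 * N * (Φ * (F * M)) := by
    refine (Finset.sum_le_sum fun p hp => hT κ hκ hκ1 p hp).trans ?_
    rw [Finset.sum_add_distrib, ← Finset.mul_sum, Finset.sum_const, nsmul_eq_mul]
    gcongr
  -- Weyl's inequality bounds mean squares; the saving `t ^ 10` of `mixedCount_mul_le` there becomes
  -- `t ^ 5` for the sum itself.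
  have hcs := sq_sum_le_card_mul_sum_sq (s := P) (f := T)
  have hM0 : 0 ≤ M := mixedCount_nonneg _ _ _ _ _
  have e1 : 3 * N / κ * t ^ 10 ≤ (3 : ℝ) * N ^ 2 := by
    rw [hκdef]
    have : 3 * (N : ℝ) / (t ^ 20 / N) * t ^ 10 = 3 * N ^ 2 / t ^ 10 := by field_simp
    rw [this]
    exact div_le_self (by positivity) (one_le_pow₀ ht)
  have hfin : ((∑ p ∈ P, T p) * t ^ 5) ^ 2 ≤ (Φ * F * (H * S * W * N)) ^ 2 := by
    calc ((∑ p ∈ P, T p) * t ^ 5) ^ 2 = (∑ p ∈ P, T p) ^ 2 * t ^ 10 := by ring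
      _ ≤ P.card * (P.card * (3 * N / κ) + 2 * N * (Φ * (F * M))) * t ^ 10 := by
          gcongr; exact hcs.trans (by gcongr)
      _ = P.card * (P.card * (3 * N / κ * t ^ 10) + 2 * N * (Φ * (F * (M * t ^ 10)))) := by ring
      _ ≤ Φ * (H * S * W) * (Φ * (H * S * W) * (3 * N ^ 2) +
          2 * N * (Φ * (F * (H * S * (2 * (W * N) : ℕ))))) := by gcongr
      _ = Φ ^ 2 * (H * S * W * N) ^ 2 * (3 + 4 * F) := by push_cast; ring
      _ ≤ Φ ^ 2 * (H * S * W * N) ^ 2 * (F ^ 2) := by gcongr; nlinarith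
      _ = _ := by ring
  exact (pow_le_pow_iff_left₀ (mul_nonneg (Finset.sum_nonneg fun _ _ => hT0 _) (by positivity))
    (by positivity) (by norm_num)).1 hfin

/-- Counts dyadic ranges: splitting any variable of polynomial size costs one factor `F`. -/
lemma Setting.log_two_le {α : ℝ} {q : ℕ} {t F : ℝ} (hs : Setting α q t F) {n : ℕ} (hn : 1 ≤ n)
    (hnq : (n : ℝ) ≤ (q : ℝ) ^ 10) : ((Nat.log 2 n + 1 : ℕ) : ℝ) ≤ F := by
  have h1 : (2 : ℝ) ^ Nat.log 2 n ≤ n := by exact_mod_cast Nat.pow_log_le_self 2 (by omega)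
  have h2 := Real.log_le_log (by positivity) (h1.trans hnq)
  rw [Real.log_pow, Real.log_pow] at h2
  have h3 := Real.log_two_gt_d9
  have h4 := hs.log_le
  have h5 := hs.le_F
  push_cast at h2 ⊢
  have h6 : (Nat.log 2 n : ℝ) * (1 / 2) ≤ Nat.log 2 n * Real.log 2 := by gcongr; linarith
  linarith

lemma sum_le_of_dyadic {ι : Type*} (P : Finset ι) (r : ι → ℕ) (T : ι → ℝ) {X : ℕ} {C : ℝ}
    (hr : ∀ p ∈ P, 1 ≤ r p ∧ r p ≤ X) (hC : ∀ j, 2 ^ j ≤ X →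
      ∑ p ∈ P.filter (fun p => r p ∈ Finset.Ico (2 ^ j) (2 ^ j + 2 ^ j)), T p ≤ C) (hX : 1 ≤ X) :
    ∑ p ∈ P, T p ≤ ((Nat.log 2 X + 1 : ℕ) : ℝ) * C := by
  have hmaps : ∀ p ∈ P, Nat.log 2 (r p) ∈ Finset.range (Nat.log 2 X + 1) := by
    intro p hp
    rw [Finset.mem_range, Nat.lt_add_one_iff]
    exact Nat.log_mono_right (hr p hp).2
  rw [← Finset.sum_fiberwise_of_maps_to hmaps, ← nsmul_eq_mul]
  refine (Finset.sum_le_card_nsmul _ _ C ?_).trans (by rw [Finset.card_range])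
  intro j hj
  have hj' : 2 ^ j ≤ X := by
    have := Finset.mem_range.1 hj
    exact (Nat.pow_le_pow_right (by norm_num) (by omega)).trans (Nat.pow_log_le_self 2 (by omega))
  refine (le_of_eq ?_).trans (hC j hj')
  refine Finset.sum_congr ?_ fun _ _ => rfl
  refine Finset.filter_congr fun p hp => ?_
  have := hr p hp
  rw [Nat.log_eq_iff (Or.inr ⟨by norm_num, by omega⟩), Finset.mem_Ico, pow_succ, mul_two]

lemma mem_frequencies {K : ℝ} (hK : 0 ≤ K) {k : ℤ} :
    k ∈ frequencies K ↔ k.natAbs ∈ Finset.Icc 1 ⌊K⌋₊ := by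
  have h : ((⌊K⌋₊ : ℕ) : ℤ) = ⌊K⌋ := Int.natCast_floor_eq_floor hK
  simp only [frequencies, Finset.mem_filter, Finset.mem_Icc]
  omega

lemma card_frequencies_le {K : ℝ} (hK : 0 ≤ K) : ((frequencies K).card : ℝ) ≤ 2 * K := by
  have h1 : (frequencies K).card ≤ (Finset.Icc (1 : ℕ) ⌊K⌋₊ ×ˢ (Finset.univ : Finset Bool)).card := by
    refine Finset.card_le_card_of_injOn (fun k => (k.natAbs, decide (0 ≤ k))) ?_ ?_
    · intro k hk
      have := (mem_frequencies hK).1 hk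
      have h2 := Finset.mem_Icc.1 this
      simp only [Finset.coe_product, Set.mem_prod, Finset.mem_coe, Finset.mem_Icc, Finset.mem_univ,
        and_true]
      exact h2
    · intro k _ k' _ h
      simp only [Prod.mk.injEq, decide_eq_decide] at h
      omega
  have h2 : ((⌊K⌋₊ : ℕ) : ℝ) ≤ K := Nat.floor_le hK
  have h3 : ((frequencies K).card : ℝ) ≤ ((⌊K⌋₊ * 2 : ℕ) : ℝ) := by
    simp only [Finset.card_product, Nat.card_Icc, Nat.add_sub_cancel, Finset.card_univ,
      Fintype.card_bool] at h1
    exact_mod_cast h1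
  push_cast at h3
  linarith

/-- Distance to the nearest integer is even, so signs of `k` and of `l₁ - l₂` disappear and only
counts over natural numbers are needed. -/
lemma near_intCast_mul (κ α : ℝ) (k : ℤ) (n : ℕ) (y : ℝ) (hy : y = α * (k * n)) :
    near κ y = near κ (α * (k.natAbs * n : ℕ)) := by
  subst hy
  obtain ⟨j, rfl | rfl⟩ := Int.eq_nat_or_neg k
  · simp
  · have : α * (((-(j : ℤ) : ℤ) : ℝ) * n) = -(α * (j * n : ℕ)) := by push_cast; ring
    rw [this, Int.natAbs_neg, Int.natAbs_natCast]
    unfold near; rw [circNorm_neg]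

/-! ### Linear sums. -/

/-- Sums over `m l ≡ b (mod d)` with a smooth variable `l`. -/
lemma sum_typeI_le {α : ℝ} {q : ℕ} {t F : ℝ} (hs : Setting α q t F) {K : ℝ} (hK : 1 ≤ K)
    (hKq : K ≤ q) (b : ℤ) {D Z : ℕ} (hDZ : (D * Z : ℝ) * t ^ 80 ≤ q) (𝒟 : Finset ℕ)
    (h𝒟 : ∀ d ∈ 𝒟, 1 ≤ d ∧ d ≤ D ∧ IsCoprime b (d : ℤ)) (A : ℕ → ℕ → Finset ℕ)
    (hA : ∀ d m, ∀ l ∈ A d m, m * l < q ∧ (m * l : ℤ) ≡ b [ZMOD d])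
    (hconv : ∀ d m, ∀ l₁ ∈ A d m, ∀ l₂ ∈ A d m, ∀ l, l₁ ≤ l → l ≤ l₂ →
      (m * l : ℤ) ≡ b [ZMOD d] → l ∈ A d m) :
    (∑ d ∈ 𝒟, ∑ k ∈ frequencies K, ∑ m ∈ Finset.Icc 1 Z,
      ‖∑ l ∈ A d m, e (α * k * (m : ℝ) ^ 2 * (l : ℝ) ^ 2)‖) * t ^ 5 ≤ 4 * F ^ 3 * (K * q) := by
  classical
  have hq := hs.q_posR
  have hF := hs.one_le_F
  have htp := hs.t_pos
  have hK0 : 0 ≤ K := by linarith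
  set T : ℕ × ℤ × ℕ → ℝ := fun p => ‖∑ l ∈ A p.1 p.2.2, e (α * p.2.1 * (p.2.2 : ℝ) ^ 2 * (l : ℝ) ^ 2)‖
    with hT
  have hT0 : ∀ p, 0 ≤ T p := fun p => norm_nonneg _
  set P := 𝒟 ×ˢ frequencies K ×ˢ Finset.Icc 1 Z with hP
  have hPmem : ∀ p ∈ P, 1 ≤ p.1 ∧ p.1 ≤ D ∧ IsCoprime b (p.1 : ℤ) ∧ p.2.1.natAbs ∈ Finset.Icc 1 ⌊K⌋₊ ∧
      1 ≤ p.2.2 ∧ p.2.2 ≤ Z := by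
    rintro ⟨d, k, m⟩ hp
    simp only [hP, Finset.mem_product] at hp
    obtain ⟨h1, h2, h3⟩ := hp
    have := h𝒟 d h1
    have h4 := Finset.mem_Icc.1 h3
    exact ⟨this.1, this.2.1, this.2.2, (mem_frequencies hK0).1 h2, h4.1, h4.2⟩
  have hsum : ∑ d ∈ 𝒟, ∑ k ∈ frequencies K, ∑ m ∈ Finset.Icc 1 Z,
      ‖∑ l ∈ A d m, e (α * k * (m : ℝ) ^ 2 * (l : ℝ) ^ 2)‖ = ∑ p ∈ P, T p := by
    simp only [hP, Finset.sum_product, hT]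
  rw [hsum]
  rcases P.eq_empty_or_nonempty with hPe | hPne
  · rw [hPe, Finset.sum_empty, zero_mul]; positivity
  have hDZ1 : 1 ≤ D * Z := by
    obtain ⟨p, hp⟩ := hPne
    have := hPmem p hp
    exact Nat.mul_pos (by omega) (by omega)
  have hDZq : ((D * Z : ℕ) : ℝ) ≤ q := by
    push_cast
    refine le_trans ?_ hDZ
    exact le_mul_of_one_le_right (by positivity) (one_le_pow₀ hs.one_le_t)
  have hq10 : (q : ℝ) ≤ (q : ℝ) ^ 10 := le_self_pow₀ hs.one_le_q (by norm_num)
  have key : ∀ j, 2 ^ j ≤ D * Z → ∑ p ∈ P.filter (fun p => p.1 * p.2.2 ∈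
      Finset.Ico (2 ^ j) (2 ^ j + 2 ^ j)), T p ≤ 4 * F ^ 2 * (K * q) / t ^ 5 := by
    intro j hj
    rw [le_div_iff₀ (by positivity)]
    set S := 2 ^ j with hS
    have hSpos : 0 < S := by positivity
    have hSR : (0 : ℝ) < S := by exact_mod_cast hSpos
    have hjR : (S : ℝ) ≤ D * Z := by exact_mod_cast hj
    have hSq : (S : ℝ) ≤ q := by push_cast at hDZq; linarith
    have hSq' : S ≤ q := by exact_mod_cast hSq
    -- With `d m ≥ S` and `m l < q` this gives `l < d N`, so the progression of step `d` has at most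
    -- `N` terms.
    set N := q / S + 1 with hN
    have hNS : q < S * N := by rw [hN, mul_comm]; exact Nat.lt_div_mul_add hSpos |>.trans_eq (by ring)
    have hNSR : (q : ℝ) ≤ S * N := by exact_mod_cast hNS.le
    have hNS2 : S * N ≤ 2 * q := by
      have := Nat.mul_div_le q S
      rw [hN, mul_add, mul_one]; omega
    have hNS2R : (S * N : ℝ) ≤ 2 * q := by exact_mod_cast hNS2
    have hSone : (1 : ℝ) ≤ S := by exact_mod_cast hSpos
    have hKfl : ((⌊K⌋₊ : ℕ) : ℝ) ≤ K := Nat.floor_le hK0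
    have hKfl1 : 1 ≤ ⌊K⌋₊ := (Nat.one_le_floor_iff K).2 hK
    have hKfl1R : (1 : ℝ) ≤ (⌊K⌋₊ : ℕ) := by exact_mod_cast hKfl1
    set P' := P.filter (fun p => p.1 * p.2.2 ∈ Finset.Ico S (S + S)) with hP'
    -- The product `d m` plays the role of `s` and `|k|` that of `w`. A fibre is fixed by a divisor
    -- `d` of `s` and the sign of `k`, hence `Φ = 2 F`.
    have main := sum_mul_le_of_mixed α hs P'
      (fun p => (1, p.1 * p.2.2, p.2.1.natAbs)) T hT0 (H := 1) (S := S) (W := ⌊K⌋₊) (N := N)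
      (Φ := 2 * F) one_pos hSpos (by omega) ?_ (by linarith) ?_ ?_ ?_ (Or.inr (Or.inr rfl)) ?_ ?_ ?_
    · refine main.trans ?_
      calc 2 * F * F * (((1 : ℕ) : ℝ) * S * (⌊K⌋₊ : ℕ) * N) = 2 * F ^ 2 * ((⌊K⌋₊ : ℕ) * (S * N)) := by
            push_cast; ring
        _ ≤ 2 * F ^ 2 * (K * (2 * q)) := by gcongr
        _ = _ := by ring
    · intro p hp
      have hp := Finset.mem_filter.1 hp
      simp only [Finset.mem_product]
      exact ⟨by simp, hp.2, (hPmem p hp.1).2.2.2.1⟩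
    · rintro ⟨h, s, w⟩ hx
      have hx2 := (Finset.mem_product.1 (Finset.mem_product.1 hx).2).1
      have hx2 : S ≤ s ∧ s < S + S := Finset.mem_Ico.1 hx2
      have hs1 : 1 ≤ s := by omega
      have hsq : (s : ℝ) ≤ (q : ℝ) ^ 10 := by
        have h1 : s ≤ 2 * (D * Z) := by omega
        have h2 : (s : ℝ) ≤ 2 * (D * Z : ℕ) := by exact_mod_cast h1
        have h3 : (2 : ℝ) ≤ t ^ 80 := by
          calc (2 : ℝ) ≤ F := by linarith [hs.le_F]
            _ = F ^ 1 := (pow_one _).symm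
            _ ≤ t := hs.F_pow_le_t (by norm_num)
            _ ≤ t ^ 80 := le_self_pow₀ hs.one_le_t (by norm_num)
        have h4 : ((D * Z : ℕ) : ℝ) * 2 ≤ (D * Z : ℝ) * t ^ 80 := by push_cast; gcongr
        linarith
      have hd := hs.divisors_le s hs1 hsq
      have hc : (P'.filter fun p => ((1, p.1 * p.2.2, p.2.1.natAbs) : ℕ × ℕ × ℕ) = (h, s, w)).card
          ≤ (s.divisors ×ˢ (Finset.univ : Finset Bool)).card := by
        refine Finset.card_le_card_of_injOn (fun p => (p.1, decide (0 ≤ p.2.1))) ?_ ?_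
        · rintro ⟨d, k, m⟩ hp
          have hp := (Finset.mem_filter.1 hp).2
          simp only [Prod.mk.injEq] at hp
          simp only [Finset.coe_product, Set.mem_prod, Finset.mem_coe, Nat.mem_divisors,
            Finset.mem_univ, and_true]
          exact ⟨⟨m, hp.2.1.symm⟩, by omega⟩
        · rintro ⟨d, k, m⟩ hp ⟨d', k', m'⟩ hp' heq
          have hp1 := (Finset.mem_filter.1 hp).2
          have hp1' := (Finset.mem_filter.1 hp').2
          simp only [Prod.mk.injEq, decide_eq_decide] at hp1 hp1' heq
          obtain ⟨rfl, h2⟩ := heq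
          have h3 : d * m = d * m' := hp1.2.1.trans hp1'.2.1.symm
          have hd0 : 0 < d := by
            rcases Nat.eq_zero_or_pos d with h | h
            · subst h; simp at hp1; omega
            · exact h
          have h4 := Nat.eq_of_mul_eq_mul_left hd0 h3
          have h5 : k = k' := by
            have := hp1.2.2; have := hp1'.2.2; omega
          rw [h4, h5]
      have hc' : ((P'.filter fun p => ((1, p.1 * p.2.2, p.2.1.natAbs) : ℕ × ℕ × ℕ) = (h, s, w)).card : ℝ)
          ≤ s.divisors.card * 2 := by
        rw [Finset.card_product] at hc
        simp only [Finset.card_univ, Fintype.card_bool] at hc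
        exact_mod_cast hc
      linarith
    · rintro κ hκ hκ1 ⟨d, k, m⟩ hp
      have hp := Finset.mem_filter.1 hp
      obtain ⟨hd1, hdD, hcop, hk, hm1, hmZ⟩ := hPmem _ hp.1
      simp only at hd1 hdD hcop hk hm1 hmZ
      have hS2 : S ≤ d * m := (Finset.mem_Ico.1 hp.2).1
      have := norm_sq_sum_e_progression_le (α * k * (m : ℝ) ^ 2) hκ hκ1 (r := d) (N := N) hd1
        (A d m) ?_ ?_ ?_
      · refine this.trans (le_of_eq ?_)
        congr 2
        refine Finset.sum_congr rfl fun u _ => ?_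
        -- The step `d` of the progression squares to `d²` and meets `m²` from the phase: the
        -- coefficient depends on `d` and `m` only through `(d m)²`.
        rw [near_intCast_mul κ α k ((d * m) ^ 2 * (2 * u))]
        · congr 2; push_cast; ring
        · push_cast; ring
      · intro l hl l' hl'
        have h1 := ((hA d m l hl).2).trans ((hA d m l' hl').2).symm
        -- Since `m l ≡ b` and `b` is coprime to `d`, `m` is invertible modulo `d` and the class of
        -- `l` is determined.
        have hmd : IsCoprime (d : ℤ) (m : ℤ) := by
          have h2 := (hA d m l hl).2
          have h3 : (d : ℤ) ∣ b - m * l := Int.ModEq.dvd h2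
          obtain ⟨c, hc⟩ := h3
          have hb : b = m * l + d * c := by linarith
          have h4 : IsCoprime (m * l + d * c : ℤ) d := hb ▸ hcop
          exact (IsCoprime.of_mul_left_left (IsCoprime.of_add_mul_left_left h4)).symm
        have h5 : (l : ℤ) ≡ l' [ZMOD d] := by
          rw [Int.modEq_iff_dvd] at h1 ⊢
          have : (m : ℤ) * l' - m * l = m * (l' - l) := by ring
          rw [this] at h1
          exact hmd.dvd_of_dvd_mul_left h1
        exact (Int.natCast_modEq_iff).1 h5
      · intro l₁ h₁ l₂ h₂ l hl1 hl2 hmod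
        refine hconv d m l₁ h₁ l₂ h₂ l hl1 hl2 ?_
        have h5 : (l : ℤ) ≡ l₁ [ZMOD d] := Int.natCast_modEq_iff.2 hmod
        exact (h5.mul_left _).trans (hA d m l₁ h₁).2
      · intro l hl
        have h1 := (hA d m l hl).1
        have h2 : m * l < m * (d * N) := by
          calc m * l < q := h1
            _ ≤ S * N := hNS.le
            _ ≤ (d * m) * N := Nat.mul_le_mul_right _ hS2
            _ = _ := by ring
        exact Nat.lt_of_mul_lt_mul_left h2
    · have h1 : t ^ 80 * (S : ℝ) ≤ N * (S : ℝ) := by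
        calc t ^ 80 * (S : ℝ) ≤ t ^ 80 * ((D : ℝ) * Z) := by gcongr
          _ ≤ (q : ℝ) := by linarith
          _ ≤ (N : ℝ) * S := by linarith
      exact le_of_mul_le_mul_right h1 hSR
    · have : (N : ℝ) ≤ S * N := le_mul_of_one_le_left (by positivity) hSone
      linarith
    · push_cast
      calc (q : ℝ) ^ 2 ≤ ((S : ℝ) * N) ^ 2 := by gcongr
        _ = 1 * ((S : ℝ) * N) ^ 2 := by ring
        _ ≤ ((⌊K⌋₊ : ℕ) : ℝ) * ((S : ℝ) * N) ^ 2 := by gcongr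
        _ = _ := by ring
    · have h1 : (1 : ℝ) ≤ q := hs.one_le_q
      have h4 : (4 : ℝ) ≤ q := by
        have : F ^ 1 ≤ t := hs.F_pow_le_t (by norm_num)
        have h3 : t ^ 1 ≤ (q : ℝ) := hs.t_pow_le_q (by norm_num)
        rw [pow_one] at this h3
        linarith [hs.le_F]
      calc 2 * ((⌊K⌋₊ : ℕ) * N : ℝ) * S ^ 2 * ((1 : ℕ) : ℝ) ^ 3 = 2 * ((⌊K⌋₊ : ℕ) : ℝ) * ((S : ℝ) * N) * S := by
            push_cast; ring
        _ ≤ 2 * (q : ℝ) * (2 * q) * q := by gcongr; exact_mod_cast hKfl.trans hKq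
        _ = 4 * (q : ℝ) ^ 3 := by ring
        _ ≤ q * (q : ℝ) ^ 3 := by gcongr
        _ = (q : ℝ) ^ 4 := by ring
        _ ≤ (q : ℝ) ^ 10 := pow_le_pow_right₀ h1 (by norm_num)
  have hfin := sum_le_of_dyadic P (fun p => p.1 * p.2.2) T (X := D * Z) ?_ key hDZ1
  · have hlog := hs.log_two_le hDZ1 (hDZq.trans hq10)
    calc (∑ p ∈ P, T p) * t ^ 5 ≤ ((Nat.log 2 (D * Z) + 1 : ℕ) : ℝ) * (4 * F ^ 2 * (K * q) / t ^ 5)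
          * t ^ 5 := by gcongr
      _ ≤ F * (4 * F ^ 2 * (K * q) / t ^ 5) * t ^ 5 := by gcongr
      _ = 4 * F ^ 3 * (K * q) := by field_simp
  · intro p hp
    have := hPmem p hp
    exact ⟨Nat.mul_pos (by omega) (by omega), Nat.mul_le_mul (by omega) (by omega)⟩

/-! ### Arithmetic of a pair of moduli in the dispersion. -/

lemma isCoprime_left_of_mul_modEq {b m l : ℤ} {d : ℤ} (hb : IsCoprime b d)
    (h : m * l ≡ b [ZMOD d]) : IsCoprime m d := by
  obtain ⟨c, hc⟩ := Int.ModEq.dvd h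
  have hb' : b = m * l + d * c := by linarith
  rw [hb'] at hb
  exact IsCoprime.of_mul_left_left (IsCoprime.of_add_mul_left_left hb)

lemma modEq_of_mul_modEq {b m m' l : ℤ} {d : ℤ} (hb : IsCoprime b d)
    (h : m * l ≡ b [ZMOD d]) (h' : m' * l ≡ b [ZMOD d]) : m ≡ m' [ZMOD d] := by
  have hl : IsCoprime l d := isCoprime_left_of_mul_modEq hb (by rwa [mul_comm] at h)
  have h1 := (h.trans h'.symm).dvd
  rw [← sub_mul] at h1
  exact Int.modEq_iff_dvd.2 (hl.symm.dvd_of_dvd_mul_right h1)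

/-- The common range of `m` for two pairs `(d₁, l₁)`, `(d₂, l₂)`. -/
def pairRange (q : ℕ) (b : ℤ) (d₁ d₂ l₁ l₂ : ℕ) : Finset ℕ :=
  (Finset.range q).filter fun m => (q ≤ 2 * (m * l₁) ∧ m * l₁ < q ∧ (m * l₁ : ℤ) ≡ b [ZMOD d₁]) ∧
    (q ≤ 2 * (m * l₂) ∧ m * l₂ < q ∧ (m * l₂ : ℤ) ≡ b [ZMOD d₂])

/-- A common factor `h` leaves the least common multiple once, so doubling the moduli squares only
their cofactors. This is the gain from keeping `h` outside the square. -/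
lemma lcm_div_bounds {h d₁ d₂ : ℕ} (hh : 0 < h) (h₁ : h ∣ d₁) (h₂ : h ∣ d₂) (hd₁ : 0 < d₁)
    (hd₂ : 0 < d₂) : Nat.lcm d₁ d₂ = h * (Nat.lcm d₁ d₂ / h) ∧ 0 < Nat.lcm d₁ d₂ / h ∧
      Nat.lcm d₁ d₂ / h ≤ d₁ / h * (d₂ / h) := by
  obtain ⟨a, rfl⟩ := h₁
  obtain ⟨c, rfl⟩ := h₂
  have ha := Nat.pos_of_mul_pos_left hd₁
  have hc := Nat.pos_of_mul_pos_left hd₂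
  rw [Nat.lcm_mul_left, Nat.mul_div_cancel_left _ hh, Nat.mul_div_cancel_left _ hh,
    Nat.mul_div_cancel_left _ hh]
  exact ⟨rfl, Nat.lcm_pos ha hc, Nat.le_of_dvd (Nat.mul_pos ha hc) (Nat.lcm_dvd_mul _ _)⟩

/-- As `b` is coprime to both moduli, the two congruences fix `m` modulo each of them, hence modulo
the least common multiple; the size conditions are convex in `m`. Weyl's inequality then applies
along this progression. -/
lemma norm_sq_sum_pairRange_le {q : ℕ} {b : ℤ} {d₁ d₂ l₁ l₂ : ℕ} (hd₁ : 0 < d₁)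
    (hd₂ : 0 < d₂) (hb₁ : IsCoprime b (d₁ : ℤ)) (hb₂ : IsCoprime b (d₂ : ℤ)) {κ : ℝ}
    (hκ : 0 < κ) (hκ1 : κ ≤ 1) {N : ℕ} (hN : q ≤ l₁ * (Nat.lcm d₁ d₂ * N)) (β : ℝ) :
    ‖∑ m ∈ pairRange q b d₁ d₂ l₁ l₂, e (β * (m : ℝ) ^ 2)‖ ^ 2
      ≤ 3 * N / κ + 2 * N * ∑ u ∈ Finset.Icc 1 N,
        near κ (2 * (β * (Nat.lcm d₁ d₂ : ℝ) ^ 2) * u) := by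
  refine norm_sq_sum_e_progression_le β hκ hκ1 (Nat.lcm_pos hd₁ hd₂) _ ?_ ?_ ?_
  · intro m hm m' hm'
    have hm := (Finset.mem_filter.1 hm).2
    have hm' := (Finset.mem_filter.1 hm').2
    have h1 := (modEq_of_mul_modEq hb₁ hm.1.2.2 hm'.1.2.2).dvd
    have h2 := (modEq_of_mul_modEq hb₂ hm.2.2.2 hm'.2.2.2).dvd
    rw [Nat.modEq_iff_dvd]
    rw [Int.natCast_dvd] at h1 h2 ⊢
    exact Nat.lcm_dvd h1 h2
  · intro m₁ h₁ m₂ h₂ m hm1 hm2 hmod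
    simp only [pairRange, Finset.mem_filter, Finset.mem_range] at h₁ h₂ ⊢
    have e1 : m₁ * l₁ ≤ m * l₁ := Nat.mul_le_mul_right _ hm1
    have e2 : m * l₁ ≤ m₂ * l₁ := Nat.mul_le_mul_right _ hm2
    have e3 : m₁ * l₂ ≤ m * l₂ := Nat.mul_le_mul_right _ hm1
    have e4 : m * l₂ ≤ m₂ * l₂ := Nat.mul_le_mul_right _ hm2
    have c1 : (m : ℤ) ≡ m₁ [ZMOD d₁] :=
      Int.natCast_modEq_iff.2 (hmod.of_dvd (Nat.dvd_lcm_left _ _))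
    have c2 : (m : ℤ) ≡ m₁ [ZMOD d₂] :=
      Int.natCast_modEq_iff.2 (hmod.of_dvd (Nat.dvd_lcm_right _ _))
    refine ⟨by omega, ⟨by omega, by omega, (c1.mul_right _).trans h₁.2.1.2.2⟩,
      ⟨by omega, by omega, (c2.mul_right _).trans h₁.2.2.2.2⟩⟩
  · intro m hm
    have hm := (Finset.mem_filter.1 hm).2
    have h1 : l₁ * m < l₁ * (Nat.lcm d₁ d₂ * N) := by
      have := hm.1.2.1
      rw [mul_comm] at this
      omega
    exact Nat.lt_of_mul_lt_mul_left h1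

/-- Modulo `h` both `m l₁` and `m l₂` are `b`, and `m` is invertible there because `b` is. This
divisibility thins out the pairs and supplies the third factor `h` of the phase. -/
lemma dvd_sub_of_mem_pairRange {q : ℕ} {b : ℤ} {d₁ d₂ l₁ l₂ h m : ℕ}
    (hb₁ : IsCoprime b (d₁ : ℤ)) (h₁ : h ∣ d₁) (h₂ : h ∣ d₂)
    (hm : m ∈ pairRange q b d₁ d₂ l₁ l₂) : (h : ℤ) ∣ (l₁ : ℤ) - l₂ := by
  have hm := (Finset.mem_filter.1 hm).2
  have e1 : (m * l₁ : ℤ) ≡ b [ZMOD h] := hm.1.2.2.of_dvd (by exact_mod_cast h₁)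
  have e2 : (m * l₂ : ℤ) ≡ b [ZMOD h] := hm.2.2.2.of_dvd (by exact_mod_cast h₂)
  have hbh : IsCoprime b (h : ℤ) := hb₁.of_isCoprime_of_dvd_right (by exact_mod_cast h₁)
  rw [mul_comm] at e1 e2
  exact (modEq_of_mul_modEq hbh e2 e1).dvd

/-! ### Off-diagonal pairs. -/

/-- The off-diagonal pairs, with equal first factor `f d₁ = f d₂` dividing `l₁ - l₂`. -/
def offDiagonal (K : ℝ) (L : ℕ) (𝒟 : Finset ℕ) (f : ℕ → ℕ) : Finset (ℤ × ℕ × ℕ × ℕ × ℕ) :=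
  (frequencies K ×ˢ 𝒟 ×ˢ 𝒟 ×ˢ Finset.Ico L (L + L) ×ˢ Finset.Ico L (L + L)).filter
    fun p => f p.2.1 = f p.2.2.1 ∧ p.2.2.2.1 ≠ p.2.2.2.2 ∧
      ((f p.2.1 : ℕ) : ℤ) ∣ (p.2.2.2.1 : ℤ) - p.2.2.2.2

/-- The shape `(h, s, w)` of an off-diagonal pair. -/
def shape (f : ℕ → ℕ) (p : ℤ × ℕ × ℕ × ℕ × ℕ) : ℕ × ℕ × ℕ :=
  (f p.2.1, Nat.lcm p.2.1 p.2.2.1 / f p.2.1,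
    p.1.natAbs * (((p.2.2.2.1 : ℤ) - p.2.2.2.2).natAbs / f p.2.1 * (p.2.2.2.1 + p.2.2.2.2)))

/-- The shape determines `h s = lcm(d₁, d₂)` and `h w = |k| |l₁ - l₂| (l₁ + l₂)`. So `d₁, d₂` are
divisors of the first number, the three other factors are divisors of the second, and two signs
complete the data: `4 F ^ 5`. -/
lemma card_shape_fiber_le (P : Finset (ℤ × ℕ × ℕ × ℕ × ℕ)) {f : ℕ → ℕ} {F : ℝ}
    (hP : ∀ p ∈ P, 0 < f p.2.1 ∧ f p.2.1 ∣ p.2.1 ∧ 0 < p.2.1 ∧ 0 < p.2.2.1 ∧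
      ((f p.2.1 : ℕ) : ℤ) ∣ (p.2.2.2.1 : ℤ) - p.2.2.2.2) {h s w : ℕ} (hh : 0 < h) (hs : 0 < s)
    (hw : 0 < w) (h1 : ((h * s).divisors.card : ℝ) ≤ F) (h2 : ((h * w).divisors.card : ℝ) ≤ F) :
    ((P.filter fun p => shape f p = (h, s, w)).card : ℝ) ≤ 4 * F ^ 5 := by
  set B := (h * s).divisors ×ˢ (h * s).divisors ×ˢ (h * w).divisors ×ˢ (h * w).divisors ×ˢ
    (h * w).divisors ×ˢ (Finset.univ : Finset Bool) ×ˢ (Finset.univ : Finset Bool) with hB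
  have hc : (P.filter fun p => shape f p = (h, s, w)).card ≤ B.card := by
    refine Finset.card_le_card_of_injOn (fun p => (p.2.1, p.2.2.1, p.1.natAbs,
      ((p.2.2.2.1 : ℤ) - p.2.2.2.2).natAbs, p.2.2.2.1 + p.2.2.2.2, decide (0 ≤ p.1),
      decide (p.2.2.2.1 ≤ p.2.2.2.2))) ?_ ?_
    · rintro ⟨k, d₁, d₂, l₁, l₂⟩ hp
      have hp := Finset.mem_filter.1 hp
      obtain ⟨a1, a2, a3, a4, a5⟩ := hP _ hp.1
      have hp2 := hp.2
      simp only [shape, Prod.mk.injEq] at hp2 a1 a2 a3 a4 a5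
      obtain ⟨b1, b2, b3⟩ := hp2
      rw [b1] at a1 a2 a5 b2 b3
      have hr : Nat.lcm d₁ d₂ = h * s := by
        rw [← b2, Nat.mul_div_cancel' (a2.trans (Nat.dvd_lcm_left _ _))]
      have hh2 : h ∣ ((l₁ : ℤ) - l₂).natAbs := Int.natCast_dvd.1 a5
      set t := ((l₁ : ℤ) - l₂).natAbs / h with ht
      have htt : ((l₁ : ℤ) - l₂).natAbs = h * t := (Nat.mul_div_cancel' hh2).symm
      have hne : h * s ≠ 0 := (Nat.mul_pos hh hs).ne'
      have hne' : h * w ≠ 0 := (Nat.mul_pos hh hw).ne'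
      rw [Finset.mem_coe, hB]
      simp only [Finset.mem_product, Nat.mem_divisors, Finset.mem_univ, and_true]
      refine ⟨⟨hr ▸ Nat.dvd_lcm_left _ _, hne⟩, ⟨hr ▸ Nat.dvd_lcm_right _ _, hne⟩,
        ⟨?_, hne'⟩, ⟨?_, hne'⟩, ⟨?_, hne'⟩⟩
      · exact ⟨h * (t * (l₁ + l₂)), by rw [← b3]; ring⟩
      · rw [htt]; exact ⟨k.natAbs * (l₁ + l₂), by rw [← b3]; ring⟩
      · exact ⟨h * (k.natAbs * t), by rw [← b3]; ring⟩
    · rintro ⟨k, d₁, d₂, l₁, l₂⟩ hp ⟨k', d₁', d₂', l₁', l₂'⟩ hp' heq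
      simp only [Prod.mk.injEq, decide_eq_decide] at heq
      obtain ⟨e1, e2, e3, e4, e5, e6, e7⟩ := heq
      simp only [Prod.mk.injEq]
      exact ⟨by omega, e1, e2, by omega, by omega⟩
  have hc' : ((P.filter fun p => shape f p = (h, s, w)).card : ℝ) ≤ B.card := by exact_mod_cast hc
  have hF0 : 0 ≤ F := le_trans (Nat.cast_nonneg _) h1
  refine hc'.trans ?_
  simp only [hB, Finset.card_product, Finset.card_univ, Fintype.card_bool]
  push_cast
  calc ((h * s).divisors.card : ℝ) * (((h * s).divisors.card : ℝ) * (((h * w).divisors.card : ℝ) *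
      (((h * w).divisors.card : ℝ) * (((h * w).divisors.card : ℝ) * 4))))
      ≤ F * (F * (F * (F * (F * 4)))) := by gcongr
    _ = _ := by ring

/-- Writing `|l₁ - l₂| = h τ` and `lcm = h s`, the product `k (l₁² - l₂²) lcm²` is, up to sign, `h³
s²` times `|k| τ (l₁ + l₂)`. -/
lemma near_shape (α κ : ℝ) {f : ℕ → ℕ} {k : ℤ} {d₁ d₂ l₁ l₂ : ℕ} (hf : f d₁ ∣ d₁)
    (hdvd : ((f d₁ : ℕ) : ℤ) ∣ (l₁ : ℤ) - l₂) (u : ℕ) :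
    near κ (2 * (α * k * ((l₁ : ℝ) ^ 2 - (l₂ : ℝ) ^ 2) * (Nat.lcm d₁ d₂ : ℝ) ^ 2) * u) =
      near κ (α * ((shape f (k, d₁, d₂, l₁, l₂)).1 ^ 3 * (shape f (k, d₁, d₂, l₁, l₂)).2.1 ^ 2 *
        (2 * ((shape f (k, d₁, d₂, l₁, l₂)).2.2 * u)) : ℕ)) := by
  simp only [shape]
  set h := f d₁
  set s := Nat.lcm d₁ d₂ / h with hs
  have hr : Nat.lcm d₁ d₂ = h * s := (Nat.mul_div_cancel' (hf.trans (Nat.dvd_lcm_left _ _))).symm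
  have hh2 : h ∣ ((l₁ : ℤ) - l₂).natAbs := Int.natCast_dvd.1 hdvd
  set t := ((l₁ : ℤ) - l₂).natAbs / h with ht
  have htt : ((l₁ : ℤ) - l₂).natAbs = h * t := (Nat.mul_div_cancel' hh2).symm
  rw [near_intCast_mul κ α (k * ((l₁ : ℤ) - l₂)) ((l₁ + l₂) * (h * s) ^ 2 * (2 * u))]
  · rw [Int.natAbs_mul, htt]; congr 2; push_cast; ring
  · rw [hr]; push_cast; ring

/-- The off-diagonal contribution to the dispersion. -/
lemma sum_offDiagonal_le (α : ℝ) {q : ℕ} {t F : ℝ} (hs : Setting α q t F) {K : ℝ} (hK : 1 ≤ K)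
    (hKq : K ≤ q) (b : ℤ) {H L X : ℕ} (hH : 0 < H) (hHL : H ≤ L) (hX : 1 ≤ X)
    (𝒟 : Finset ℕ) (f : ℕ → ℕ)
    (h𝒟 : ∀ d ∈ 𝒟, 1 ≤ d ∧ IsCoprime b (d : ℤ) ∧ f d ∣ d ∧ f d ∈ Finset.Ico H (H + H))
    (hX𝒟 : ∀ d ∈ 𝒟, ∀ d' ∈ 𝒟, d / f d * (d' / f d') ≤ X)
    (h80 : (L * H * X : ℝ) * t ^ 80 ≤ q)
    (hcase : (L * H * X : ℝ) * t ^ 140 ≤ q ∨ (X : ℝ) ≤ t ^ 24) :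
    (∑ p ∈ offDiagonal K L 𝒟 f, ‖∑ m ∈ pairRange q b p.2.1 p.2.2.1 p.2.2.2.1 p.2.2.2.2,
      e (α * p.1 * ((p.2.2.2.1 : ℝ) ^ 2 - (p.2.2.2.2 : ℝ) ^ 2) * (m : ℝ) ^ 2)‖) * t ^ 5 * H
      ≤ 32 * F ^ 7 * (K * L * q) := by
  have hq := hs.q_posR
  have hF := hs.one_le_F
  have htp := hs.t_pos
  have ht := hs.one_le_t
  have hK0 : 0 ≤ K := by linarith
  have hL : 0 < L := lt_of_lt_of_le hH hHL
  have hHR : (1 : ℝ) ≤ H := by exact_mod_cast hH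
  have hLR : (1 : ℝ) ≤ L := by exact_mod_cast hL
  have hXR : (1 : ℝ) ≤ X := by exact_mod_cast hX
  have hHLR : (H : ℝ) ≤ L := by exact_mod_cast hHL
  have hLHXq : (L * H * X : ℝ) ≤ q :=
    le_trans (le_mul_of_one_le_right (by positivity) (one_le_pow₀ ht)) h80
  have hLHq : (L * H : ℝ) ≤ q := le_trans (le_mul_of_one_le_right (by positivity) hXR) hLHXq
  have hq1000 : (1000000 : ℝ) ≤ q := by
    have h1 : F ^ 1 ≤ t := hs.F_pow_le_t (by norm_num)
    have h3 : t ^ 1 ≤ (q : ℝ) := hs.t_pow_le_q (by norm_num)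
    rw [pow_one] at h1 h3
    linarith [hs.le_F]
  set T : ℤ × ℕ × ℕ × ℕ × ℕ → ℝ := fun p =>
    ‖∑ m ∈ pairRange q b p.2.1 p.2.2.1 p.2.2.2.1 p.2.2.2.2,
      e (α * p.1 * ((p.2.2.2.1 : ℝ) ^ 2 - (p.2.2.2.2 : ℝ) ^ 2) * (m : ℝ) ^ 2)‖ with hT
  set P := offDiagonal K L 𝒟 f with hP
  have hPmem : ∀ p ∈ P, p.1.natAbs ∈ Finset.Icc 1 ⌊K⌋₊ ∧ p.2.1 ∈ 𝒟 ∧ p.2.2.1 ∈ 𝒟 ∧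
      (L ≤ p.2.2.2.1 ∧ p.2.2.2.1 < L + L) ∧ (L ≤ p.2.2.2.2 ∧ p.2.2.2.2 < L + L) ∧
      f p.2.1 = f p.2.2.1 ∧ p.2.2.2.1 ≠ p.2.2.2.2 ∧
      ((f p.2.1 : ℕ) : ℤ) ∣ (p.2.2.2.1 : ℤ) - p.2.2.2.2 := by
    rintro ⟨k, d₁, d₂, l₁, l₂⟩ hp
    simp only [hP, offDiagonal, Finset.mem_filter, Finset.mem_product] at hp
    obtain ⟨⟨h1, h2, h3, h4, h5⟩, h6, h7, h8⟩ := hp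
    exact ⟨(mem_frequencies hK0).1 h1, h2, h3, Finset.mem_Ico.1 h4, Finset.mem_Ico.1 h5, h6, h7, h8⟩
  have hfpos : ∀ d ∈ 𝒟, 0 < f d := fun d hd => by
    have := Finset.mem_Ico.1 (h𝒟 d hd).2.2.2; omega
  have hlcm : ∀ p ∈ P, 0 < (shape f p).2.1 ∧ (shape f p).2.1 ≤ X ∧
      Nat.lcm p.2.1 p.2.2.1 = f p.2.1 * (shape f p).2.1 := by
    intro p hp
    obtain ⟨h1, h2, h3, h4, h5, h6, h7, h8⟩ := hPmem p hp
    have hd1 := h𝒟 _ h2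
    have hd2 := h𝒟 _ h3
    have := lcm_div_bounds (hfpos _ h2) hd1.2.2.1 (h6 ▸ hd2.2.2.1) hd1.1 hd2.1
    refine ⟨this.2.1, this.2.2.trans ?_, this.1⟩
    have h9 := hX𝒟 _ h2 _ h3
    rwa [← h6] at h9
  -- From `|k| ≤ K`, `|l₁ - l₂| / h ≤ L / H` and `l₁ + l₂ ≤ 4 L`.
  set W := ⌊4 * K * L ^ 2 / H⌋₊ with hW
  have hWle : (W : ℝ) ≤ 4 * K * L ^ 2 / H := Nat.floor_le (by positivity)
  have hWH : (W : ℝ) * H ≤ 4 * K * L ^ 2 := by rwa [le_div_iff₀ (by positivity)] at hWle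
  have hWge : (L : ℝ) ^ 2 ≤ W * H := by
    have h1 : 4 * K * L ^ 2 / H < W + 1 := Nat.lt_floor_add_one _
    rw [div_lt_iff₀ (by positivity)] at h1
    have h2 : (H : ℝ) ≤ L ^ 2 := hHLR.trans (le_self_pow₀ hLR (by norm_num))
    have h3 : (L : ℝ) ^ 2 ≤ K * L ^ 2 := le_mul_of_one_le_left (by positivity) hK
    nlinarith
  have hWpos : 0 < W := by
    rcases Nat.eq_zero_or_pos W with h | h
    · rw [h] at hWge; push_cast at hWge
      have : (0 : ℝ) < L ^ 2 := by positivity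
      linarith
    · exact h
  have hshape3 : ∀ p ∈ P, (shape f p).2.2 ∈ Finset.Icc 1 W := by
    rintro ⟨k, d₁, d₂, l₁, l₂⟩ hp
    obtain ⟨h1, h2, h3, h4, h5, h6, h7, h8⟩ := hPmem _ hp
    simp only at h1 h2 h3 h4 h5 h6 h7 h8
    have h1 := Finset.mem_Icc.1 h1
    have hf1 := Finset.mem_Ico.1 (h𝒟 _ h2).2.2.2
    have hh2 : f d₁ ∣ ((l₁ : ℤ) - l₂).natAbs := Int.natCast_dvd.1 h8
    have hne : 0 < ((l₁ : ℤ) - l₂).natAbs := by omega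
    have ht1 : 0 < ((l₁ : ℤ) - l₂).natAbs / f d₁ := Nat.div_pos (Nat.le_of_dvd hne hh2) (by omega)
    set τ := ((l₁ : ℤ) - l₂).natAbs / f d₁ with hτ
    have hτL : τ * H ≤ L := by
      have e1 : τ * f d₁ = ((l₁ : ℤ) - l₂).natAbs := Nat.div_mul_cancel hh2
      have e2 : τ * H ≤ τ * f d₁ := Nat.mul_le_mul_left _ hf1.1
      omega
    rw [Finset.mem_Icc]
    simp only [shape]
    refine ⟨Nat.mul_pos (by omega) (Nat.mul_pos ht1 (by omega)), ?_⟩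
    rw [hW]
    refine Nat.le_floor ?_
    rw [le_div_iff₀ (by positivity)]
    have k1 : ((k.natAbs : ℕ) : ℝ) ≤ K := (Nat.cast_le.2 h1.2).trans (Nat.floor_le hK0)
    have k2 : (τ : ℝ) * H ≤ L := by exact_mod_cast hτL
    have k3 : ((l₁ + l₂ : ℕ) : ℝ) ≤ 4 * L := by
      have : l₁ + l₂ ≤ 4 * L := by omega
      exact_mod_cast this
    calc ((k.natAbs * (τ * (l₁ + l₂)) : ℕ) : ℝ) * H
        = (k.natAbs : ℕ) * (((τ : ℝ) * H) * ((l₁ + l₂ : ℕ) : ℝ)) := by push_cast; ring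
      _ ≤ K * (L * (4 * L)) := by gcongr
      _ = _ := by ring
  have key : ∀ j, 2 ^ j ≤ X → ∑ p ∈ P.filter (fun p => (shape f p).2.1 ∈
      Finset.Ico (2 ^ j) (2 ^ j + 2 ^ j)), T p ≤ 32 * F ^ 6 * (K * L * q) / (t ^ 5 * H) := by
    intro j hj
    rw [le_div_iff₀ (by positivity)]
    set S := 2 ^ j with hSdef
    have hSpos : 0 < S := by positivity
    have hSR : (1 : ℝ) ≤ S := by exact_mod_cast hSpos
    have hSX : (S : ℝ) ≤ X := by exact_mod_cast hj
    -- A lower bound for `l₁ * lcm(d₁, d₂)`; as `m l₁ < q`, the progression of `m` has at most `q /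
    -- Q + 1` terms.
    set Q := L * H * S with hQ
    have hQpos : 0 < Q := by positivity
    have hQR : (0 : ℝ) < Q := by exact_mod_cast hQpos
    have hQcast : (Q : ℝ) = L * H * S := by rw [hQ]; push_cast; ring
    have hQX : (Q : ℝ) ≤ L * H * X := by rw [hQcast]; gcongr
    have hQq : Q ≤ q := by
      have := hQX.trans hLHXq
      exact_mod_cast this
    set N := q / Q + 1 with hN
    have hNQ : q < Q * N := by
      rw [hN, mul_comm]; exact Nat.lt_div_mul_add hQpos |>.trans_eq (by ring)
    have hNQR : (q : ℝ) ≤ Q * N := by exact_mod_cast hNQ.le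
    have hNQ2 : Q * N ≤ 2 * q := by
      have := Nat.mul_div_le q Q
      rw [hN, mul_add, mul_one]; omega
    have hNQ2R : (Q * N : ℝ) ≤ 2 * q := by exact_mod_cast hNQ2
    have hQ1 : (1 : ℝ) ≤ Q := by exact_mod_cast hQpos
    have hlow : ∀ y : ℝ, (L * H * X : ℝ) * y ≤ q → 0 ≤ y → y ≤ N := by
      intro y hy hy0
      have h1 : (Q : ℝ) * y ≤ Q * N := by
        calc (Q : ℝ) * y ≤ (L * H * X : ℝ) * y := by gcongr
          _ ≤ (q : ℝ) := hy
          _ ≤ Q * N := hNQR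
      exact le_of_mul_le_mul_left h1 hQR
    set P' := P.filter (fun p => (shape f p).2.1 ∈ Finset.Ico S (S + S)) with hP'
    have main := sum_mul_le_of_mixed α hs P' (shape f) T (fun _ => norm_nonneg _)
      (H := H) (S := S) (W := W) (N := N) (Φ := 4 * F ^ 5) hH hSpos hWpos ?_ (by positivity) ?_ ?_
      (hlow _ h80 (by positivity)) ?_ ?_ ?_ ?_
    · have e1 : (H * S * W * N : ℝ) * H ≤ 8 * (K * L * q) := by
        have h1 : (H * S * W * N : ℝ) * H * L ≤ 8 * (K * L * q) * L := by
          calc (H * S * W * N : ℝ) * H * L = (W * H) * (Q * N) := by rw [hQcast]; ring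
            _ ≤ (4 * K * L ^ 2) * (2 * q) := by gcongr
            _ = _ := by ring
        exact le_of_mul_le_mul_right h1 (by positivity)
      calc (∑ p ∈ P', T p) * (t ^ 5 * H) = (∑ p ∈ P', T p) * t ^ 5 * H := by ring
        _ ≤ 4 * F ^ 5 * F * (H * S * W * N) * H := by gcongr
        _ = 4 * F ^ 6 * ((H * S * W * N) * H) := by ring
        _ ≤ 4 * F ^ 6 * (8 * (K * L * q)) := by gcongr
        _ = _ := by ring
    · intro p hp
      have hp := Finset.mem_filter.1 hp
      simp only [Finset.mem_product]
      exact ⟨(h𝒟 _ (hPmem p hp.1).2.1).2.2.2, hp.2, hshape3 p hp.1⟩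
    · rintro ⟨h, s, w⟩ hx
      simp only [Finset.mem_product, Finset.mem_Ico, Finset.mem_Icc] at hx
      obtain ⟨⟨hh1, hh2⟩, ⟨hs1, hs2⟩, ⟨hw1, hw2⟩⟩ := hx
      have hhR : (h : ℝ) ≤ 2 * H := by
        have : h ≤ 2 * H := by omega
        exact_mod_cast this
      have hsR : (s : ℝ) ≤ 2 * X := by
        have : s ≤ 2 * X := by omega
        exact_mod_cast this
      have hwR : (w : ℝ) ≤ W := by exact_mod_cast hw2
      have hq1 := hs.one_le_q
      refine card_shape_fiber_le P' ?_ (by omega) (by omega) (by omega) ?_ ?_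
      · intro p hp
        have hp := (Finset.mem_filter.1 hp).1
        obtain ⟨h1, h2, h3, h4, h5, h6, h7, h8⟩ := hPmem p hp
        exact ⟨hfpos _ h2, (h𝒟 _ h2).2.2.1, (h𝒟 _ h2).1, (h𝒟 _ h3).1, h8⟩
      · refine hs.divisors_le _ (Nat.mul_pos (by omega) (by omega)) ?_
        push_cast
        calc (h : ℝ) * s ≤ (2 * H) * (2 * X) := by gcongr
          _ = 4 * (1 * H * X) := by ring
          _ ≤ 4 * (L * H * X) := by gcongr
          _ ≤ q * q := by gcongr; linarith
          _ = (q : ℝ) ^ 2 := by ring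
          _ ≤ (q : ℝ) ^ 10 := pow_le_pow_right₀ hq1 (by norm_num)
      · refine hs.divisors_le _ (Nat.mul_pos (by omega) (by omega)) ?_
        have hLq : (L : ℝ) ≤ q := le_trans (le_mul_of_one_le_right (by positivity) hHR) hLHq
        push_cast
        calc (h : ℝ) * w ≤ (2 * H) * W := by gcongr
          _ = 2 * (W * H) := by ring
          _ ≤ 2 * (4 * K * L ^ 2) := by gcongr
          _ = 8 * (K * L ^ 2) := by ring
          _ ≤ q * (q * (q : ℝ) ^ 2) := by gcongr; linarith
          _ = (q : ℝ) ^ 4 := by ring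
          _ ≤ (q : ℝ) ^ 10 := pow_le_pow_right₀ hq1 (by norm_num)
    · rintro κ hκ hκ1 ⟨k, d₁, d₂, l₁, l₂⟩ hp
      have hp := Finset.mem_filter.1 hp
      obtain ⟨h1, h2, h3, h4, h5, h6, h7, h8⟩ := hPmem _ hp.1
      obtain ⟨g1, g2, g3⟩ := hlcm _ hp.1
      have hS2 := (Finset.mem_Ico.1 hp.2).1
      simp only at h1 h2 h3 h4 h5 h6 h7 h8 g3
      have hf1 := Finset.mem_Ico.1 (h𝒟 _ h2).2.2.2
      have hlen : q ≤ l₁ * (Nat.lcm d₁ d₂ * N) := by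
        calc q ≤ Q * N := hNQ.le
          _ = L * (H * S * N) := by rw [hQ]; ring
          _ ≤ l₁ * (f d₁ * (shape f (k, d₁, d₂, l₁, l₂)).2.1 * N) := by
              gcongr
              · exact h4.1
              · exact hf1.1
          _ = _ := by rw [g3]
      have := norm_sq_sum_pairRange_le (h𝒟 _ h2).1 (h𝒟 _ h3).1 (h𝒟 _ h2).2.1 (h𝒟 _ h3).2.1
        hκ hκ1 (l₂ := l₂) hlen (α * k * ((l₁ : ℝ) ^ 2 - (l₂ : ℝ) ^ 2))
      refine this.trans (le_of_eq ?_)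
      congr 2
      exact Finset.sum_congr rfl fun u _ => near_shape α κ (h𝒟 _ h2).2.2.1 h8 u
    · rcases hcase with h | h
      · left; exact hlow _ h (by positivity)
      · right; left; exact hSX.trans h
    · have : (N : ℝ) ≤ Q * N := le_mul_of_one_le_left (by positivity) hQ1
      linarith
    · have h1 : (q : ℝ) ^ 2 * L ^ 2 ≤ (H ^ 3 * S ^ 2 * W * N ^ 2) * L ^ 2 := by
        calc (q : ℝ) ^ 2 * L ^ 2 ≤ (Q * N) ^ 2 * (W * H) := by gcongr
          _ = _ := by rw [hQcast]; ring
      exact le_of_mul_le_mul_right h1 (by positivity)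
    · have hLq : (L : ℝ) ≤ q := le_trans (le_mul_of_one_le_right (by positivity) hHR) hLHq
      have hLHS : (L * H * S : ℝ) ≤ q := by rw [← hQcast]; exact hQX.trans hLHXq
      have hq1 := hs.one_le_q
      calc 2 * (W * N : ℝ) * S ^ 2 * H ^ 3 = 2 * (W * H) * (1 * H * S * N) * (1 * H * S) := by ring
        _ ≤ 2 * (4 * K * L ^ 2) * (L * H * S * N) * (L * H * S) := by gcongr
        _ = 8 * K * L ^ 2 * (Q * N) * (L * H * S) := by rw [hQcast]; ring
        _ ≤ 8 * q * (q : ℝ) ^ 2 * (2 * q) * q := by gcongr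
        _ = 16 * (q : ℝ) ^ 5 := by ring
        _ ≤ q * (q : ℝ) ^ 5 := by gcongr; linarith
        _ = (q : ℝ) ^ 6 := by ring
        _ ≤ (q : ℝ) ^ 10 := pow_le_pow_right₀ hq1 (by norm_num)
  have hfin := sum_le_of_dyadic P (fun p => (shape f p).2.1) T (X := X) ?_ key hX
  · have hXq : (X : ℝ) ≤ (q : ℝ) ^ 10 := by
      calc (X : ℝ) = 1 * 1 * X := by ring
        _ ≤ L * H * X := by gcongr
        _ ≤ (q : ℝ) := hLHXq
        _ ≤ (q : ℝ) ^ 10 := le_self_pow₀ hs.one_le_q (by norm_num)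
    have hlog := hs.log_two_le hX hXq
    calc (∑ p ∈ P, T p) * t ^ 5 * H ≤ (((Nat.log 2 X + 1 : ℕ) : ℝ) *
          (32 * F ^ 6 * (K * L * q) / (t ^ 5 * H))) * t ^ 5 * H := by gcongr
      _ ≤ (F * (32 * F ^ 6 * (K * L * q) / (t ^ 5 * H))) * t ^ 5 * H := by gcongr
      _ = 32 * F ^ 7 * (K * L * q) := by field_simp
  · intro p hp
    exact ⟨(hlcm p hp).1, (hlcm p hp).2.1⟩

/-! ### Opening the square, and the diagonal pairs. -/

lemma sum_norm_sq_sum_le {ι τ : Type*} (R : Finset ι) (I : Finset τ) (v : ι → τ → ℂ) :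
    ∑ m ∈ R, ‖∑ i ∈ I, v m i‖ ^ 2
      ≤ ∑ i ∈ I, ∑ j ∈ I, ‖∑ m ∈ R, v m i * (starRingEnd ℂ) (v m j)‖ := by
  have h1 : ((∑ m ∈ R, ‖∑ i ∈ I, v m i‖ ^ 2 : ℝ) : ℂ)
      = ∑ i ∈ I, ∑ j ∈ I, ∑ m ∈ R, v m i * (starRingEnd ℂ) (v m j) := by
    push_cast
    simp only [← Complex.mul_conj', map_sum, Finset.sum_mul_sum]
    rw [Finset.sum_comm]
    refine Finset.sum_congr rfl fun i _ => ?_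
    rw [Finset.sum_comm]
  have h0 : 0 ≤ ∑ m ∈ R, ‖∑ i ∈ I, v m i‖ ^ 2 := Finset.sum_nonneg fun _ _ => by positivity
  calc ∑ m ∈ R, ‖∑ i ∈ I, v m i‖ ^ 2 = ‖((∑ m ∈ R, ‖∑ i ∈ I, v m i‖ ^ 2 : ℝ) : ℂ)‖ := by
        rw [Complex.norm_real, Real.norm_of_nonneg h0]
    _ ≤ _ := by
        rw [h1]
        exact (norm_sum_le _ _).trans (Finset.sum_le_sum fun i _ => norm_sum_le _ _)

/-- The condition `m l ∈ [q/2, q)`, `m l ≡ b (mod d)`. -/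
def Cond (q : ℕ) (b : ℤ) (d m l : ℕ) : Prop :=
  q ≤ 2 * (m * l) ∧ m * l < q ∧ (m * l : ℤ) ≡ b [ZMOD d]

instance (q : ℕ) (b : ℤ) (d m l : ℕ) : Decidable (Cond q b d m l) := by
  unfold Cond; infer_instance

lemma card_modEq_le (q h : ℕ) (b : ℤ) :
    ((Finset.range q).filter fun n : ℕ => (n : ℤ) ≡ b [ZMOD h]).card ≤ q / h + 1 := by
  rw [← Finset.card_range (q / h + 1)]
  refine Finset.card_le_card_of_injOn (fun n => n / h) ?_ ?_
  · intro n hn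
    have hn := Finset.mem_range.1 (Finset.mem_filter.1 hn).1
    simp only [Finset.coe_range, Set.mem_Iio]
    have := Nat.div_le_div_right (c := h) hn.le
    omega
  · intro n hn n' hn' heq
    have h1 := (Finset.mem_filter.1 hn).2
    have h2 := (Finset.mem_filter.1 hn').2
    have h3 : n ≡ n' [MOD h] := Int.natCast_modEq_iff.1 (h1.trans h2.symm)
    have h4 := Nat.div_add_mod n h
    have h5 := Nat.div_add_mod n' h
    simp only at heq
    have h6 : n % h = n' % h := h3
    rw [heq, h6] at h4
    omega

/-- The diagonal contribution, for one value of the first factor. -/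
lemma sum_diagonal_le {α : ℝ} {q : ℕ} {t F : ℝ} (hs : Setting α q t F) {b : ℤ}
    (hb : 2 * b.natAbs < q) {h L : ℕ} (hh : 0 < h) (hhq : h ≤ q) (hL : 0 < L) (𝒟 : Finset ℕ)
    (h𝒟 : ∀ d ∈ 𝒟, 0 < d ∧ h ∣ d) :
    ∑ d₁ ∈ 𝒟, ∑ d₂ ∈ 𝒟, ∑ l ∈ Finset.Ico L (L + L), ((pairRange q b d₁ d₂ l l).card : ℝ)
      ≤ F ^ 3 * (2 * q / h) := by
  have hF := hs.one_le_F
  have hq := hs.q_posR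
  have hq10 : (2 * q : ℝ) ≤ (q : ℝ) ^ 10 := by
    have h2 : (2 : ℝ) ≤ q := by
      have : 2 ≤ q ∨ q = 1 := by have := hs.q_pos; omega
      rcases this with h | h
      · exact_mod_cast h
      · exfalso
        have h1 : F ^ 1 ≤ t := hs.F_pow_le_t (by norm_num)
        have h3 : t ^ 1 ≤ (q : ℝ) := hs.t_pow_le_q (by norm_num)
        rw [pow_one] at h1 h3
        rw [h] at h3; push_cast at h3
        linarith [hs.le_F]
    calc (2 * q : ℝ) ≤ q * q := by gcongr
      _ = (q : ℝ) ^ 2 := by ring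
      _ ≤ _ := pow_le_pow_right₀ hs.one_le_q (by norm_num)
  set M := q / L with hM
  set g : ℕ → ℝ := fun n => if n < q ∧ (n : ℤ) ≡ b [ZMOD h] then 1 else 0 with hg
  have hg0 : ∀ n, 0 ≤ g n := fun n => by simp only [hg]; split_ifs <;> norm_num
  have hcard : ∀ d₁ d₂ l, l ∈ Finset.Ico L (L + L) → ((pairRange q b d₁ d₂ l l).card : ℝ)
      = ∑ m ∈ Finset.Icc 1 M, (if Cond q b d₁ m l ∧ Cond q b d₂ m l then (1 : ℝ) else 0) := by
    intro d₁ d₂ l hl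
    have hl := Finset.mem_Ico.1 hl
    rw [Finset.sum_ite, Finset.sum_const_zero, add_zero, Finset.sum_const, nsmul_eq_mul, mul_one]
    congr 2
    ext m
    rw [pairRange, Finset.mem_filter, Finset.mem_filter, Finset.mem_range, Finset.mem_Icc]
    constructor
    · rintro ⟨-, h1, h2⟩
      refine ⟨⟨?_, ?_⟩, h1, h2⟩
      · rcases Nat.eq_zero_or_pos m with h | h
        · rw [h] at h1; have := hs.q_pos; omega
        · exact h
      · rw [hM, Nat.le_div_iff_mul_le hL]
        exact (Nat.mul_le_mul_left _ hl.1).trans h1.2.1.le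
    · rintro ⟨-, h1, h2⟩
      refine ⟨?_, h1, h2⟩
      exact (Nat.le_mul_of_pos_right m (by omega)).trans_lt h1.2.1
  -- For fixed `m, l` the moduli are divisors of `m l - b`, so there are at most `F ^ 2` pairs;
  -- moreover `m l` lies in one class modulo `h`, which gains the factor `1 / h`.
  have hpt : ∀ m l : ℕ, ∑ d₁ ∈ 𝒟, ∑ d₂ ∈ 𝒟,
      (if Cond q b d₁ m l ∧ Cond q b d₂ m l then (1 : ℝ) else 0) ≤ F ^ 2 * g (m * l) := by
    intro m l
    have e1 : ∑ d₁ ∈ 𝒟, ∑ d₂ ∈ 𝒟, (if Cond q b d₁ m l ∧ Cond q b d₂ m l then (1 : ℝ) else 0)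
        = (∑ d ∈ 𝒟, if Cond q b d m l then (1 : ℝ) else 0) ^ 2 := by
      rw [pow_two, Finset.sum_mul_sum]
      refine Finset.sum_congr rfl fun d₁ _ => Finset.sum_congr rfl fun d₂ _ => ?_
      by_cases h1 : Cond q b d₁ m l <;> by_cases h2 : Cond q b d₂ m l <;> simp [h1, h2]
    rw [e1, Finset.sum_ite, Finset.sum_const_zero, add_zero, Finset.sum_const, nsmul_eq_mul, mul_one]
    set E := 𝒟.filter fun d => Cond q b d m l with hE
    rcases E.eq_empty_or_nonempty with h0 | ⟨d, hd⟩
    · rw [h0]; simp only [Finset.card_empty, Nat.cast_zero, ne_eq, OfNat.ofNat_ne_zero,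
        not_false_eq_true, zero_pow]
      exact mul_nonneg (by positivity) (hg0 _)
    · have hd := Finset.mem_filter.1 hd
      obtain ⟨c1, c2, c3⟩ := hd.2
      have hgv : g (m * l) = 1 := by
        simp only [hg]
        rw [if_pos]
        refine ⟨c2, ?_⟩
        push_cast
        exact c3.of_dvd (by exact_mod_cast (h𝒟 d hd.1).2)
      rw [hgv, mul_one]
      -- Since `2 |b| < q ≤ 2 m l`, the number `m l - b` is not 0 and the divisor bound is
      -- available.
      have hnz : 1 ≤ ((m * l : ℕ) - b : ℤ).natAbs := by omega
      have hdiv := hs.divisors_le (((m * l : ℕ) - b : ℤ).natAbs) hnz (by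
        refine le_trans ?_ hq10
        have : ((m * l : ℕ) - b : ℤ).natAbs ≤ 2 * q := by omega
        exact_mod_cast this)
      have hEc : (E.card : ℝ) ≤ F := by
        refine le_trans ?_ hdiv
        apply Nat.cast_le.2
        refine Finset.card_le_card fun d' hd' => ?_
        have hd' := Finset.mem_filter.1 hd'
        rw [Nat.mem_divisors]
        refine ⟨?_, by omega⟩
        have := hd'.2.2.2.symm.dvd
        rw [← Int.natCast_dvd]
        push_cast; exact this
      gcongr
  have hAB : M * (2 * L) ≤ 2 * q := by
    have := Nat.div_mul_le_self q L
    calc M * (2 * L) = 2 * (q / L * L) := by rw [hM]; ring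
      _ ≤ 2 * q := by omega
  have hprod := sum_mul_le_divisor_bound (F := F) (A := M) (B := 2 * L) g hg0 (by
    intro n hn hn2
    refine hs.divisors_le n hn (le_trans ?_ hq10)
    exact_mod_cast hn2.trans hAB)
  have hgsum : ∑ n ∈ Finset.Icc 1 (M * (2 * L)), g n ≤ 2 * q / h := by
    have h1 : ∑ n ∈ Finset.Icc 1 (M * (2 * L)), g n
        ≤ (((Finset.range q).filter fun n : ℕ => (n : ℤ) ≡ b [ZMOD h]).card : ℝ) := by
      simp only [hg]
      rw [Finset.sum_ite, Finset.sum_const_zero, add_zero, Finset.sum_const, nsmul_eq_mul, mul_one]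
      apply Nat.cast_le.2
      refine Finset.card_le_card fun n hn => ?_
      simp only [Finset.mem_filter, Finset.mem_range] at hn ⊢
      exact hn.2
    refine h1.trans ?_
    have h2 : (((Finset.range q).filter fun n : ℕ => (n : ℤ) ≡ b [ZMOD h]).card : ℝ)
        ≤ ((q / h : ℕ) : ℝ) + 1 := by exact_mod_cast card_modEq_le q h b
    have h3 : ((q / h : ℕ) : ℝ) ≤ q / h := Nat.cast_div_le
    have h4 : (1 : ℝ) ≤ q / h := by
      rw [one_le_div (by exact_mod_cast hh)]; exact_mod_cast hhq
    have e2 : 2 * (q : ℝ) / h = q / h + q / h := by ring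
    linarith
  calc ∑ d₁ ∈ 𝒟, ∑ d₂ ∈ 𝒟, ∑ l ∈ Finset.Ico L (L + L), ((pairRange q b d₁ d₂ l l).card : ℝ)
      = ∑ d₁ ∈ 𝒟, ∑ d₂ ∈ 𝒟, ∑ l ∈ Finset.Ico L (L + L), ∑ m ∈ Finset.Icc 1 M,
          (if Cond q b d₁ m l ∧ Cond q b d₂ m l then (1 : ℝ) else 0) :=
        Finset.sum_congr rfl fun d₁ _ => Finset.sum_congr rfl fun d₂ _ =>
          Finset.sum_congr rfl fun l hl => hcard d₁ d₂ l hl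
    _ = ∑ m ∈ Finset.Icc 1 M, ∑ l ∈ Finset.Ico L (L + L), ∑ d₁ ∈ 𝒟, ∑ d₂ ∈ 𝒟,
          (if Cond q b d₁ m l ∧ Cond q b d₂ m l then (1 : ℝ) else 0) := by
        have e3 : ∀ d₁ ∈ 𝒟, ∑ d₂ ∈ 𝒟, ∑ l ∈ Finset.Ico L (L + L), ∑ m ∈ Finset.Icc 1 M,
            (if Cond q b d₁ m l ∧ Cond q b d₂ m l then (1 : ℝ) else 0)
            = ∑ m ∈ Finset.Icc 1 M, ∑ l ∈ Finset.Ico L (L + L), ∑ d₂ ∈ 𝒟,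
              (if Cond q b d₁ m l ∧ Cond q b d₂ m l then (1 : ℝ) else 0) := by
          intro d₁ _
          rw [Finset.sum_comm]
          conv_lhs => enter [2, l]; rw [Finset.sum_comm]
          rw [Finset.sum_comm]
        rw [Finset.sum_congr rfl e3, Finset.sum_comm]
        refine Finset.sum_congr rfl fun m _ => ?_
        rw [Finset.sum_comm]
    _ ≤ ∑ m ∈ Finset.Icc 1 M, ∑ l ∈ Finset.Ico L (L + L), F ^ 2 * g (m * l) :=
        Finset.sum_le_sum fun m _ => Finset.sum_le_sum fun l _ => hpt m l
    _ ≤ ∑ m ∈ Finset.Icc 1 M, ∑ l ∈ Finset.Icc 1 (2 * L), F ^ 2 * g (m * l) := by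
        refine Finset.sum_le_sum fun m _ => Finset.sum_le_sum_of_subset_of_nonneg ?_ ?_
        · intro l hl
          have := Finset.mem_Ico.1 hl
          rw [Finset.mem_Icc]; omega
        · intro l _ _
          exact mul_nonneg (by positivity) (hg0 _)
    _ = F ^ 2 * ∑ m ∈ Finset.Icc 1 M, ∑ l ∈ Finset.Icc 1 (2 * L), g (m * l) := by
        simp only [Finset.mul_sum]
    _ ≤ F ^ 2 * (F * (2 * q / h)) := by
        gcongr
        exact hprod.trans (by gcongr)
    _ = _ := by ring

/-! ### Bilinear sums: dispersion and well-separability. -/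

/-- The bilinear sum over `m l ≡ b (mod d)`, `m l ∈ [q/2, q)`, with `l` restricted to `R`. -/
def bilinearSum (α β : ℝ) (q : ℕ) (b : ℤ) (K : ℝ) (𝒟 : Finset ℕ) (lam : ℕ → ℂ) (c : ℤ → ℂ)
    (u v : ℕ → ℂ) (R : Finset ℕ) : ℂ :=
  ∑ d ∈ 𝒟, ∑ k ∈ frequencies K, ∑ m ∈ Finset.Icc 1 q, ∑ l ∈ R,
    if Cond q b d m l then
      lam d * c k * u m * v l * e ((α * ((m * l : ℕ) : ℝ) ^ 2 + β) * k) else 0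

/-- The exponential sum attached to a pair of moduli and a pair of `l`. -/
def pairSum (α : ℝ) (q : ℕ) (b : ℤ) (k : ℤ) (d₁ d₂ l₁ l₂ : ℕ) : ℝ :=
  ‖∑ m ∈ pairRange q b d₁ d₂ l₁ l₂, e (α * k * ((l₁ : ℝ) ^ 2 - (l₂ : ℝ) ^ 2) * (m : ℝ) ^ 2)‖

/-- Splitting the dispersion into diagonal and off-diagonal parts. -/
lemma pairSum_le (α : ℝ) (q : ℕ) {b : ℤ} (k : ℤ) {h d₁ d₂ : ℕ} (l₁ l₂ : ℕ)
    (hb₁ : IsCoprime b (d₁ : ℤ)) (h₁ : h ∣ d₁) (h₂ : h ∣ d₂) :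
    pairSum α q b k d₁ d₂ l₁ l₂ ≤ (if l₁ = l₂ then ((pairRange q b d₁ d₂ l₁ l₁).card : ℝ) else 0) +
      (if l₁ ≠ l₂ ∧ (h : ℤ) ∣ (l₁ : ℤ) - l₂ then pairSum α q b k d₁ d₂ l₁ l₂ else 0) := by
  by_cases h0 : l₁ = l₂
  · subst h0
    simp only [if_true, ne_eq, not_true_eq_false, false_and, if_false, add_zero]
    refine (norm_sum_le _ _).trans ?_
    simp [norm_e]
  · by_cases h3 : (h : ℤ) ∣ (l₁ : ℤ) - l₂
    · simp [h0, h3]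
    · simp only [h0, if_false, h3, and_false, zero_add]
      have : pairRange q b d₁ d₂ l₁ l₂ = ∅ := by
        rw [Finset.eq_empty_iff_forall_notMem]
        intro m hm
        exact h3 (dvd_sub_of_mem_pairRange hb₁ h₁ h₂ hm)
      simp [pairSum, this]

lemma sum_offDiagonal_eq (K : ℝ) (H L : ℕ) (𝒟 : Finset ℕ) (f : ℕ → ℕ)
    (hf : ∀ d ∈ 𝒟, f d ∈ Finset.Ico H (H + H)) (G : ℤ → ℕ → ℕ → ℕ → ℕ → ℝ) :
    ∑ k ∈ frequencies K, ∑ h ∈ Finset.Ico H (H + H), ∑ d₁ ∈ 𝒟.filter (fun d => f d = h),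
      ∑ d₂ ∈ 𝒟.filter (fun d => f d = h), ∑ l₁ ∈ Finset.Ico L (L + L), ∑ l₂ ∈ Finset.Ico L (L + L),
        (if l₁ ≠ l₂ ∧ (h : ℤ) ∣ (l₁ : ℤ) - l₂ then G k d₁ d₂ l₁ l₂ else 0)
      = ∑ p ∈ offDiagonal K L 𝒟 f, G p.1 p.2.1 p.2.2.1 p.2.2.2.1 p.2.2.2.2 := by
  rw [offDiagonal, Finset.sum_filter, Finset.sum_product]
  refine Finset.sum_congr rfl fun k _ => ?_
  rw [Finset.sum_product]
  have h1 : ∀ h ∈ Finset.Ico H (H + H), ∑ d₁ ∈ 𝒟.filter (fun d => f d = h),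
      ∑ d₂ ∈ 𝒟.filter (fun d => f d = h), ∑ l₁ ∈ Finset.Ico L (L + L), ∑ l₂ ∈ Finset.Ico L (L + L),
        (if l₁ ≠ l₂ ∧ (h : ℤ) ∣ (l₁ : ℤ) - l₂ then G k d₁ d₂ l₁ l₂ else 0)
      = ∑ d₁ ∈ 𝒟.filter (fun d => f d = h), ∑ d₂ ∈ 𝒟, ∑ l₁ ∈ Finset.Ico L (L + L),
        ∑ l₂ ∈ Finset.Ico L (L + L), (if f d₁ = f d₂ ∧ l₁ ≠ l₂ ∧
          ((f d₁ : ℕ) : ℤ) ∣ (l₁ : ℤ) - l₂ then G k d₁ d₂ l₁ l₂ else 0) := by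
    intro h _
    refine Finset.sum_congr rfl fun d₁ hd₁ => ?_
    have hd₁ := (Finset.mem_filter.1 hd₁).2
    rw [Finset.sum_filter]
    refine Finset.sum_congr rfl fun d₂ _ => ?_
    by_cases h2 : f d₂ = h
    · rw [if_pos h2]
      refine Finset.sum_congr rfl fun l₁ _ => Finset.sum_congr rfl fun l₂ _ => ?_
      simp [h2, hd₁]
    · rw [if_neg h2]
      symm
      refine Finset.sum_eq_zero fun l₁ _ => Finset.sum_eq_zero fun l₂ _ => ?_
      rw [if_neg]
      rintro ⟨h3, -⟩
      exact h2 (h3 ▸ hd₁)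
  rw [Finset.sum_congr rfl h1, Finset.sum_fiberwise_of_maps_to hf]
  refine Finset.sum_congr rfl fun d₁ _ => ?_
  rw [Finset.sum_product]
  refine Finset.sum_congr rfl fun d₂ _ => ?_
  rw [Finset.sum_product]

/-- The summand of the inner sum after Cauchy's inequality. -/
def innerTerm (α : ℝ) (q : ℕ) (b : ℤ) (lam v : ℕ → ℂ) (k : ℤ) (m : ℕ) (i : ℕ × ℕ) : ℂ :=
  if Cond q b i.1 m i.2 then lam i.1 * v i.2 * e (α * k * ((m * i.2 : ℕ) : ℝ) ^ 2) else 0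

/-- On the common range the two phases combine to `α k (l₁² - l₂²) m²`; the four weights do not
depend on `m` and leave the sum with a factor `F ^ 4`. -/
lemma norm_sum_innerTerm_le (α : ℝ) (q : ℕ) (b : ℤ) {lam v : ℕ → ℂ} {F : ℝ} (k : ℤ)
    {L d₁ d₂ l₁ l₂ : ℕ} (hL : 0 < L) (hl₁ : L ≤ l₁)
    (hd₁ : ‖lam d₁‖ ≤ F) (hd₂ : ‖lam d₂‖ ≤ F) (hv : ∀ l, ‖v l‖ ≤ F) :
    ‖∑ m ∈ Finset.Icc 1 (q / L), innerTerm α q b lam v k m (d₁, l₁) *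
      (starRingEnd ℂ) (innerTerm α q b lam v k m (d₂, l₂))‖ ≤ F ^ 4 * pairSum α q b k d₁ d₂ l₁ l₂ := by
  have hF : 0 ≤ F := (norm_nonneg _).trans hd₁
  have h1 : ∑ m ∈ Finset.Icc 1 (q / L), innerTerm α q b lam v k m (d₁, l₁) *
      (starRingEnd ℂ) (innerTerm α q b lam v k m (d₂, l₂))
      = (lam d₁ * v l₁ * (starRingEnd ℂ) (lam d₂ * v l₂)) * ∑ m ∈ pairRange q b d₁ d₂ l₁ l₂,
        e (α * k * ((l₁ : ℝ) ^ 2 - (l₂ : ℝ) ^ 2) * (m : ℝ) ^ 2) := by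
    rw [Finset.mul_sum]
    symm
    refine Finset.sum_subset_zero_on_sdiff ?_ ?_ ?_
    · intro m hm
      rw [pairRange, Finset.mem_filter, Finset.mem_range] at hm
      obtain ⟨-, c1, c2⟩ := hm
      rw [Finset.mem_Icc]
      refine ⟨?_, ?_⟩
      · rcases Nat.eq_zero_or_pos m with h | h
        · rw [h] at c1; omega
        · exact h
      · rw [Nat.le_div_iff_mul_le hL]
        exact (Nat.mul_le_mul_left _ hl₁).trans c1.2.1.le
    · intro m hm
      rw [Finset.mem_sdiff, pairRange, Finset.mem_filter, Finset.mem_range] at hm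
      simp only [innerTerm]
      by_cases c1 : Cond q b d₁ m l₁
      · by_cases c2 : Cond q b d₂ m l₂
        · exfalso
          refine hm.2 ⟨?_, c1, c2⟩
          exact (Nat.le_mul_of_pos_right m (by omega)).trans_lt c1.2.1
        · simp [c2]
      · simp [c1]
    · intro m hm
      rw [pairRange, Finset.mem_filter] at hm
      obtain ⟨-, c1, c2⟩ := hm
      simp only [innerTerm]
      rw [if_pos (show Cond q b d₁ m l₁ from c1), if_pos (show Cond q b d₂ m l₂ from c2)]
      have : e (α * k * ((l₁ : ℝ) ^ 2 - (l₂ : ℝ) ^ 2) * (m : ℝ) ^ 2)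
          = e (α * k * ((m * l₁ : ℕ) : ℝ) ^ 2) *
            (starRingEnd ℂ) (e (α * k * ((m * l₂ : ℕ) : ℝ) ^ 2)) := by
        rw [conj_e, ← e_add]; congr 1; push_cast; ring
      rw [this, map_mul, map_mul, map_mul]; ring
  rw [h1, norm_mul, pairSum]
  gcongr
  rw [norm_mul, norm_mul, RCLike.norm_conj, norm_mul]
  calc ‖lam d₁‖ * ‖v l₁‖ * (‖lam d₂‖ * ‖v l₂‖) ≤ F * F * (F * F) := by
        gcongr
        · exact hv _
        · exact hv _
    _ = _ := by ring

/-- The dispersion estimate for one dyadic block of `l` and of the first factor of `d`. -/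
lemma bilinearSum_block_le (α β : ℝ) {q : ℕ} {t F : ℝ} (hs : Setting α q t F) {K : ℝ} (hK : 1 ≤ K)
    (hKq : K ≤ q) {b : ℤ} (hb : 2 * b.natAbs < q) {H L X : ℕ} (hH : 0 < H)
    (hHL : (H : ℝ) * t ^ 5 ≤ L) (hX : 1 ≤ X) (𝒟 : Finset ℕ) (f : ℕ → ℕ)
    (h𝒟 : ∀ d ∈ 𝒟, 1 ≤ d ∧ IsCoprime b (d : ℤ) ∧ f d ∣ d ∧ f d ∈ Finset.Ico H (H + H))
    (hX𝒟 : ∀ d ∈ 𝒟, ∀ d' ∈ 𝒟, d / f d * (d' / f d') ≤ X)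
    (h80 : (L * H * X : ℝ) * t ^ 80 ≤ q)
    (hcase : (L * H * X : ℝ) * t ^ 140 ≤ q ∨ (X : ℝ) ≤ t ^ 24)
    {lam : ℕ → ℂ} {c : ℤ → ℂ} {u v : ℕ → ℂ} (hlam : ∀ d ∈ 𝒟, ‖lam d‖ ≤ F)
    (hc : ∀ k ∈ frequencies K, ‖c k‖ ≤ F) (hu : ∀ m, ‖u m‖ ≤ F) (hv : ∀ l, ‖v l‖ ≤ F) :
    ‖bilinearSum α β q b K 𝒟 lam c u v (Finset.Ico L (L + L))‖ ^ 2 * t ^ 5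
      ≤ 72 * F ^ 15 * (K * q) ^ 2 := by
  have hq := hs.q_posR
  have hF := hs.one_le_F
  have htp := hs.t_pos
  have ht := hs.one_le_t
  have hK0 : 0 ≤ K := by linarith
  have hHR : (1 : ℝ) ≤ H := by exact_mod_cast hH
  have hHLR : (H : ℝ) ≤ L := (le_mul_of_one_le_right (by positivity) (one_le_pow₀ ht)).trans hHL
  have hHLn : H ≤ L := by exact_mod_cast hHLR
  have hLpos : 0 < L := by omega
  have hLR : (0 : ℝ) < L := by exact_mod_cast hLpos
  have hXR : (1 : ℝ) ≤ X := by exact_mod_cast hX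
  have hLHXq : (L * H * X : ℝ) ≤ q :=
    le_trans (le_mul_of_one_le_right (by positivity) (one_le_pow₀ ht)) h80
  have hLHq : (L * H : ℝ) ≤ q := le_trans (le_mul_of_one_le_right (by positivity) hXR) hLHXq
  have hHq : H * 2 ≤ 2 * q := by
    have h1 : (H : ℝ) ≤ q := by
      refine le_trans ?_ hLHq
      exact le_mul_of_one_le_left (by positivity) (by exact_mod_cast hLpos)
    have : H ≤ q := by exact_mod_cast h1
    omega
  set M := q / L with hM
  have hMle : (M : ℝ) ≤ q / L := Nat.cast_div_le
  set 𝓗 := Finset.Ico H (H + H) with h𝓗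
  set I : ℕ → Finset (ℕ × ℕ) := fun h => 𝒟.filter (fun d => f d = h) ×ˢ Finset.Ico L (L + L) with hI
  set Xs : ℤ × ℕ × ℕ → ℂ := fun p => ∑ i ∈ I p.2.1, innerTerm α q b lam v p.1 p.2.2 i with hXs
  set idx := frequencies K ×ˢ 𝓗 ×ˢ Finset.Icc 1 M with hidx
  -- The moduli are grouped by `h = f d`; the inner sum `Xs` runs over `l` and the `d` with this
  -- `h`. The range of `m` shrinks to `q / L` because `l ≥ L`.
  have hB : bilinearSum α β q b K 𝒟 lam c u v (Finset.Ico L (L + L))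
      = ∑ p ∈ idx, c p.1 * u p.2.2 * e (β * p.1) * Xs p := by
    rw [hidx, Finset.sum_product]
    simp only [Finset.sum_product, hXs, hI]
    rw [bilinearSum, Finset.sum_comm]
    refine Finset.sum_congr rfl fun k _ => ?_
    rw [← Finset.sum_fiberwise_of_maps_to (fun d hd => (h𝒟 d hd).2.2.2)]
    refine Finset.sum_congr rfl fun h _ => ?_
    rw [Finset.sum_comm]
    symm
    refine Finset.sum_subset_zero_on_sdiff ?_ ?_ ?_
    · refine Finset.Icc_subset_Icc_right ?_
      exact Nat.div_le_self _ _
    · intro m hm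
      rw [Finset.mem_sdiff, Finset.mem_Icc, Finset.mem_Icc] at hm
      refine Finset.sum_eq_zero fun d _ => Finset.sum_eq_zero fun l hl => ?_
      have hl := Finset.mem_Ico.1 hl
      rw [if_neg]
      rintro ⟨-, c2, -⟩
      apply hm.2
      refine ⟨hm.1.1, ?_⟩
      rw [hM, Nat.le_div_iff_mul_le hLpos]
      exact (Nat.mul_le_mul_left _ hl.1).trans c2.le
    · intro m _
      rw [Finset.mul_sum]
      refine Finset.sum_congr rfl fun d _ => ?_
      rw [Finset.mul_sum]
      refine Finset.sum_congr rfl fun l _ => ?_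
      simp only [innerTerm]
      split_ifs
      · have : e ((α * ((m * l : ℕ) : ℝ) ^ 2 + β) * k)
            = e (β * k) * e (α * k * ((m * l : ℕ) : ℝ) ^ 2) := by
          rw [← e_add]; congr 1; ring
        rw [this]; ring
      · simp
  have hcardidx : (idx.card : ℝ) ≤ 2 * K * H * (q / L) := by
    rw [hidx, Finset.card_product, Finset.card_product, h𝓗, Nat.card_Ico, Nat.card_Icc,
      Nat.add_sub_cancel, Nat.add_sub_cancel]
    push_cast
    have := card_frequencies_le hK0
    calc ((frequencies K).card : ℝ) * (H * M) ≤ (2 * K) * (H * (q / L)) := by gcongr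
      _ = _ := by ring
  have hnorm : ‖bilinearSum α β q b K 𝒟 lam c u v (Finset.Ico L (L + L))‖
      ≤ ∑ p ∈ idx, F ^ 2 * ‖Xs p‖ := by
    rw [hB]
    refine (norm_sum_le _ _).trans (Finset.sum_le_sum fun p hp => ?_)
    rw [norm_mul, norm_mul, norm_mul, norm_e, mul_one, pow_two]
    have hk := (Finset.mem_product.1 hp).1
    gcongr
    · exact hc _ hk
    · exact hu _
  -- Cauchy's inequality over `(k, h, m)`, of which there are at most `2 K H (q / L)`.
  have hsq : ‖bilinearSum α β q b K 𝒟 lam c u v (Finset.Ico L (L + L))‖ ^ 2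
      ≤ (2 * K * H * (q / L)) * (F ^ 4 * ∑ p ∈ idx, ‖Xs p‖ ^ 2) := by
    calc _ ≤ (∑ p ∈ idx, F ^ 2 * ‖Xs p‖) ^ 2 := by gcongr
      _ ≤ idx.card * ∑ p ∈ idx, (F ^ 2 * ‖Xs p‖) ^ 2 := sq_sum_le_card_mul_sum_sq
      _ = idx.card * (F ^ 4 * ∑ p ∈ idx, ‖Xs p‖ ^ 2) := by
          congr 1; rw [Finset.mul_sum]
          exact Finset.sum_congr rfl fun p _ => by ring
      _ ≤ _ := by gcongr
  set Off := ∑ p ∈ offDiagonal K L 𝒟 f, pairSum α q b p.1 p.2.1 p.2.2.1 p.2.2.2.1 p.2.2.2.2 with hOff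
  have hOffle : Off * t ^ 5 * H ≤ 32 * F ^ 7 * (K * L * q) :=
    sum_offDiagonal_le α hs hK hKq b hH hHLn hX 𝒟 f h𝒟 hX𝒟 h80 hcase
  have hXsum : ∑ p ∈ idx, ‖Xs p‖ ^ 2 ≤ F ^ 4 * (4 * F ^ 3 * (K * q) + Off) := by
    have h1 : ∑ p ∈ idx, ‖Xs p‖ ^ 2 ≤ ∑ k ∈ frequencies K, ∑ h ∈ 𝓗,
        ∑ i ∈ I h, ∑ j ∈ I h, F ^ 4 * pairSum α q b k i.1 j.1 i.2 j.2 := by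
      rw [hidx, Finset.sum_product]
      refine Finset.sum_le_sum fun k _ => ?_
      rw [Finset.sum_product]
      refine Finset.sum_le_sum fun h _ => ?_
      refine (sum_norm_sq_sum_le _ (I h) (fun m i => innerTerm α q b lam v k m i)).trans ?_
      refine Finset.sum_le_sum fun i hi => Finset.sum_le_sum fun j hj => ?_
      obtain ⟨hi1, hi2⟩ := Finset.mem_product.1 hi
      obtain ⟨hj1, hj2⟩ := Finset.mem_product.1 hj
      exact norm_sum_innerTerm_le α q b k hLpos (Finset.mem_Ico.1 hi2).1
        (hlam _ (Finset.mem_filter.1 hi1).1) (hlam _ (Finset.mem_filter.1 hj1).1) hv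
    refine h1.trans ?_
    have h2 : ∑ k ∈ frequencies K, ∑ h ∈ 𝓗,
        ∑ i ∈ I h, ∑ j ∈ I h, F ^ 4 * pairSum α q b k i.1 j.1 i.2 j.2
        = F ^ 4 * ∑ k ∈ frequencies K, ∑ h ∈ 𝓗, ∑ d₁ ∈ 𝒟.filter (fun d => f d = h),
          ∑ d₂ ∈ 𝒟.filter (fun d => f d = h), ∑ l₁ ∈ Finset.Ico L (L + L),
            ∑ l₂ ∈ Finset.Ico L (L + L), pairSum α q b k d₁ d₂ l₁ l₂ := by
      simp only [Finset.mul_sum, hI, Finset.sum_product]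
      refine Finset.sum_congr rfl fun k _ => Finset.sum_congr rfl fun h _ =>
        Finset.sum_congr rfl fun d₁ _ => ?_
      rw [Finset.sum_comm]
    rw [h2]
    gcongr
    have h3 : ∑ k ∈ frequencies K, ∑ h ∈ 𝓗, ∑ d₁ ∈ 𝒟.filter (fun d => f d = h),
          ∑ d₂ ∈ 𝒟.filter (fun d => f d = h), ∑ l₁ ∈ Finset.Ico L (L + L),
            ∑ l₂ ∈ Finset.Ico L (L + L), pairSum α q b k d₁ d₂ l₁ l₂
        ≤ (∑ k ∈ frequencies K, ∑ h ∈ 𝓗, ∑ d₁ ∈ 𝒟.filter (fun d => f d = h),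
          ∑ d₂ ∈ 𝒟.filter (fun d => f d = h), ∑ l₁ ∈ Finset.Ico L (L + L),
            ((pairRange q b d₁ d₂ l₁ l₁).card : ℝ)) + Off := by
      rw [hOff, ← sum_offDiagonal_eq K H L 𝒟 f (fun d hd => (h𝒟 d hd).2.2.2)
        (fun k d₁ d₂ l₁ l₂ => pairSum α q b k d₁ d₂ l₁ l₂)]
      rw [← Finset.sum_add_distrib]
      refine Finset.sum_le_sum fun k _ => ?_
      rw [← Finset.sum_add_distrib]
      refine Finset.sum_le_sum fun h _ => ?_
      rw [← Finset.sum_add_distrib]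
      refine Finset.sum_le_sum fun d₁ hd₁ => ?_
      rw [← Finset.sum_add_distrib]
      refine Finset.sum_le_sum fun d₂ hd₂ => ?_
      rw [← Finset.sum_add_distrib]
      refine Finset.sum_le_sum fun l₁ hl₁ => ?_
      have hd₁ := Finset.mem_filter.1 hd₁
      have hd₂ := Finset.mem_filter.1 hd₂
      have e1 := h𝒟 d₁ hd₁.1
      have e2 := h𝒟 d₂ hd₂.1
      rw [hd₁.2] at e1
      rw [hd₂.2] at e2
      refine (Finset.sum_le_sum fun l₂ _ =>
        pairSum_le α q k l₁ l₂ e1.2.1 e1.2.2.1 e2.2.2.1).trans ?_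
      rw [Finset.sum_add_distrib, Finset.sum_ite_eq, if_pos hl₁]
    refine h3.trans ?_
    gcongr
    have h4 : ∀ k ∈ frequencies K, ∑ h ∈ 𝓗, ∑ d₁ ∈ 𝒟.filter (fun d => f d = h),
          ∑ d₂ ∈ 𝒟.filter (fun d => f d = h), ∑ l₁ ∈ Finset.Ico L (L + L),
            ((pairRange q b d₁ d₂ l₁ l₁).card : ℝ) ≤ 2 * F ^ 3 * q := by
      intro k _
      -- The `H` values of `h` are paid for by the factor `1 / H`, so the whole diagonal stays of
      -- order `K q` up to powers of `F`.
      have h5 : ∀ h ∈ 𝓗, ∑ d₁ ∈ 𝒟.filter (fun d => f d = h),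
          ∑ d₂ ∈ 𝒟.filter (fun d => f d = h), ∑ l₁ ∈ Finset.Ico L (L + L),
            ((pairRange q b d₁ d₂ l₁ l₁).card : ℝ) ≤ F ^ 3 * (2 * q / H) := by
        intro h hh
        have hh := Finset.mem_Ico.1 hh
        by_cases hhq : h ≤ q
        · refine (sum_diagonal_le hs hb (by omega : 0 < h) hhq hLpos _ ?_).trans ?_
          · intro d hd
            have hd := Finset.mem_filter.1 hd
            have := h𝒟 d hd.1
            exact ⟨this.1, hd.2 ▸ this.2.2.1⟩
          · gcongr
            exact_mod_cast hh.1
        · exfalso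
          have h6 : (2 * H : ℝ) ≤ q := by
            have h7 : (2 : ℝ) ≤ t ^ 80 := by
              calc (2 : ℝ) ≤ F := by linarith [hs.le_F]
                _ = F ^ 1 := (pow_one _).symm
                _ ≤ t := hs.F_pow_le_t (by norm_num)
                _ ≤ t ^ 80 := le_self_pow₀ hs.one_le_t (by norm_num)
            have hL1 : (1 : ℝ) ≤ L := by exact_mod_cast hLpos
            calc (2 * H : ℝ) = (1 * H * 1) * 2 := by ring
              _ ≤ (L * H * X) * t ^ 80 := by gcongr
              _ ≤ q := h80
          have h8 : 2 * H ≤ q := by exact_mod_cast h6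
          omega
      refine (Finset.sum_le_sum h5).trans (le_of_eq ?_)
      rw [h𝓗, Finset.sum_const, Nat.card_Ico, Nat.add_sub_cancel, nsmul_eq_mul]
      field_simp
    refine (Finset.sum_le_sum h4).trans ?_
    rw [Finset.sum_const, nsmul_eq_mul]
    calc ((frequencies K).card : ℝ) * (2 * F ^ 3 * q) ≤ (2 * K) * (2 * F ^ 3 * q) := by
          gcongr; exact card_frequencies_le hK0
      _ = _ := by ring
  have hF37 : F ^ 3 ≤ F ^ 7 := pow_le_pow_right₀ hF (by norm_num)
  -- The diagonal gains `t ^ 5` from `H t ^ 5 ≤ L`, the off-diagonal part from the averaged Weyl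
  -- bound.
  have e1 : H * (4 * F ^ 3 * (K * q) + Off) * t ^ 5 ≤ 36 * F ^ 7 * (K * q) * L := by
    calc H * (4 * F ^ 3 * (K * q) + Off) * t ^ 5
        = 4 * F ^ 3 * (K * q) * (H * t ^ 5) + Off * t ^ 5 * H := by ring
      _ ≤ 4 * F ^ 7 * (K * q) * L + 32 * F ^ 7 * (K * L * q) := by gcongr
      _ = _ := by ring
  calc _ ≤ (2 * K * H * (q / L)) * (F ^ 4 * (F ^ 4 * (4 * F ^ 3 * (K * q) + Off))) * t ^ 5 := by
        gcongr
        exact hsq.trans (by gcongr)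
    _ = 2 * K * (q / L) * F ^ 8 * (H * (4 * F ^ 3 * (K * q) + Off) * t ^ 5) := by ring
    _ ≤ 2 * K * (q / L) * F ^ 8 * (36 * F ^ 7 * (K * q) * L) := by gcongr
    _ = _ := by field_simp; ring

/-- Taking the root turns `t ^ 5` into `√t ^ 5`, which is the final saving `q ^ (ρ / 32)`. -/
lemma norm_bilinearSum_le_of_sq_le {T t F Y : ℝ} (hT : 0 ≤ T) (ht : 0 ≤ t) (hF : 1 ≤ F)
    (hY : 0 ≤ Y) (h : T ^ 2 * t ^ 5 ≤ 72 * F ^ 15 * Y ^ 2) :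
    T * √t ^ 5 ≤ 9 * F ^ 8 * Y := by
  refine (pow_le_pow_iff_left₀ (by positivity) (by positivity) (two_ne_zero)).1 ?_
  calc (T * √t ^ 5) ^ 2 = T ^ 2 * (√t ^ 2) ^ 5 := by ring
    _ = T ^ 2 * t ^ 5 := by rw [Real.sq_sqrt ht]
    _ ≤ 72 * F ^ 15 * Y ^ 2 := h
    _ ≤ 81 * F ^ 16 * Y ^ 2 := by
        gcongr
        · norm_num
        · norm_num
    _ = _ := by ring

/-- The bilinear sum for one dyadic range of `l`, using the well-separability of the moduli. -/
lemma bilinearSum_Ico_le (α β : ℝ) {q : ℕ} {t F : ℝ} (hs : Setting α q t F) {K : ℝ} (hK : 1 ≤ K)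
    (hKq : K ≤ q) {b : ℤ} (hb : 2 * b.natAbs < q) {D : ℝ} (hD : 1 ≤ D) (hDq : D ^ 2 * t ^ 160 ≤ q)
    (𝒟 : Finset ℕ) (h𝒟 : ∀ d ∈ 𝒟, 1 ≤ d ∧ IsCoprime b (d : ℤ) ∧ WellSeparable D d)
    {L : ℕ} (hL : t ^ 20 ≤ L) (hLq : (L : ℝ) ^ 2 ≤ q)
    {lam : ℕ → ℂ} {c : ℤ → ℂ} {u v : ℕ → ℂ} (hlam : ∀ d ∈ 𝒟, ‖lam d‖ ≤ F)
    (hc : ∀ k ∈ frequencies K, ‖c k‖ ≤ F) (hu : ∀ m, ‖u m‖ ≤ F) (hv : ∀ l, ‖v l‖ ≤ F) :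
    ‖bilinearSum α β q b K 𝒟 lam c u v (Finset.Ico L (L + L))‖ * √t ^ 5
      ≤ 9 * F ^ 9 * (K * q) := by
  have hq := hs.q_posR
  have hq1 := hs.one_le_q
  have hF := hs.one_le_F
  have htp := hs.t_pos
  have ht := hs.one_le_t
  have hL0 : (0 : ℝ) < L := lt_of_lt_of_le (by positivity) hL
  -- The separation point is `Hr = min (D, L / t ^ 20)`: as large as the diagonal permits, so that
  -- the cofactor, which is squared, is as small as possible.
  obtain ⟨Hr, Sr, hH1, hS1, hHS, hHL, h80, hcase, hHq⟩ : ∃ Hr Sr : ℝ, 1 ≤ Hr ∧ 1 ≤ Sr ∧ Hr * Sr = D ∧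
      Hr * t ^ 20 ≤ L ∧ (L * Hr * Sr ^ 2) * t ^ 80 ≤ q ∧
      ((L * Hr * Sr ^ 2) * t ^ 140 ≤ q ∨ Sr ^ 2 ≤ t ^ 24) ∧ Hr ≤ q := by
    have hDle : D ≤ q := by
      calc D ≤ D ^ 2 := le_self_pow₀ hD (by norm_num)
        _ ≤ D ^ 2 * t ^ 160 := le_mul_of_one_le_right (by positivity) (one_le_pow₀ ht)
        _ ≤ q := hDq
    -- If `D` itself is short enough, `Sr = 1` and the size condition follows from `L² ≤ q` and `D²
    -- t ^ 160 ≤ q`. Otherwise `L * Hr * Sr ^ 2 = D² t ^ 20`, and the level leaves exactly the `t ^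
    -- 140` required.
    by_cases h : D * t ^ 20 ≤ L
    · refine ⟨D, 1, hD, le_rfl, mul_one _, h, ?_, Or.inr ?_, hDle⟩
      · refine (pow_le_pow_iff_left₀ (by positivity) (by positivity) (two_ne_zero)).1 ?_
        calc (L * D * 1 ^ 2 * t ^ 80) ^ 2 = (L : ℝ) ^ 2 * (D ^ 2 * t ^ 160) := by ring
          _ ≤ (q : ℝ) * q := by gcongr
          _ = _ := by ring
      · rw [one_pow]; exact one_le_pow₀ ht
    · push Not at h
      have ht20 : 0 < t ^ 20 := by positivity
      have e : L * (L / t ^ 20) * (D / (L / t ^ 20)) ^ 2 = D ^ 2 * t ^ 20 := by field_simp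
      refine ⟨L / t ^ 20, D / (L / t ^ 20), ?_, ?_, ?_, ?_, ?_, Or.inl ?_, ?_⟩
      · rwa [le_div_iff₀ ht20, one_mul]
      · rw [le_div_iff₀ (by positivity), one_mul, div_le_iff₀ ht20]; exact h.le
      · field_simp
      · rw [div_mul_cancel₀ _ ht20.ne']
      · rw [e]
        calc D ^ 2 * t ^ 20 * t ^ 80 = D ^ 2 * t ^ 100 := by ring
          _ ≤ D ^ 2 * t ^ 160 := by gcongr; norm_num
          _ ≤ q := hDq
      · rw [e]
        calc D ^ 2 * t ^ 20 * t ^ 140 = D ^ 2 * t ^ 160 := by ring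
          _ ≤ (q : ℝ) := hDq
      · rw [div_le_iff₀ ht20]
        refine h.le.trans ?_
        gcongr
  have hsep : ∀ d ∈ 𝒟, ∃ h : ℕ, 0 < h ∧ (h : ℝ) ≤ Hr ∧ h ∣ d ∧ ((d / h : ℕ) : ℝ) ≤ Sr := by
    intro d hd
    obtain ⟨h, s, h0, -, hh, hs', rfl⟩ := (h𝒟 d hd).2.2 Hr Sr hH1 hS1 hHS
    refine ⟨h, h0, hh, dvd_mul_right _ _, ?_⟩
    rwa [Nat.mul_div_cancel_left _ h0]
  -- One factorisation is fixed for each modulus, so each `d` belongs to a single `h`; this `h` is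
  -- then localised dyadically.
  choose! f hf0 hfH hfd hfS using hsep
  have hHfl : 1 ≤ ⌊Hr⌋₊ := (Nat.one_le_floor_iff Hr).2 hH1
  have hsplit : bilinearSum α β q b K 𝒟 lam c u v (Finset.Ico L (L + L))
      = ∑ j ∈ Finset.range (Nat.log 2 ⌊Hr⌋₊ + 1), bilinearSum α β q b K
        (𝒟.filter fun d => Nat.log 2 (f d) = j) lam c u v (Finset.Ico L (L + L)) := by
    unfold bilinearSum
    rw [Finset.sum_fiberwise_of_maps_to]
    intro d hd
    rw [Finset.mem_range, Nat.lt_succ_iff]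
    exact Nat.log_mono_right (Nat.le_floor (hfH d hd))
  have hblock : ∀ j ∈ Finset.range (Nat.log 2 ⌊Hr⌋₊ + 1), ‖bilinearSum α β q b K
        (𝒟.filter fun d => Nat.log 2 (f d) = j) lam c u v (Finset.Ico L (L + L))‖ * √t ^ 5
        ≤ 9 * F ^ 8 * (K * q) := by
    intro j hj
    have hj := Finset.mem_range_succ_iff.1 hj
    have hjH : ((2 ^ j : ℕ) : ℝ) ≤ Hr := by
      have h1 : 2 ^ j ≤ ⌊Hr⌋₊ :=
        (Nat.pow_le_pow_right (by norm_num) hj).trans (Nat.pow_log_le_self 2 (by omega))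
      exact (Nat.le_floor_iff (by linarith)).1 h1
    have hXle : ((⌊Sr ^ 2⌋₊ : ℕ) : ℝ) ≤ Sr ^ 2 := Nat.floor_le (by positivity)
    refine norm_bilinearSum_le_of_sq_le (norm_nonneg _) htp.le hF (by positivity) ?_
    refine bilinearSum_block_le α β hs hK hKq hb (H := 2 ^ j) (X := ⌊Sr ^ 2⌋₊) (by positivity) ?_ ?_
      _ f ?_ ?_ ?_ ?_ ?_ hc hu hv
    · calc ((2 ^ j : ℕ) : ℝ) * t ^ 5 ≤ Hr * t ^ 20 := by gcongr; norm_num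
        _ ≤ (L : ℝ) := hHL
    · exact (Nat.one_le_floor_iff _).2 (one_le_pow₀ hS1)
    · intro d hd
      obtain ⟨hd, hdj⟩ := Finset.mem_filter.1 hd
      refine ⟨(h𝒟 d hd).1, (h𝒟 d hd).2.1, hfd d hd, ?_⟩
      have h0 := hf0 d hd
      rw [Finset.mem_Ico, ← hdj]
      refine ⟨Nat.pow_log_le_self 2 h0.ne', ?_⟩
      have := Nat.lt_pow_succ_log_self (b := 2) (by norm_num) (f d)
      rw [pow_succ] at this
      omega
    · intro d hd d' hd'
      have hd := (Finset.mem_filter.1 hd).1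
      have hd' := (Finset.mem_filter.1 hd').1
      refine Nat.le_floor ?_
      rw [Nat.cast_mul, pow_two]
      exact mul_le_mul (hfS d hd) (hfS d' hd') (by positivity) (by positivity)
    · refine le_trans ?_ h80
      gcongr
    · rcases hcase with h | h
      · left
        refine le_trans ?_ h
        gcongr
      · right
        exact hXle.trans h
    · intro d hd
      exact hlam d (Finset.mem_filter.1 hd).1
  rw [hsplit]
  calc _ ≤ (∑ j ∈ Finset.range (Nat.log 2 ⌊Hr⌋₊ + 1), ‖bilinearSum α β q b K
        (𝒟.filter fun d => Nat.log 2 (f d) = j) lam c u v (Finset.Ico L (L + L))‖) * √t ^ 5 := by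
        gcongr; exact norm_sum_le _ _
    _ ≤ ∑ j ∈ Finset.range (Nat.log 2 ⌊Hr⌋₊ + 1), 9 * F ^ 8 * (K * q) := by
        rw [Finset.sum_mul]; exact Finset.sum_le_sum hblock
    _ = ((Nat.log 2 ⌊Hr⌋₊ + 1 : ℕ) : ℝ) * (9 * F ^ 8 * (K * q)) := by
        rw [Finset.sum_const, Finset.card_range, nsmul_eq_mul]
    _ ≤ F * (9 * F ^ 8 * (K * q)) := by
        gcongr
        refine hs.log_two_le hHfl ?_
        calc ((⌊Hr⌋₊ : ℕ) : ℝ) ≤ Hr := Nat.floor_le (by linarith)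
          _ ≤ q := hHq
          _ ≤ (q : ℝ) ^ 10 := le_self_pow₀ hq1 (by norm_num)
    _ = _ := by ring

/-- The bilinear sum over all `l` with `2 t ^ 20 ≤ l ≤ √q`. -/
lemma bilinearSum_le (α β : ℝ) {q : ℕ} {t F : ℝ} (hs : Setting α q t F) {K : ℝ} (hK : 1 ≤ K)
    (hKq : K ≤ q) {b : ℤ} (hb : 2 * b.natAbs < q) {D : ℝ} (hD : 1 ≤ D) (hDq : D ^ 2 * t ^ 160 ≤ q)
    (𝒟 : Finset ℕ) (h𝒟 : ∀ d ∈ 𝒟, 1 ≤ d ∧ IsCoprime b (d : ℤ) ∧ WellSeparable D d)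
    (R : Finset ℕ) (hR : ∀ l ∈ R, 2 * t ^ 20 ≤ l ∧ (l : ℝ) ^ 2 ≤ q)
    {lam : ℕ → ℂ} {c : ℤ → ℂ} {u v : ℕ → ℂ} (hlam : ∀ d ∈ 𝒟, ‖lam d‖ ≤ F)
    (hc : ∀ k ∈ frequencies K, ‖c k‖ ≤ F) (hu : ∀ m, ‖u m‖ ≤ F) (hv : ∀ l, ‖v l‖ ≤ F) :
    ‖bilinearSum α β q b K 𝒟 lam c u v R‖ * √t ^ 5 ≤ 9 * F ^ 10 * (K * q) := by
  have hq := hs.q_posR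
  have hq1 := hs.one_le_q
  have hF := hs.one_le_F
  have htp := hs.t_pos
  have ht := hs.one_le_t
  have hRq : ∀ l ∈ R, 1 ≤ l ∧ l ≤ q := by
    intro l hl
    obtain ⟨h1, h2⟩ := hR l hl
    have h3 : (1 : ℝ) ≤ l := by linarith [one_le_pow₀ ht (n := 20)]
    refine ⟨by exact_mod_cast h3, ?_⟩
    have h4 : (l : ℝ) ≤ q := (le_self_pow₀ h3 (by norm_num)).trans h2
    exact_mod_cast h4
  -- Extending the weight by zero outside `R` allows full dyadic intervals in place of `R`.
  set v' : ℕ → ℂ := fun l => if l ∈ R then v l else 0 with hv'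
  have hv'F : ∀ l, ‖v' l‖ ≤ F := by
    intro l
    simp only [hv']
    split_ifs
    · exact hv l
    · rw [norm_zero]; linarith
  have hsplit : bilinearSum α β q b K 𝒟 lam c u v R
      = ∑ i ∈ Finset.range (Nat.log 2 q + 1), bilinearSum α β q b K
        𝒟 lam c u v' (Finset.Ico (2 ^ i) (2 ^ i + 2 ^ i)) := by
    unfold bilinearSum
    rw [Finset.sum_comm (s := Finset.range _)]
    refine Finset.sum_congr rfl fun d _ => ?_
    rw [Finset.sum_comm (s := Finset.range _)]
    refine Finset.sum_congr rfl fun k _ => ?_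
    rw [Finset.sum_comm (s := Finset.range _)]
    refine Finset.sum_congr rfl fun m _ => ?_
    have hmap : ∀ l ∈ R, Nat.log 2 l ∈ Finset.range (Nat.log 2 q + 1) := fun l hl =>
      Finset.mem_range_succ_iff.2 (Nat.log_mono_right (hRq l hl).2)
    rw [← Finset.sum_fiberwise_of_maps_to hmap]
    refine Finset.sum_congr rfl fun i _ => ?_
    refine Finset.sum_subset_zero_on_sdiff ?_ ?_ ?_
    · intro l hl
      obtain ⟨hl, hli⟩ := Finset.mem_filter.1 hl
      rw [Finset.mem_Ico, ← hli]
      refine ⟨Nat.pow_log_le_self 2 (by have := (hRq l hl).1; omega), ?_⟩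
      have := Nat.lt_pow_succ_log_self (b := 2) (by norm_num) l
      rw [pow_succ] at this
      omega
    · intro l hl
      rw [Finset.mem_sdiff, Finset.mem_Ico, Finset.mem_filter] at hl
      have : l ∉ R := by
        intro hlR
        refine hl.2 ⟨hlR, ?_⟩
        rw [Nat.log_eq_iff (Or.inr ⟨by norm_num, by have := (hRq l hlR).1; omega⟩), pow_succ]
        omega
      simp [hv', this]
    · intro l hl
      simp [hv', (Finset.mem_filter.1 hl).1]
  have hblock : ∀ i ∈ Finset.range (Nat.log 2 q + 1), ‖bilinearSum α β q b K
        𝒟 lam c u v' (Finset.Ico (2 ^ i) (2 ^ i + 2 ^ i))‖ * √t ^ 5 ≤ 9 * F ^ 9 * (K * q) := by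
    intro i _
    by_cases hne : ∃ l ∈ R, l ∈ Finset.Ico (2 ^ i) (2 ^ i + 2 ^ i)
    · obtain ⟨l, hlR, hl⟩ := hne
      obtain ⟨hl1, hl2⟩ := Finset.mem_Ico.1 hl
      obtain ⟨h1, h2⟩ := hR l hlR
      have h3 : ((2 ^ i : ℕ) : ℝ) ≤ l := by exact_mod_cast hl1
      have h4 : (l : ℝ) ≤ 2 * ((2 ^ i : ℕ) : ℝ) := by
        have : l ≤ 2 * 2 ^ i := by omega
        exact_mod_cast this
      refine bilinearSum_Ico_le α β hs hK hKq hb hD hDq 𝒟 h𝒟 (by linarith) ?_ hlam hc hu hv'F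
      refine le_trans ?_ h2
      gcongr
    · have : bilinearSum α β q b K 𝒟 lam c u v' (Finset.Ico (2 ^ i) (2 ^ i + 2 ^ i)) = 0 := by
        unfold bilinearSum
        refine Finset.sum_eq_zero fun d _ => Finset.sum_eq_zero fun k _ =>
          Finset.sum_eq_zero fun m _ => Finset.sum_eq_zero fun l hl => ?_
        have : l ∉ R := fun h => hne ⟨l, h, hl⟩
        simp [hv', this]
      rw [this, norm_zero, zero_mul]
      positivity
  rw [hsplit]
  calc _ ≤ (∑ i ∈ Finset.range (Nat.log 2 q + 1), ‖bilinearSum α β q b K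
        𝒟 lam c u v' (Finset.Ico (2 ^ i) (2 ^ i + 2 ^ i))‖) * √t ^ 5 := by
        gcongr; exact norm_sum_le _ _
    _ ≤ ∑ i ∈ Finset.range (Nat.log 2 q + 1), 9 * F ^ 9 * (K * q) := by
        rw [Finset.sum_mul]; exact Finset.sum_le_sum hblock
    _ = ((Nat.log 2 q + 1 : ℕ) : ℝ) * (9 * F ^ 9 * (K * q)) := by
        rw [Finset.sum_const, Finset.card_range, nsmul_eq_mul]
    _ ≤ F * (9 * F ^ 9 * (K * q)) := by
        gcongr
        exact hs.log_two_le hs.q_pos (le_self_pow₀ hq1 (by norm_num))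
    _ = _ := by ring

/-! ### Convolutions inside the sum. -/

/-- The sum `W(q)` with `Λ` replaced by an arbitrary `g`, and the moduli restricted to `𝒟`. -/
def twistedSum (α β : ℝ) (q : ℕ) (b : ℤ) (K : ℝ) (𝒟 : Finset ℕ) (lam : ℕ → ℂ) (c : ℤ → ℂ)
    (g : ℕ → ℂ) : ℂ :=
  ∑ d ∈ 𝒟, lam d * ∑ k ∈ frequencies K, c k *
    ∑ n ∈ progression q b d, e ((α * (n : ℝ) ^ 2 + β) * k) * g n

lemma mem_progression {q : ℕ} {b : ℤ} {d n : ℕ} :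
    n ∈ progression q b d ↔ q ≤ 2 * n ∧ n < q ∧ (n : ℤ) ≡ b [ZMOD d] := by
  rw [progression, Finset.mem_filter, Finset.mem_range, Nat.ceil_natCast]
  have : ((q : ℝ) / 2 ≤ n) ↔ q ≤ 2 * n := by
    rw [div_le_iff₀ (by norm_num)]
    constructor
    · intro h
      have : (q : ℝ) ≤ (2 * n : ℕ) := by push_cast; linarith
      exact_mod_cast this
    · intro h
      have : (q : ℝ) ≤ (2 * n : ℕ) := by exact_mod_cast h
      push_cast at this; linarith
  rw [this]
  tauto

lemma sum_progression_divisorsAntidiagonal (q : ℕ) (b : ℤ) (d : ℕ) (G : ℕ → ℕ → ℂ) :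
    ∑ n ∈ progression q b d, ∑ p ∈ n.divisorsAntidiagonal, G p.1 p.2
      = ∑ m ∈ Finset.Icc 1 q, ∑ l ∈ Finset.Icc 1 q, if Cond q b d m l then G m l else 0 := by
  rw [Finset.sum_sigma', ← Finset.sum_product', ← Finset.sum_filter]
  refine Finset.sum_bij' (fun x _ => x.2) (fun p _ => ⟨p.1 * p.2, p⟩) ?_ ?_ ?_ ?_ ?_
  · rintro ⟨n, p⟩ hx
    obtain ⟨h1, h2⟩ := Finset.mem_sigma.1 hx
    obtain ⟨h3, h4⟩ := Nat.mem_divisorsAntidiagonal.1 h2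
    obtain ⟨h5, h6, h7⟩ := mem_progression.1 h1
    simp only at h3 h4 h5 h6 h7 ⊢
    have hp1 : 0 < p.1 := Nat.pos_of_ne_zero fun h => h4 (by rw [← h3, h, zero_mul])
    have hp2 : 0 < p.2 := Nat.pos_of_ne_zero fun h => h4 (by rw [← h3, h, mul_zero])
    have e1 : p.1 ≤ n := by rw [← h3]; exact Nat.le_mul_of_pos_right _ hp2
    have e2 : p.2 ≤ n := by rw [← h3]; exact Nat.le_mul_of_pos_left _ hp1
    rw [Finset.mem_filter, Finset.mem_product, Finset.mem_Icc, Finset.mem_Icc]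
    refine ⟨⟨⟨hp1, by omega⟩, ⟨hp2, by omega⟩⟩, ?_⟩
    subst h3
    exact ⟨h5, h6, by exact_mod_cast h7⟩
  · rintro ⟨m, l⟩ hx
    obtain ⟨h1, h2, h3, h4⟩ := Finset.mem_filter.1 hx
    simp only at h2 h3 h4 ⊢
    rw [Finset.mem_sigma, Nat.mem_divisorsAntidiagonal, mem_progression]
    refine ⟨⟨h2, h3, by exact_mod_cast h4⟩, rfl, ?_⟩
    simp only
    omega
  · rintro ⟨n, p⟩ hx
    obtain ⟨h1, h2⟩ := Finset.mem_sigma.1 hx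
    obtain ⟨h3, h4⟩ := Nat.mem_divisorsAntidiagonal.1 h2
    simp only at h3
    subst h3
    rfl
  · intro p _
    rfl
  · intro p _
    rfl

lemma twistedSum_divisorsAntidiagonal (α β : ℝ) (q : ℕ) (b : ℤ) (K : ℝ)
    (𝒟 : Finset ℕ) (lam : ℕ → ℂ) (c : ℤ → ℂ) (a : ℕ → ℕ → ℂ) :
    twistedSum α β q b K 𝒟 lam c (fun n => ∑ p ∈ n.divisorsAntidiagonal, a p.1 p.2)
      = ∑ d ∈ 𝒟, ∑ k ∈ frequencies K, ∑ m ∈ Finset.Icc 1 q, ∑ l ∈ Finset.Icc 1 q,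
        if Cond q b d m l then
          lam d * c k * a m l * e ((α * ((m * l : ℕ) : ℝ) ^ 2 + β) * k) else 0 := by
  unfold twistedSum
  refine Finset.sum_congr rfl fun d _ => ?_
  rw [Finset.mul_sum]
  refine Finset.sum_congr rfl fun k _ => ?_
  rw [← sum_progression_divisorsAntidiagonal q b d
    (fun m l => lam d * c k * a m l * e ((α * ((m * l : ℕ) : ℝ) ^ 2 + β) * k)),
    Finset.mul_sum, Finset.mul_sum]
  refine Finset.sum_congr rfl fun n _ => ?_
  rw [Finset.mul_sum, Finset.mul_sum, Finset.mul_sum]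
  refine Finset.sum_congr rfl fun p hp => ?_
  rw [(Nat.mem_divisorsAntidiagonal.1 hp).1]
  ring

lemma twistedSum_add (α β : ℝ) (q : ℕ) (b : ℤ) (K : ℝ) (𝒟 : Finset ℕ) (lam : ℕ → ℂ) (c : ℤ → ℂ)
    (g₁ g₂ : ℕ → ℂ) : twistedSum α β q b K 𝒟 lam c (fun n => g₁ n + g₂ n)
      = twistedSum α β q b K 𝒟 lam c g₁ + twistedSum α β q b K 𝒟 lam c g₂ := by
  simp only [twistedSum, mul_add, Finset.sum_add_distrib]

lemma twistedSum_congr {α β : ℝ} {q : ℕ} {b : ℤ} {K : ℝ} {𝒟 : Finset ℕ} {lam : ℕ → ℂ} {c : ℤ → ℂ}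
    {g₁ g₂ : ℕ → ℂ} (h : ∀ n, q ≤ 2 * n → n < q → g₁ n = g₂ n) :
    twistedSum α β q b K 𝒟 lam c g₁ = twistedSum α β q b K 𝒟 lam c g₂ := by
  unfold twistedSum
  refine Finset.sum_congr rfl fun d _ => ?_
  congr 1
  refine Finset.sum_congr rfl fun k _ => ?_
  congr 1
  refine Finset.sum_congr rfl fun n hn => ?_
  obtain ⟨h1, h2, -⟩ := mem_progression.1 hn
  rw [h n h1 h2]

/-- Bilinear sums with both variables larger than `2 t ^ 20`. -/
lemma twistedSum_bilinear_le (α β : ℝ) {q : ℕ} {t F : ℝ} (hs : Setting α q t F) {K : ℝ}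
    (hK : 1 ≤ K) (hKq : K ≤ q) {b : ℤ} (hb : 2 * b.natAbs < q) {D : ℝ} (hD : 1 ≤ D)
    (hDq : D ^ 2 * t ^ 160 ≤ q) (𝒟 : Finset ℕ)
    (h𝒟 : ∀ d ∈ 𝒟, 1 ≤ d ∧ IsCoprime b (d : ℤ) ∧ WellSeparable D d)
    {lam : ℕ → ℂ} {c : ℤ → ℂ} {u v : ℕ → ℂ} (hlam : ∀ d ∈ 𝒟, ‖lam d‖ ≤ F)
    (hc : ∀ k ∈ frequencies K, ‖c k‖ ≤ F)
    (hu : ∀ m ≤ q, ‖u m‖ ≤ F) (hv : ∀ l ≤ q, ‖v l‖ ≤ F)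
    (hu0 : ∀ m : ℕ, (m : ℝ) < 2 * t ^ 20 → u m = 0) (hv0 : ∀ l : ℕ, (l : ℝ) < 2 * t ^ 20 → v l = 0) :
    ‖twistedSum α β q b K 𝒟 lam c (fun n => ∑ p ∈ n.divisorsAntidiagonal, u p.1 * v p.2)‖
      * √t ^ 5 ≤ 18 * F ^ 10 * (K * q) := by
  have hF := hs.F_pos
  set R : Finset ℕ := (Finset.Icc 1 q).filter fun l => 2 * t ^ 20 ≤ (l : ℝ) ∧ l * l ≤ q with hRdef
  have hR : ∀ l ∈ R, 2 * t ^ 20 ≤ (l : ℝ) ∧ (l : ℝ) ^ 2 ≤ q := by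
    intro l hl
    obtain ⟨-, h1, h2⟩ := Finset.mem_filter.1 hl
    refine ⟨h1, ?_⟩
    rw [pow_two]
    exact_mod_cast h2
  set u₁ : ℕ → ℂ := fun m => if m ≤ q then u m else 0 with hu₁
  set v₁ : ℕ → ℂ := fun l => if l ≤ q then v l else 0 with hv₁
  set v₂ : ℕ → ℂ := fun l => if l ≤ q ∧ q < l * l then v l else 0 with hv₂
  have hu₁F : ∀ m, ‖u₁ m‖ ≤ F := by
    intro m; simp only [hu₁]; split_ifs with h
    · exact hu m h
    · rw [norm_zero]; exact hF.le
  have hv₁F : ∀ m, ‖v₁ m‖ ≤ F := by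
    intro m; simp only [hv₁]; split_ifs with h
    · exact hv m h
    · rw [norm_zero]; exact hF.le
  have hv₂F : ∀ m, ‖v₂ m‖ ≤ F := by
    intro m; simp only [hv₂]; split_ifs with h
    · exact hv m h.1
    · rw [norm_zero]; exact hF.le
  -- As `m l < q`, at least one variable has square at most `q`. If `l` does, it is the short
  -- variable; otherwise `m` takes its place, and `v₂` records that the long variable has square
  -- above `q`, so that nothing is counted twice.
  have hsplit : twistedSum α β q b K 𝒟 lam c
      (fun n => ∑ p ∈ n.divisorsAntidiagonal, u p.1 * v p.2)
      = bilinearSum α β q b K 𝒟 lam c u₁ v₁ R + bilinearSum α β q b K 𝒟 lam c v₂ u₁ R := by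
    rw [twistedSum_divisorsAntidiagonal α β q b K 𝒟 lam c (fun m l => u m * v l),
      bilinearSum, bilinearSum, ← Finset.sum_add_distrib]
    refine Finset.sum_congr rfl fun d _ => ?_
    rw [← Finset.sum_add_distrib]
    refine Finset.sum_congr rfl fun k _ => ?_
    simp only [hRdef, Finset.sum_filter]
    rw [Finset.sum_comm (f := fun (m l : ℕ) => if 2 * t ^ 20 ≤ (l : ℝ) ∧ l * l ≤ q then
      (if Cond q b d m l then lam d * c k * v₂ m * u₁ l *
        e ((α * ((m * l : ℕ) : ℝ) ^ 2 + β) * k) else 0) else 0), ← Finset.sum_add_distrib]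
    refine Finset.sum_congr rfl fun m hm => ?_
    rw [← Finset.sum_add_distrib]
    refine Finset.sum_congr rfl fun l hl => ?_
    have hm := (Finset.mem_Icc.1 hm).2
    have hl := (Finset.mem_Icc.1 hl).2
    have hsymm : Cond q b d l m ↔ Cond q b d m l := by
      unfold Cond; rw [mul_comm l m, mul_comm (l : ℤ) m]
    by_cases hC : Cond q b d m l
    · rw [if_pos hC, if_pos hC, if_pos (hsymm.2 hC), mul_comm l m]
      simp only [hu₁, hv₁, hv₂, hm, hl, if_true, true_and]
      by_cases hl0 : (l : ℝ) < 2 * t ^ 20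
      · simp [hv0 l hl0]
      · by_cases hm0 : (m : ℝ) < 2 * t ^ 20
        · simp [hu0 m hm0]
        · push Not at hl0 hm0
          simp only [hl0, hm0, true_and]
          by_cases hll : l * l ≤ q
          · rw [if_pos hll, if_neg (by omega : ¬ q < l * l)]
            simp only [mul_zero, zero_mul, ite_self, add_zero]
            ring
          · have hmm : m * m ≤ q := by
              by_contra hcon
              have h1 : m * l < q := hC.2.1
              rcases le_total m l with h | h
              · have := Nat.mul_le_mul_left m h; omega
              · have := Nat.mul_le_mul_right l h; omega
            rw [if_neg hll, if_pos hmm, if_pos (by omega : q < l * l)]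
            ring
    · rw [if_neg hC, if_neg hC, if_neg (fun h => hC (hsymm.1 h))]
      simp
  rw [hsplit]
  calc _ ≤ (‖bilinearSum α β q b K 𝒟 lam c u₁ v₁ R‖ + ‖bilinearSum α β q b K 𝒟 lam c v₂ u₁ R‖)
        * √t ^ 5 := by gcongr; exact norm_add_le _ _
    _ = ‖bilinearSum α β q b K 𝒟 lam c u₁ v₁ R‖ * √t ^ 5
        + ‖bilinearSum α β q b K 𝒟 lam c v₂ u₁ R‖ * √t ^ 5 := by ring
    _ ≤ 9 * F ^ 10 * (K * q) + 9 * F ^ 10 * (K * q) :=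
        add_le_add (bilinearSum_le α β hs hK hKq hb hD hDq 𝒟 h𝒟 R hR hlam hc hu₁F hv₁F)
          (bilinearSum_le α β hs hK hKq hb hD hDq 𝒟 h𝒟 R hR hlam hc hv₂F hu₁F)
    _ = _ := by ring

/-- Sums in which one variable is at most `Z` and the other one has a monotone weight. -/
lemma twistedSum_linear_le (α β : ℝ) {q : ℕ} {t F : ℝ} (hs : Setting α q t F) {K : ℝ}
    (hK : 1 ≤ K) (hKq : K ≤ q) (b : ℤ) {D Z : ℕ} (hDZ : (D * Z : ℝ) * t ^ 80 ≤ q) (𝒟 : Finset ℕ)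
    (h𝒟 : ∀ d ∈ 𝒟, 1 ≤ d ∧ d ≤ D ∧ IsCoprime b (d : ℤ))
    {lam : ℕ → ℂ} {c : ℤ → ℂ} {a : ℕ → ℂ} {δ : ℕ → ℝ} (hlam : ∀ d ∈ 𝒟, ‖lam d‖ ≤ F)
    (hc : ∀ k ∈ frequencies K, ‖c k‖ ≤ F) (ha : ∀ m ≤ Z, ‖a m‖ ≤ F) (ha0 : ∀ m, Z < m → a m = 0)
    (hZq : Z ≤ q) (hδ : ∀ j, 0 ≤ δ j) (hδF : ∑ j ∈ Finset.range q, δ j ≤ F) :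
    ‖twistedSum α β q b K 𝒟 lam c (fun n => ∑ p ∈ n.divisorsAntidiagonal,
      a p.1 * ((∑ j ∈ Finset.range p.2, δ j : ℝ) : ℂ))‖ * t ^ 5 ≤ 4 * F ^ 7 * (K * q) := by
  have hF := hs.F_pos
  have hq := hs.q_posR
  have htp := hs.t_pos
  -- Partial summation: exchanging `l` and `j` replaces the weight by the condition `j < l`, which
  -- keeps an interval an interval, so `sum_typeI_le` applies uniformly in `j`.
  set A : ℕ → ℕ → ℕ → Finset ℕ := fun j d m =>
    (Finset.Icc 1 q).filter fun l => Cond q b d m l ∧ j < l with hA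
  have hj : ∀ j, (∑ d ∈ 𝒟, ∑ k ∈ frequencies K, ∑ m ∈ Finset.Icc 1 Z,
      ‖∑ l ∈ A j d m, e (α * k * (m : ℝ) ^ 2 * (l : ℝ) ^ 2)‖) * t ^ 5 ≤ 4 * F ^ 3 * (K * q) := by
    intro j
    refine sum_typeI_le hs hK hKq b hDZ 𝒟 h𝒟 (A j) ?_ ?_
    · intro d m l hl
      exact (Finset.mem_filter.1 hl).2.1.2
    · intro d m l₁ hl₁ l₂ hl₂ l h1 h2 h3
      obtain ⟨a1, ⟨a2, a3, -⟩, a4⟩ := Finset.mem_filter.1 hl₁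
      obtain ⟨b1, ⟨b2, b3, -⟩, b4⟩ := Finset.mem_filter.1 hl₂
      have a1 := Finset.mem_Icc.1 a1
      have b1 := Finset.mem_Icc.1 b1
      have c1 := Nat.mul_le_mul_left m h1
      have c2 := Nat.mul_le_mul_left m h2
      rw [hA, Finset.mem_filter, Finset.mem_Icc]
      exact ⟨⟨by omega, by omega⟩, ⟨by omega, by omega, h3⟩, by omega⟩
  have hbound : ‖twistedSum α β q b K 𝒟 lam c (fun n => ∑ p ∈ n.divisorsAntidiagonal,
      a p.1 * ((∑ j ∈ Finset.range p.2, δ j : ℝ) : ℂ))‖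
      ≤ ∑ d ∈ 𝒟, ∑ k ∈ frequencies K, ∑ m ∈ Finset.Icc 1 Z, ∑ j ∈ Finset.range q,
        F ^ 3 * (δ j * ‖∑ l ∈ A j d m, e (α * k * (m : ℝ) ^ 2 * (l : ℝ) ^ 2)‖) := by
    rw [twistedSum_divisorsAntidiagonal α β q b K 𝒟 lam c
      (fun m l => a m * ((∑ j ∈ Finset.range l, δ j : ℝ) : ℂ))]
    refine (norm_sum_le _ _).trans (Finset.sum_le_sum fun d hd => ?_)
    refine (norm_sum_le _ _).trans (Finset.sum_le_sum fun k hk => ?_)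
    refine (norm_sum_le _ _).trans ?_
    rw [← Finset.sum_subset_zero_on_sdiff (Finset.Icc_subset_Icc_right hZq) (f := fun m =>
      ‖∑ l ∈ Finset.Icc 1 q, if Cond q b d m l then lam d * c k *
        (a m * ((∑ j ∈ Finset.range l, δ j : ℝ) : ℂ)) * e ((α * ((m * l : ℕ) : ℝ) ^ 2 + β) * k)
        else 0‖) _ (fun _ _ => rfl)]
    swap
    · intro m hm
      rw [Finset.mem_sdiff, Finset.mem_Icc, Finset.mem_Icc] at hm
      simp [ha0 m (by omega)]
    refine Finset.sum_le_sum fun m hm => ?_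
    have hm := (Finset.mem_Icc.1 hm).2
    have heq : ∑ l ∈ Finset.Icc 1 q, (if Cond q b d m l then lam d * c k *
        (a m * ((∑ j ∈ Finset.range l, δ j : ℝ) : ℂ)) * e ((α * ((m * l : ℕ) : ℝ) ^ 2 + β) * k)
        else 0) = ∑ j ∈ Finset.range q, (lam d * c k * a m * e (β * k)) *
          (δ j * ∑ l ∈ A j d m, e (α * k * (m : ℝ) ^ 2 * (l : ℝ) ^ 2)) := by
      have h1 : ∀ l ∈ Finset.Icc 1 q, (if Cond q b d m l then lam d * c k *
          (a m * ((∑ j ∈ Finset.range l, δ j : ℝ) : ℂ)) *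
            e ((α * ((m * l : ℕ) : ℝ) ^ 2 + β) * k) else 0)
          = ∑ j ∈ Finset.range q, if Cond q b d m l ∧ j < l then
            (lam d * c k * a m * e (β * k)) * (δ j * e (α * k * (m : ℝ) ^ 2 * (l : ℝ) ^ 2))
            else 0 := by
        intro l hl
        have hl := (Finset.mem_Icc.1 hl).2
        by_cases hC : Cond q b d m l
        · simp only [hC, if_true, true_and]
          have h2 : Finset.range l = (Finset.range q).filter fun j => j < l := by
            ext j; rw [Finset.mem_filter, Finset.mem_range, Finset.mem_range]; omega
          have h3 : e ((α * ((m * l : ℕ) : ℝ) ^ 2 + β) * k)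
              = e (β * k) * e (α * k * (m : ℝ) ^ 2 * (l : ℝ) ^ 2) := by
            rw [← e_add]; congr 1; push_cast; ring
          rw [← Finset.sum_filter, ← h2, h3]
          push_cast
          rw [Finset.mul_sum, Finset.mul_sum, Finset.sum_mul]
          exact Finset.sum_congr rfl fun j _ => by ring
        · simp [hC]
      rw [Finset.sum_congr rfl h1, Finset.sum_comm]
      refine Finset.sum_congr rfl fun j _ => ?_
      rw [← Finset.sum_filter, Finset.mul_sum, Finset.mul_sum]
    rw [heq]
    refine (norm_sum_le _ _).trans (Finset.sum_le_sum fun j _ => ?_)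
    rw [norm_mul, norm_mul, norm_mul, norm_mul, norm_mul, norm_e, mul_one, Complex.norm_real,
      Real.norm_of_nonneg (hδ j)]
    have : ‖lam d‖ * ‖c k‖ * ‖a m‖ ≤ F * F * F := by
      gcongr
      · exact hlam d hd
      · exact hc k hk
      · exact ha m hm
    calc _ ≤ (F * F * F) * (δ j * ‖∑ l ∈ A j d m, e (α * k * (m : ℝ) ^ 2 * (l : ℝ) ^ 2)‖) := by
          refine mul_le_mul_of_nonneg_right this (mul_nonneg (hδ j) (norm_nonneg _))
      _ = _ := by ring
  calc _ ≤ (∑ d ∈ 𝒟, ∑ k ∈ frequencies K, ∑ m ∈ Finset.Icc 1 Z, ∑ j ∈ Finset.range q,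
        F ^ 3 * (δ j * ‖∑ l ∈ A j d m, e (α * k * (m : ℝ) ^ 2 * (l : ℝ) ^ 2)‖)) * t ^ 5 := by gcongr
    _ = F ^ 3 * ∑ j ∈ Finset.range q, δ j * ((∑ d ∈ 𝒟, ∑ k ∈ frequencies K, ∑ m ∈ Finset.Icc 1 Z,
        ‖∑ l ∈ A j d m, e (α * k * (m : ℝ) ^ 2 * (l : ℝ) ^ 2)‖) * t ^ 5) := by
        simp only [Finset.mul_sum, Finset.sum_mul]
        rw [Finset.sum_comm (s := Finset.range q)]
        refine Finset.sum_congr rfl fun d _ => ?_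
        rw [Finset.sum_comm (s := Finset.range q)]
        refine Finset.sum_congr rfl fun k _ => ?_
        rw [Finset.sum_comm (s := Finset.range q)]
        refine Finset.sum_congr rfl fun m _ => Finset.sum_congr rfl fun j _ => by ring
    _ ≤ F ^ 3 * ∑ j ∈ Finset.range q, δ j * (4 * F ^ 3 * (K * q)) := by
        refine mul_le_mul_of_nonneg_left (Finset.sum_le_sum fun j _ => ?_) (by positivity)
        exact mul_le_mul_of_nonneg_left (hj j) (hδ j)
    _ = F ^ 3 * ((∑ j ∈ Finset.range q, δ j) * (4 * F ^ 3 * (K * q))) := by rw [Finset.sum_mul]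
    _ ≤ F ^ 3 * (F * (4 * F ^ 3 * (K * q))) := by gcongr
    _ = _ := by ring

/-! ### Vaughan's identity and its coefficients. -/

/-- The restriction of an arithmetic function to `n ≤ U`. -/
def low (U : ℕ) (f : ArithmeticFunction ℝ) : ArithmeticFunction ℝ :=
  ⟨fun n => if n ≤ U then f n else 0, by simp⟩

lemma low_apply (U : ℕ) (f : ArithmeticFunction ℝ) (n : ℕ) :
    low U f n = if n ≤ U then f n else 0 := rfl

lemma arith_sub_apply (f g : ArithmeticFunction ℝ) (n : ℕ) : (f - g) n = f n - g n := by
  rw [sub_eq_add_neg, ArithmeticFunction.add_apply, sub_eq_add_neg]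
  rfl

/-- The Möbius function with real values. -/
abbrev realMoebius : ArithmeticFunction ℝ := (ArithmeticFunction.moebius : ArithmeticFunction ℤ)

/-- The zeta function with real values. -/
abbrev realZeta : ArithmeticFunction ℝ := (ArithmeticFunction.zeta : ArithmeticFunction ℕ)

lemma abs_realMoebius_le (n : ℕ) : |realMoebius n| ≤ 1 := by
  rw [ArithmeticFunction.intCoe_apply]
  exact_mod_cast ArithmeticFunction.abs_moebius_le_one

/-- Vaughan's identity. -/
lemma vaughan_identity (U : ℕ) :
    ArithmeticFunction.vonMangoldt = low U ArithmeticFunction.vonMangoldt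
      + low U realMoebius * ArithmeticFunction.log
      - (low U realMoebius * low U ArithmeticFunction.vonMangoldt) * realZeta
      + (realMoebius - low U realMoebius) *
        (realZeta * (ArithmeticFunction.vonMangoldt - low U ArithmeticFunction.vonMangoldt)) := by
  have h1 : realMoebius * realZeta = 1 := ArithmeticFunction.coe_moebius_mul_coe_zeta
  have h2 : ArithmeticFunction.vonMangoldt * realZeta = ArithmeticFunction.log :=
    ArithmeticFunction.vonMangoldt_mul_zeta
  -- In the last term `μ * ζ = 1` recovers the high part of `Λ`, and the truncated `μ` leaves minus
  -- the two middle terms by `Λ * ζ = log`.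
  linear_combination (ArithmeticFunction.vonMangoldt - low U ArithmeticFunction.vonMangoldt) * (-h1)
    + low U realMoebius * h2

lemma sum_divisorsAntidiagonal_vonMangoldt (n : ℕ) :
    ∑ p ∈ n.divisorsAntidiagonal, ArithmeticFunction.vonMangoldt p.2 = Real.log n := by
  rw [Nat.sum_divisorsAntidiagonal' (f := fun _ j => ArithmeticFunction.vonMangoldt j)]
  exact ArithmeticFunction.vonMangoldt_sum

/-- The truncations only discard terms of `∑ Λ = log n`, and `|μ| ≤ 1`. -/
lemma abs_low_moebius_mul_le (U n : ℕ) :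
    |(low U realMoebius * low U ArithmeticFunction.vonMangoldt) n| ≤ Real.log n := by
  rw [ArithmeticFunction.mul_apply, ← sum_divisorsAntidiagonal_vonMangoldt]
  refine (Finset.abs_sum_le_sum_abs _ _).trans (Finset.sum_le_sum fun p _ => ?_)
  rw [abs_mul, low_apply, low_apply]
  have h0 := ArithmeticFunction.vonMangoldt_nonneg (n := p.2)
  have h1 := abs_realMoebius_le p.1
  split_ifs
  · rw [abs_of_nonneg h0]; exact mul_le_of_le_one_left h0 h1
  · simp [h0]
  · simp [h0]
  · simp [h0]

lemma low_moebius_mul_eq_zero {U n : ℕ} (h : U * U < n) :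
    (low U realMoebius * low U ArithmeticFunction.vonMangoldt) n = 0 := by
  rw [ArithmeticFunction.mul_apply]
  refine Finset.sum_eq_zero fun p hp => ?_
  rw [low_apply, low_apply]
  by_cases h1 : p.1 ≤ U
  · by_cases h2 : p.2 ≤ U
    · have := Nat.mul_le_mul h1 h2
      rw [(Nat.mem_divisorsAntidiagonal.1 hp).1] at this
      omega
    · simp [h2]
  · simp [h1]

lemma high_vonMangoldt_bounds (U n : ℕ) :
    0 ≤ (ArithmeticFunction.vonMangoldt - low U ArithmeticFunction.vonMangoldt) n ∧
      (ArithmeticFunction.vonMangoldt - low U ArithmeticFunction.vonMangoldt) n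
        ≤ ArithmeticFunction.vonMangoldt n := by
  have h0 := ArithmeticFunction.vonMangoldt_nonneg (n := n)
  rw [arith_sub_apply, low_apply]
  split_ifs <;> simp [h0]

lemma abs_zeta_mul_high_le (U n : ℕ) :
    |(realZeta * (ArithmeticFunction.vonMangoldt - low U ArithmeticFunction.vonMangoldt)) n|
      ≤ Real.log n := by
  rw [ArithmeticFunction.mul_apply, ← sum_divisorsAntidiagonal_vonMangoldt]
  refine (Finset.abs_sum_le_sum_abs _ _).trans (Finset.sum_le_sum fun p hp => ?_)
  obtain ⟨h1, h2⟩ := high_vonMangoldt_bounds U p.2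
  have h3 : p.1 ≠ 0 := by
    intro h
    have := Nat.mem_divisorsAntidiagonal.1 hp
    rw [h, zero_mul] at this
    exact this.2 this.1.symm
  rw [ArithmeticFunction.natCoe_apply, ArithmeticFunction.zeta_apply_ne h3, Nat.cast_one, one_mul,
    abs_of_nonneg h1]
  exact h2

lemma zeta_mul_high_eq_zero {U n : ℕ} (h : n ≤ U) :
    (realZeta * (ArithmeticFunction.vonMangoldt - low U ArithmeticFunction.vonMangoldt)) n = 0 := by
  rw [ArithmeticFunction.mul_apply]
  refine Finset.sum_eq_zero fun p hp => ?_
  have h1 : p.2 ≤ n := Nat.divisor_le (Nat.snd_mem_divisors_of_mem_antidiagonal hp)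
  rw [arith_sub_apply, low_apply, if_pos (h1.trans h), sub_self, mul_zero]

/-- Beyond `U` the truncated `Λ` vanishes. Both linear terms are given the shape of
`twistedSum_linear_le`: the weight `log` telescopes, its first increment being 0 because `Real.log 0
= 0`, and the weight 1 is a unit mass at `j = 0`. -/
lemma vonMangoldt_eq_of_lt {U n : ℕ} (h : U < n) :
    ArithmeticFunction.vonMangoldt n =
      ∑ p ∈ n.divisorsAntidiagonal, low U realMoebius p.1 *
        ∑ j ∈ Finset.range p.2, (Real.log ((j + 1 : ℕ) : ℝ) - Real.log (j : ℝ))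
      + ∑ p ∈ n.divisorsAntidiagonal,
        -(low U realMoebius * low U ArithmeticFunction.vonMangoldt) p.1 *
          ∑ j ∈ Finset.range p.2, (if j = 0 then (1 : ℝ) else 0)
      + ∑ p ∈ n.divisorsAntidiagonal, (realMoebius - low U realMoebius) p.1 *
        (realZeta * (ArithmeticFunction.vonMangoldt - low U ArithmeticFunction.vonMangoldt)) p.2 := by
  conv_lhs => rw [vaughan_identity U]
  have h0 : low U ArithmeticFunction.vonMangoldt n = 0 := by
    rw [low_apply, if_neg (by omega)]
  rw [ArithmeticFunction.add_apply, arith_sub_apply, ArithmeticFunction.add_apply, h0,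
    zero_add, ArithmeticFunction.mul_apply (f := low U realMoebius),
    ArithmeticFunction.mul_apply (f := low U realMoebius * _),
    ArithmeticFunction.mul_apply (f := realMoebius - _), sub_eq_add_neg, ← Finset.sum_neg_distrib]
  congr 2
  · refine Finset.sum_congr rfl fun p _ => ?_
    rw [Finset.sum_range_sub (fun j : ℕ => Real.log (j : ℝ))]
    simp [ArithmeticFunction.log_apply]
  · refine Finset.sum_congr rfl fun p hp => ?_
    have h3 : p.2 ≠ 0 := by
      intro h
      have := Nat.mem_divisorsAntidiagonal.1 hp
      rw [h, mul_zero] at this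
      exact this.2 this.1.symm
    rw [ArithmeticFunction.natCoe_apply, ArithmeticFunction.zeta_apply_ne h3, Finset.sum_ite_eq',
      if_pos (Finset.mem_range.2 (Nat.pos_of_ne_zero h3))]
    push_cast
    ring

/-! ### Assembly for moduli coprime and not coprime to `b`. -/

/-- The contribution of the moduli coprime to `b`. -/
lemma twistedSum_coprime_le (α β : ℝ) {q : ℕ} {t F : ℝ} (hs : Setting α q t F) {K : ℝ}
    (hK : 1 ≤ K) (hKq : K ≤ q) {b : ℤ} (hb : 2 * b.natAbs < q) {D : ℝ} (hD : 1 ≤ D)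
    (hDq : D ^ 2 * t ^ 160 ≤ q) (𝒟 : Finset ℕ)
    (h𝒟 : ∀ d ∈ 𝒟, 1 ≤ d ∧ (d : ℝ) ≤ D ∧ IsCoprime b (d : ℤ) ∧ WellSeparable D d)
    {lam : ℕ → ℂ} {c : ℤ → ℂ} (hlam : ∀ d ∈ 𝒟, ‖lam d‖ ≤ F)
    (hc : ∀ k ∈ frequencies K, ‖c k‖ ≤ F) :
    ‖twistedSum α β q b K 𝒟 lam c (fun n => ((ArithmeticFunction.vonMangoldt n : ℝ) : ℂ))‖ * √t ^ 5
      ≤ 26 * F ^ 10 * (K * q) := by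
  have hF := hs.one_le_F
  have hF0 := hs.F_pos
  have ht := hs.one_le_t
  have htp := hs.t_pos
  have hq := hs.q_posR
  have ht9 : 9 ≤ t := by
    calc (9 : ℝ) ≤ F ^ 1 := by linarith [hs.le_F, pow_one F]
      _ ≤ t := hs.F_pow_le_t (by norm_num)
  have ht20 : 1 ≤ t ^ 20 := one_le_pow₀ ht
  have htq : t ^ 41 ≤ q := hs.t_pow_le_q (by norm_num)
  -- The least integer cut for which both bilinear coefficients vanish below `2 t ^ 20`.
  set U := ⌈2 * t ^ 20⌉₊ with hU
  have hU1 : 2 * t ^ 20 ≤ U := Nat.le_ceil _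
  have hU2 : (U : ℝ) ≤ 3 * t ^ 20 := by
    have := (Nat.ceil_lt_add_one (by positivity : 0 ≤ 2 * t ^ 20)).le
    linarith
  have hUU : ((U * U : ℕ) : ℝ) ≤ t ^ 41 := by
    push_cast
    calc (U : ℝ) * U ≤ (3 * t ^ 20) * (3 * t ^ 20) := by gcongr
      _ = 9 * t ^ 40 := by ring
      _ ≤ t * t ^ 40 := by gcongr
      _ = t ^ 41 := by ring
  have hUUq : U * U ≤ q := by exact_mod_cast hUU.trans htq
  have hU3 : 3 ≤ U := by
    have h9 : (9 : ℝ) ≤ t ^ 20 := ht9.trans (le_self_pow₀ ht (by norm_num))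
    have : (3 : ℝ) ≤ U := by linarith
    exact_mod_cast this
  have hlogF : ∀ m : ℕ, m ≤ q → Real.log m ≤ F := by
    intro m hm
    rcases Nat.eq_zero_or_pos m with h | h
    · simp [h, hF0.le]
    · have h1 : Real.log m ≤ Real.log q :=
        Real.log_le_log (by exact_mod_cast h) (by exact_mod_cast hm)
      have h2 : 0 ≤ Real.log m := Real.log_natCast_nonneg m
      linarith [hs.log_le]
  -- The linear sums have `Z = U ^ 2 ≤ t ^ 41`, which `D² t ^ 160 ≤ q` accommodates with room to
  -- spare.
  have hDZ : ((⌊D⌋₊ : ℕ) * ((U * U : ℕ) : ℝ)) * t ^ 80 ≤ q := by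
    calc ((⌊D⌋₊ : ℕ) * ((U * U : ℕ) : ℝ)) * t ^ 80 ≤ (D * t ^ 41) * t ^ 80 := by
          gcongr
          exact Nat.floor_le (by linarith)
      _ = D * t ^ 121 := by ring
      _ ≤ D ^ 2 * t ^ 160 := by
          gcongr
          · exact le_self_pow₀ hD (by norm_num)
          · norm_num
      _ ≤ q := hDq
  have hfloor : ∀ d ∈ 𝒟, 1 ≤ d ∧ d ≤ ⌊D⌋₊ ∧ IsCoprime b (d : ℤ) := fun d hd =>
    ⟨(h𝒟 d hd).1, Nat.le_floor (h𝒟 d hd).2.1, (h𝒟 d hd).2.2.1⟩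
  have hlow : ∀ m, |low U realMoebius m| ≤ 1 := by
    intro m
    rw [low_apply]
    split_ifs
    · exact abs_realMoebius_le m
    · simp
  have hsplit : twistedSum α β q b K 𝒟 lam c
      (fun n => ((ArithmeticFunction.vonMangoldt n : ℝ) : ℂ))
      = twistedSum α β q b K 𝒟 lam c (fun n => ∑ p ∈ n.divisorsAntidiagonal,
          (fun m => ((low U realMoebius m : ℝ) : ℂ)) p.1 * ((∑ j ∈ Finset.range p.2,
            (fun j : ℕ => Real.log ((j + 1 : ℕ) : ℝ) - Real.log (j : ℝ)) j : ℝ) : ℂ))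
        + twistedSum α β q b K 𝒟 lam c (fun n => ∑ p ∈ n.divisorsAntidiagonal,
          (fun m => ((-(low U realMoebius * low U ArithmeticFunction.vonMangoldt) m : ℝ) : ℂ)) p.1 *
            ((∑ j ∈ Finset.range p.2, (fun j : ℕ => if j = 0 then (1 : ℝ) else 0) j : ℝ) : ℂ))
        + twistedSum α β q b K 𝒟 lam c (fun n => ∑ p ∈ n.divisorsAntidiagonal,
          (fun m => (((realMoebius - low U realMoebius) m : ℝ) : ℂ)) p.1 *
          (fun l => (((realZeta * (ArithmeticFunction.vonMangoldt
            - low U ArithmeticFunction.vonMangoldt)) l : ℝ) : ℂ)) p.2) := by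
    rw [← twistedSum_add, ← twistedSum_add]
    refine twistedSum_congr fun n hn _ => ?_
    -- Indeed `3 U ≤ U ^ 2 ≤ q ≤ 2 n`, so the initial segment of `Λ` is never met.
    have hUn : U < n := by
      have := Nat.mul_le_mul_right U hU3
      omega
    rw [vonMangoldt_eq_of_lt hUn]
    push_cast
    rfl
  have hlogδ : ∀ j : ℕ, 0 ≤ Real.log ((j + 1 : ℕ) : ℝ) - Real.log (j : ℝ) := by
    intro j
    rcases Nat.eq_zero_or_pos j with h | h
    · simp [h]
    · rw [sub_nonneg]
      exact Real.log_le_log (by exact_mod_cast h) (by push_cast; linarith)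
  have b1 := twistedSum_linear_le α β hs hK hKq b hDZ 𝒟 hfloor (lam := lam) (c := c)
    (a := fun m => ((low U realMoebius m : ℝ) : ℂ))
    (δ := fun j : ℕ => Real.log ((j + 1 : ℕ) : ℝ) - Real.log (j : ℝ)) hlam hc
    (fun m _ => by rw [Complex.norm_real, Real.norm_eq_abs]; exact (hlow m).trans hF)
    (fun m hm => by
      have : U ≤ U * U := Nat.le_mul_self U
      rw [low_apply, if_neg (by omega), Complex.ofReal_zero]) hUUq hlogδ
    (by
      rw [Finset.sum_range_sub (fun j : ℕ => Real.log (j : ℝ))]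
      simpa using hlogF q le_rfl)
  have b2 := twistedSum_linear_le α β hs hK hKq b hDZ 𝒟 hfloor (lam := lam) (c := c)
    (a := fun m => ((-(low U realMoebius * low U ArithmeticFunction.vonMangoldt) m : ℝ) : ℂ))
    (δ := fun j : ℕ => if j = 0 then (1 : ℝ) else 0) hlam hc
    (fun m hm => by
      rw [Complex.norm_real, Real.norm_eq_abs, abs_neg]
      exact (abs_low_moebius_mul_le U m).trans (hlogF m (hm.trans hUUq)))
    (fun m hm => by
      rw [low_moebius_mul_eq_zero hm, neg_zero, Complex.ofReal_zero]) hUUq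
    (fun j => by split_ifs; exacts [zero_le_one, le_rfl])
    (by
      rw [Finset.sum_ite_eq']
      split_ifs
      · exact hF
      · exact hF0.le)
  have b3 := twistedSum_bilinear_le α β hs hK hKq hb hD hDq 𝒟
    (fun d hd => ⟨(h𝒟 d hd).1, (h𝒟 d hd).2.2⟩) (lam := lam) (c := c)
    (u := fun m => (((realMoebius - low U realMoebius) m : ℝ) : ℂ))
    (v := fun l => (((realZeta * (ArithmeticFunction.vonMangoldt
      - low U ArithmeticFunction.vonMangoldt)) l : ℝ) : ℂ)) hlam hc
    (fun m _ => by
      rw [Complex.norm_real, Real.norm_eq_abs, arith_sub_apply, low_apply]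
      split_ifs
      · simpa using hF0.le
      · rw [sub_zero]; exact (abs_realMoebius_le m).trans hF)
    (fun l hl => by
      rw [Complex.norm_real, Real.norm_eq_abs]
      exact (abs_zeta_mul_high_le U l).trans (hlogF l hl))
    (fun m hm => by
      have h1 : (m : ℝ) ≤ U := hm.le.trans hU1
      have h2 : m ≤ U := by exact_mod_cast h1
      rw [arith_sub_apply, low_apply, if_pos h2, sub_self, Complex.ofReal_zero])
    (fun m hm => by
      have h1 : (m : ℝ) ≤ U := hm.le.trans hU1
      have h2 : m ≤ U := by exact_mod_cast h1
      rw [zeta_mul_high_eq_zero h2, Complex.ofReal_zero])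
  have hsqrt : √t ^ 5 ≤ t ^ 5 := by
    gcongr
    rw [Real.sqrt_le_left htp.le]
    exact le_self_pow₀ ht (by norm_num)
  have hF7 : 4 * F ^ 7 * (K * q) ≤ 4 * F ^ 10 * (K * q) := by
    gcongr; norm_num
  rw [hsplit]
  refine (mul_le_mul_of_nonneg_right ((norm_add_le _ _).trans
    (add_le_add_left (norm_add_le _ _) _)) (by positivity)).trans ?_
  rw [add_mul, add_mul]
  have b1' := (mul_le_mul_of_nonneg_left hsqrt (norm_nonneg _)).trans (b1.trans hF7)
  have b2' := (mul_le_mul_of_nonneg_left hsqrt (norm_nonneg _)).trans (b2.trans hF7)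
  refine (add_le_add (add_le_add b1' b2') b3).trans (le_of_eq ?_)
  ring

/-- A modulus not coprime to `b` contributes only through proper prime powers. -/
lemma not_prime_of_modEq {q d n : ℕ} {b : ℤ} (hd : 1 ≤ d) (hdq : 2 * d < q) (hn : q ≤ 2 * n)
    (hnb : (n : ℤ) ≡ b [ZMOD d]) (hbd : ¬ IsCoprime b (d : ℤ)) : ¬ n.Prime := by
  intro hp
  rw [Int.isCoprime_iff_gcd_eq_one] at hbd
  have h1 : Int.gcd b d ∣ d := Int.natCast_dvd_natCast.1 (Int.gcd_dvd_right b d)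
  have h2 : ((Int.gcd b d : ℕ) : ℤ) ∣ b := Int.gcd_dvd_left b d
  have h3 : ((Int.gcd b d : ℕ) : ℤ) ∣ n := by
    have h4 : (d : ℤ) ∣ b - n := hnb.dvd
    have h5 : ((Int.gcd b d : ℕ) : ℤ) ∣ b - n := (Int.natCast_dvd_natCast.2 h1).trans h4
    have := dvd_sub h2 h5
    rwa [sub_sub_cancel] at this
  rcases (Nat.dvd_prime hp).1 (Int.natCast_dvd_natCast.1 h3) with h | h
  · exact hbd h
  · rw [h] at h1
    have := Nat.le_of_dvd hd h1
    omega

/-- Only proper prime powers contribute, and their total up to `q` is `ψ - θ`, the difference of the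
two Chebyshev functions. -/
lemma sum_vonMangoldt_not_prime_le {q : ℕ} (hq : 1 ≤ q) :
    ∑ n ∈ (Finset.range q).filter (fun n => ¬ n.Prime), ArithmeticFunction.vonMangoldt n
      ≤ 2 * √q * Real.log q := by
  refine le_trans ?_ (Chebyshev.psi_sub_theta_le (x := q) (by exact_mod_cast hq))
  rw [Chebyshev.psi_sub_theta_eq_sum_not_prime, Nat.floor_natCast, Finset.sum_filter,
    Finset.sum_filter, ← Finset.sum_subset (s₁ := Finset.Ioc 0 (q - 1))
    (s₂ := Finset.range q)]
  · refine Finset.sum_le_sum_of_subset_of_nonneg (Finset.Ioc_subset_Ioc_right (by omega)) ?_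
    intro n _ _
    split_ifs
    · exact le_rfl
    · exact ArithmeticFunction.vonMangoldt_nonneg
  · intro n hn
    rw [Finset.mem_Ioc] at hn
    rw [Finset.mem_range]; omega
  · intro n hn hn'
    have : n = 0 := by
      rw [Finset.mem_Ioc] at hn'
      rw [Finset.mem_range] at hn
      omega
    simp [this]

/-- The contribution of the moduli not coprime to `b`. -/
lemma twistedSum_not_coprime_le (α β : ℝ) {q : ℕ} {t F : ℝ} (hs : Setting α q t F) {K : ℝ}
    (hK : 1 ≤ K) {b : ℤ} (hb : 2 * b.natAbs < q) (𝒟 : Finset ℕ)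
    (h𝒟 : ∀ d ∈ 𝒟, 1 ≤ d ∧ 2 * d < q ∧ ¬ IsCoprime b (d : ℤ))
    {lam : ℕ → ℂ} {c : ℤ → ℂ} (hlam : ∀ d ∈ 𝒟, ‖lam d‖ ≤ F)
    (hc : ∀ k ∈ frequencies K, ‖c k‖ ≤ F) :
    ‖twistedSum α β q b K 𝒟 lam c (fun n => ((ArithmeticFunction.vonMangoldt n : ℝ) : ℂ))‖
      ≤ 2 * F ^ 4 * (K * √q) := by
  have hF := hs.one_le_F
  have hF0 := hs.F_pos
  have hq := hs.q_posR
  have hK0 : 0 ≤ K := by linarith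
  have hq2 : 2 ≤ q := by
    have h1 : t ^ 1 ≤ q := hs.t_pow_le_q (by norm_num)
    have h2 : F ^ 1 ≤ t := hs.F_pow_le_t (by norm_num)
    have h3 : (2 : ℝ) ≤ q := by
      rw [pow_one] at h1 h2
      linarith [hs.le_F]
    exact_mod_cast h3
  have h1 : ‖twistedSum α β q b K 𝒟 lam c
      (fun n => ((ArithmeticFunction.vonMangoldt n : ℝ) : ℂ))‖
      ≤ ∑ d ∈ 𝒟, (2 * F ^ 2 * K) * ∑ n ∈ progression q b d, ArithmeticFunction.vonMangoldt n := by
    refine (norm_sum_le _ _).trans (Finset.sum_le_sum fun d hd => ?_)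
    rw [norm_mul]
    have h2 : ∀ k ∈ frequencies K, ‖c k * ∑ n ∈ progression q b d,
        e ((α * (n : ℝ) ^ 2 + β) * k) * ((ArithmeticFunction.vonMangoldt n : ℝ) : ℂ)‖
        ≤ F * ∑ n ∈ progression q b d, ArithmeticFunction.vonMangoldt n := by
      intro k hk
      rw [norm_mul]
      have : ‖∑ n ∈ progression q b d,
          e ((α * (n : ℝ) ^ 2 + β) * k) * ((ArithmeticFunction.vonMangoldt n : ℝ) : ℂ)‖
          ≤ ∑ n ∈ progression q b d, ArithmeticFunction.vonMangoldt n := by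
        refine (norm_sum_le _ _).trans (Finset.sum_le_sum fun n _ => ?_)
        rw [norm_mul, norm_e, one_mul, Complex.norm_real,
          Real.norm_of_nonneg ArithmeticFunction.vonMangoldt_nonneg]
      exact mul_le_mul (hc k hk) this (norm_nonneg _) hF0.le
    have hS : 0 ≤ ∑ n ∈ progression q b d, ArithmeticFunction.vonMangoldt n :=
      Finset.sum_nonneg fun _ _ => ArithmeticFunction.vonMangoldt_nonneg
    calc _ ≤ F * ∑ k ∈ frequencies K, F * ∑ n ∈ progression q b d,
            ArithmeticFunction.vonMangoldt n := by
          refine mul_le_mul (hlam d hd) ?_ (norm_nonneg _) hF0.le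
          exact (norm_sum_le _ _).trans (Finset.sum_le_sum h2)
      _ = F * ((frequencies K).card * (F * ∑ n ∈ progression q b d,
            ArithmeticFunction.vonMangoldt n)) := by rw [Finset.sum_const, nsmul_eq_mul]
      _ ≤ F * ((2 * K) * (F * ∑ n ∈ progression q b d, ArithmeticFunction.vonMangoldt n)) := by
          gcongr
          exact card_frequencies_le hK0
      _ = _ := by ring
  have h2 : ∑ d ∈ 𝒟, ∑ n ∈ progression q b d, ArithmeticFunction.vonMangoldt n
      ≤ F * (2 * √q * Real.log q) := by
    have h3 : ∀ d ∈ 𝒟, ∑ n ∈ progression q b d, ArithmeticFunction.vonMangoldt n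
        = ∑ n ∈ (Finset.range q).filter (fun n => ¬ n.Prime),
          if n ∈ progression q b d then ArithmeticFunction.vonMangoldt n else 0 := by
      intro d hd
      rw [← Finset.sum_filter]
      refine Finset.sum_congr ?_ fun _ _ => rfl
      ext n
      rw [Finset.mem_filter, Finset.mem_filter, Finset.mem_range]
      refine ⟨fun h => ⟨⟨(mem_progression.1 h).2.1, ?_⟩, h⟩, fun h => h.2⟩
      obtain ⟨a1, -, a3⟩ := mem_progression.1 h
      exact not_prime_of_modEq (h𝒟 d hd).1 (h𝒟 d hd).2.1 a1 a3 (h𝒟 d hd).2.2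
    rw [Finset.sum_congr rfl h3, Finset.sum_comm]
    -- A given `n` is counted for at most `τ(|n - b|) ≤ F` moduli, and `n ≠ b` because `2 |b| < q ≤
    -- 2 n`.
    have h4 : ∀ n ∈ (Finset.range q).filter (fun n => ¬ n.Prime),
        ∑ d ∈ 𝒟, (if n ∈ progression q b d then ArithmeticFunction.vonMangoldt n else 0)
        ≤ F * ArithmeticFunction.vonMangoldt n := by
      intro n hn
      rw [← Finset.sum_filter, Finset.sum_const, nsmul_eq_mul]
      refine mul_le_mul_of_nonneg_right ?_ ArithmeticFunction.vonMangoldt_nonneg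
      by_cases hn2 : q ≤ 2 * n
      · have hnq := Finset.mem_range.1 (Finset.mem_filter.1 hn).1
        have hne : ((n : ℤ) - b).natAbs ≠ 0 := by omega
        refine le_trans ?_ (hs.divisors_le ((n : ℤ) - b).natAbs (Nat.pos_of_ne_zero hne) ?_)
        · norm_cast
          refine Finset.card_le_card fun d hd => ?_
          rw [Nat.mem_divisors]
          refine ⟨?_, hne⟩
          have := (mem_progression.1 (Finset.mem_filter.1 hd).2).2.2.symm.dvd
          exact Int.natCast_dvd.1 this
        · have h5 : ((n : ℤ) - b).natAbs ≤ 2 * q := by omega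
          have h6 : 2 * q ≤ q ^ 10 := by
            calc 2 * q ≤ q * q := Nat.mul_le_mul_right q hq2
              _ = q ^ 2 := (pow_two q).symm
              _ ≤ q ^ 10 := Nat.pow_le_pow_right (by omega) (by norm_num)
          exact_mod_cast h5.trans h6
      · have : 𝒟.filter (fun d => n ∈ progression q b d) = ∅ := by
          rw [Finset.filter_eq_empty_iff]
          intro d _ h
          exact hn2 (mem_progression.1 h).1
        rw [this]
        simpa using hF0.le
    refine (Finset.sum_le_sum h4).trans ?_
    rw [← Finset.mul_sum]
    gcongr
    exact sum_vonMangoldt_not_prime_le hs.q_pos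
  refine h1.trans ?_
  rw [← Finset.mul_sum]
  calc (2 * F ^ 2 * K) * ∑ d ∈ 𝒟, ∑ n ∈ progression q b d, ArithmeticFunction.vonMangoldt n
      ≤ (2 * F ^ 2 * K) * (F * (2 * √q * Real.log q)) := by gcongr
    _ = 2 * F ^ 3 * K * √q * (2 * Real.log q) := by ring
    _ ≤ 2 * F ^ 3 * K * √q * F := by
        gcongr
        have := Real.log_natCast_nonneg q
        linarith [hs.log_le]
    _ = _ := by ring

/-- The estimate for `W(q)` in terms of the parameters of the setting. -/
lemma twistedSum_le (α β : ℝ) {q : ℕ} {t F : ℝ} (hs : Setting α q t F) {K : ℝ}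
    (hK : 1 ≤ K) (hKq : K ≤ q) {b : ℤ} (hb : 2 * b.natAbs < q) {D : ℝ} (hD : 1 ≤ D)
    (hDq : D ^ 2 * t ^ 160 ≤ q) (𝒟 : Finset ℕ)
    (h𝒟 : ∀ d ∈ 𝒟, 1 ≤ d ∧ (d : ℝ) ≤ D ∧ WellSeparable D d)
    {lam : ℕ → ℂ} {c : ℤ → ℂ} (hlam : ∀ d ∈ 𝒟, ‖lam d‖ ≤ F)
    (hc : ∀ k ∈ frequencies K, ‖c k‖ ≤ F) :
    ‖twistedSum α β q b K 𝒟 lam c (fun n => ((ArithmeticFunction.vonMangoldt n : ℝ) : ℂ))‖ * √t ^ 5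
      ≤ 28 * F ^ 10 * (K * q) := by
  classical
  have hF := hs.one_le_F
  have hq := hs.q_posR
  have ht := hs.one_le_t
  have htp := hs.t_pos
  have hsplit : twistedSum α β q b K 𝒟 lam c
      (fun n => ((ArithmeticFunction.vonMangoldt n : ℝ) : ℂ))
      = twistedSum α β q b K (𝒟.filter fun d => IsCoprime b (d : ℤ)) lam c
        (fun n => ((ArithmeticFunction.vonMangoldt n : ℝ) : ℂ))
      + twistedSum α β q b K (𝒟.filter fun d => ¬ IsCoprime b (d : ℤ)) lam c
        (fun n => ((ArithmeticFunction.vonMangoldt n : ℝ) : ℂ)) := by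
    unfold twistedSum
    rw [Finset.sum_filter_add_sum_filter_not]
  have ht9 : 9 ≤ t := by
    calc (9 : ℝ) ≤ F ^ 1 := by linarith [hs.le_F, pow_one F]
      _ ≤ t := hs.F_pow_le_t (by norm_num)
  have hDlt : ∀ d ∈ 𝒟, 2 * d < q := by
    intro d hd
    have h1 := (h𝒟 d hd).2.1
    have h2 : (2 * d : ℝ) < q := by
      calc (2 * d : ℝ) ≤ 2 * D := by gcongr
        _ < 9 * D := by linarith
        _ ≤ t ^ 160 * D ^ 2 := by
            gcongr
            · exact ht9.trans (le_self_pow₀ ht (by norm_num))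
            · exact le_self_pow₀ hD (by norm_num)
        _ = D ^ 2 * t ^ 160 := mul_comm _ _
        _ ≤ q := hDq
    exact_mod_cast h2
  have b1 := twistedSum_coprime_le α β hs hK hKq hb hD hDq
    (𝒟.filter fun d => IsCoprime b (d : ℤ)) (lam := lam) (c := c)
    (fun d hd => by
      obtain ⟨h1, h2⟩ := Finset.mem_filter.1 hd
      exact ⟨(h𝒟 d h1).1, (h𝒟 d h1).2.1, h2, (h𝒟 d h1).2.2⟩)
    (fun d hd => hlam d (Finset.mem_filter.1 hd).1) hc
  have b2 := twistedSum_not_coprime_le α β hs hK hb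
    (𝒟.filter fun d => ¬ IsCoprime b (d : ℤ)) (lam := lam) (c := c)
    (fun d hd => by
      obtain ⟨h1, h2⟩ := Finset.mem_filter.1 hd
      exact ⟨(h𝒟 d h1).1, hDlt d h1, h2⟩)
    (fun d hd => hlam d (Finset.mem_filter.1 hd).1) hc
  have hsqrt : √q * √t ^ 5 ≤ q := by
    rw [← pow_le_pow_iff_left₀ (by positivity) hq.le two_ne_zero]
    calc (√q * √t ^ 5) ^ 2 = √q ^ 2 * (√t ^ 2) ^ 5 := by ring
      _ = q * t ^ 5 := by rw [Real.sq_sqrt hq.le, Real.sq_sqrt htp.le]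
      _ ≤ q * q := by gcongr; exact hs.t_pow_le_q (by norm_num)
      _ = (q : ℝ) ^ 2 := (pow_two _).symm
  rw [hsplit]
  calc _ ≤ (‖twistedSum α β q b K (𝒟.filter fun d => IsCoprime b (d : ℤ)) lam c
        (fun n => ((ArithmeticFunction.vonMangoldt n : ℝ) : ℂ))‖
      + ‖twistedSum α β q b K (𝒟.filter fun d => ¬ IsCoprime b (d : ℤ)) lam c
        (fun n => ((ArithmeticFunction.vonMangoldt n : ℝ) : ℂ))‖) * √t ^ 5 := by
        gcongr; exact norm_add_le _ _
    _ ≤ 26 * F ^ 10 * (K * q) + (2 * F ^ 4 * (K * √q)) * √t ^ 5 := by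
        rw [add_mul]; gcongr
    _ = 26 * F ^ 10 * (K * q) + 2 * F ^ 4 * (K * (√q * √t ^ 5)) := by ring
    _ ≤ 26 * F ^ 10 * (K * q) + 2 * F ^ 10 * (K * q) := by
        gcongr
        norm_num
    _ = _ := by ring

/-! ### Divisor bound, approximations, and choice of the parameters. -/

/-- The divisor bound. -/
lemma exists_card_divisors_le {ε : ℝ} (hε : 0 < ε) :
    ∃ C : ℝ, 1 ≤ C ∧ ∀ n : ℕ, 1 ≤ n → (n.divisors.card : ℝ) ≤ C * (n : ℝ) ^ ε := by
  -- For `p ≥ P` one has `p ^ ε ≥ 2`, so `a + 1 ≤ 2 ^ a ≤ p ^ (a ε)` costs no constant. Each prime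
  -- below `P` costs a factor `C₀`.
  set P : ℕ := ⌈(2 : ℝ) ^ (1 / ε)⌉₊ with hP
  have hlog2 : 0 < Real.log 2 := Real.log_pos (by norm_num)
  set C₀ : ℝ := max 1 (1 / (ε * Real.log 2)) with hC₀
  have hC₀1 : 1 ≤ C₀ := le_max_left _ _
  have hC₀2 : 1 ≤ C₀ * (ε * Real.log 2) := by
    rw [← div_le_iff₀ (by positivity)]
    exact le_max_right _ _
  refine ⟨C₀ ^ P, one_le_pow₀ hC₀1, fun n hn => ?_⟩
  have hn0 : n ≠ 0 := by omega
  have hfact : ∀ p ∈ n.primeFactors, ((n.factorization p + 1 : ℕ) : ℝ)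
      ≤ (if p < P then C₀ else 1) * ((p : ℝ) ^ n.factorization p) ^ ε := by
    intro p hp
    set a := n.factorization p
    have hp2 : (2 : ℝ) ≤ p := by exact_mod_cast (Nat.prime_of_mem_primeFactors hp).two_le
    push_cast
    split_ifs with h
    · have h1 : Real.exp (a * (ε * Real.log 2)) ≤ ((p : ℝ) ^ a) ^ ε := by
        rw [← Real.rpow_natCast, ← Real.rpow_mul (by positivity),
          Real.rpow_def_of_pos (by linarith)]
        apply Real.exp_le_exp.2
        have h2 : Real.log 2 ≤ Real.log p := Real.log_le_log (by norm_num) hp2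
        calc a * (ε * Real.log 2) = Real.log 2 * (a * ε) := by ring
          _ ≤ Real.log p * (a * ε) := by gcongr
      have h2 := Real.add_one_le_exp (a * (ε * Real.log 2))
      calc (a : ℝ) + 1 ≤ a * (C₀ * (ε * Real.log 2)) + C₀ := by
            gcongr
            exact le_mul_of_one_le_right (by positivity) hC₀2
        _ = C₀ * (a * (ε * Real.log 2) + 1) := by ring
        _ ≤ C₀ * ((p : ℝ) ^ a) ^ ε := by gcongr; exact h2.trans h1
    · rw [one_mul]
      have h1 : (2 : ℝ) ≤ (p : ℝ) ^ ε := by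
        calc (2 : ℝ) = ((2 : ℝ) ^ (1 / ε)) ^ ε := by
              rw [← Real.rpow_mul (by norm_num), one_div_mul_cancel hε.ne', Real.rpow_one]
          _ ≤ (p : ℝ) ^ ε := by
              gcongr
              exact (Nat.le_ceil _).trans (by exact_mod_cast not_lt.1 h)
      calc (a : ℝ) + 1 ≤ 2 ^ a := by exact_mod_cast Nat.lt_two_pow_self (n := a)
        _ ≤ ((p : ℝ) ^ ε) ^ a := by gcongr
        _ = ((p : ℝ) ^ a) ^ ε := by
            rw [← Real.rpow_natCast, ← Real.rpow_natCast, ← Real.rpow_mul (by positivity),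
              ← Real.rpow_mul (by positivity), mul_comm]
  have hprod : ∏ p ∈ n.primeFactors, ((p : ℝ) ^ n.factorization p) = n := by
    have := Nat.prod_factorization_pow_eq_self hn0
    rw [Finsupp.prod, Nat.support_factorization] at this
    exact_mod_cast this
  rw [Nat.card_divisors hn0, Nat.cast_prod]
  calc ∏ p ∈ n.primeFactors, ((n.factorization p + 1 : ℕ) : ℝ)
      ≤ ∏ p ∈ n.primeFactors, (if p < P then C₀ else 1) * ((p : ℝ) ^ n.factorization p) ^ ε :=
        Finset.prod_le_prod (fun _ _ => by positivity) hfact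
    _ = (∏ p ∈ n.primeFactors, (if p < P then C₀ else 1)) * (n : ℝ) ^ ε := by
        rw [Finset.prod_mul_distrib, Real.finsetProd_rpow _ _ (fun _ _ => by positivity), hprod]
    _ ≤ C₀ ^ P * (n : ℝ) ^ ε := by
        gcongr
        rw [← Finset.prod_filter, Finset.prod_const]
        refine pow_le_pow_right₀ hC₀1 ?_
        refine (Finset.card_le_card (t := Finset.range P) fun p hp => ?_).trans_eq
          (Finset.card_range P)
        exact Finset.mem_range.2 (Finset.mem_filter.1 hp).2

/-- Dirichlet's theorem: an irrational number has good approximations with arbitrarily large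
denominators. -/
lemma exists_strictMono_approximations {α : ℝ} (hα : Irrational α) :
    ∃ φ : ℕ → ℕ, StrictMono φ ∧ ∀ j, 0 < φ j ∧
      ∃ a : ℤ, IsCoprime a (φ j : ℤ) ∧ |α - a / φ j| ≤ 1 / (φ j : ℝ) ^ 2 := by
  refine extraction_of_frequently_atTop (P := fun q : ℕ => 0 < q ∧
      ∃ a : ℤ, IsCoprime a (q : ℤ) ∧ |α - a / q| ≤ 1 / (q : ℝ) ^ 2) ?_
  intro hev
  obtain ⟨N, hN⟩ := eventually_atTop.1 hev
  -- If the denominators were bounded, the numerators would be too, and only finitely many good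
  -- approximations would exist.
  refine Real.infinite_rat_abs_sub_lt_one_div_den_sq_of_irrational hα ?_
  set B : ℤ := ⌈(|α| + 1) * N⌉
  refine Set.Finite.of_finite_image (f := fun r : ℚ => (r.num, r.den)) ?_ ?_
  · refine Set.Finite.subset ((Set.finite_Icc (-B) B).prod (Set.finite_Iio N)) ?_
    rintro _ ⟨r, hr, rfl⟩
    have hr : |α - r| < 1 / (r.den : ℝ) ^ 2 := hr
    have hden : (1 : ℝ) ≤ r.den := by exact_mod_cast r.den_pos
    have hlt : r.den < N := by
      by_contra h
      refine hN r.den (not_lt.1 h) ⟨r.den_pos, r.num, ?_, ?_⟩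
      · rw [Int.isCoprime_iff_gcd_eq_one]
        exact r.reduced
      · rw [← Rat.cast_def]
        exact hr.le
    refine ⟨?_, hlt⟩
    have h1 : |(r : ℝ)| ≤ |α| + 1 := by
      have h2 : 1 / (r.den : ℝ) ^ 2 ≤ 1 := by
        rw [div_le_one (by positivity)]
        exact one_le_pow₀ hden
      have h3 : |(r : ℝ)| - |α| ≤ |(r : ℝ) - α| := abs_sub_abs_le_abs_sub _ _
      rw [abs_sub_comm] at h3
      linarith
    have h2 : |(r.num : ℝ)| ≤ (|α| + 1) * N := by
      have h3 : (r.num : ℝ) = r * r.den := by exact_mod_cast (Rat.mul_den_eq_num r).symm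
      rw [h3, abs_mul, Nat.abs_cast]
      gcongr
    have h3 : |r.num| ≤ B := by
      have := h2.trans (Int.le_ceil _)
      exact_mod_cast this
    exact abs_le.1 h3
  · intro r _ s _ h
    have h := Prod.mk.inj h
    exact Rat.ext h.1 h.2

/-- The conditions are comparisons of exponents: `t ^ 392 ≤ q` needs `392 ρ / 80 ≤ 1`, which `ρ < 11
/ 54` just ensures, and `F ^ 1000 ≤ t` is `80000 ε ≤ ρ`. -/
lemma eventually_setting (α : ℝ) {ρ ε : ℝ} (hρ : ρ < 11 / 54) (hε : 0 < ε)
    (hε1 : 80000 * ε ≤ ρ) :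
    ∀ᶠ q : ℕ in atTop, (∃ a : ℤ, IsCoprime a (q : ℤ) ∧ |α - a / q| ≤ 1 / (q : ℝ) ^ 2) →
      Setting α q ((q : ℝ) ^ (ρ / 80)) ((q : ℝ) ^ ε) := by
  -- For integers up to `q ^ 10` this exponent gives `q ^ (ε / 2)`; the other half of `ε` absorbs
  -- `C`.
  obtain ⟨C, hC1, hC⟩ := exists_card_divisors_le (ε := ε / 20) (by positivity)
  have hlarge : ∀ᶠ y : ℝ in atTop, 1 ≤ y ∧ 1000000 ≤ y ^ ε ∧ C ≤ y ^ (ε / 2) ∧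
      100 * Real.log y ≤ y ^ ε := by
    have h1 := (tendsto_rpow_atTop hε).eventually_ge_atTop 1000000
    have h2 := (tendsto_rpow_atTop (half_pos hε)).eventually_ge_atTop C
    have h3 := (isLittleO_log_rpow_atTop hε).def (c := 1 / 100) (by norm_num)
    filter_upwards [h1, h2, h3, eventually_ge_atTop 1] with y h1 h2 h3 h4
    refine ⟨h4, h1, h2, ?_⟩
    rw [Real.norm_of_nonneg (Real.log_nonneg h4), Real.norm_of_nonneg (by positivity)] at h3
    linarith
  filter_upwards [tendsto_natCast_atTop_atTop.eventually hlarge] with q ⟨h1, h2, h3, h4⟩ ha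
  have hq0 : (0 : ℝ) < q := by linarith
  refine ⟨by exact_mod_cast h1, ha, h2, ?_, ?_, ?_, h4⟩
  · rw [← Real.rpow_natCast, ← Real.rpow_mul hq0.le]
    refine Real.rpow_le_rpow_of_exponent_le h1 ?_
    push_cast
    linarith
  · rw [← Real.rpow_natCast, ← Real.rpow_mul hq0.le]
    refine (Real.rpow_le_rpow_of_exponent_le h1 (z := 1) ?_).trans_eq (Real.rpow_one _)
    push_cast
    linarith
  · intro n hn hnq
    calc (n.divisors.card : ℝ) ≤ C * (n : ℝ) ^ (ε / 20) := hC n hn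
      _ ≤ (q : ℝ) ^ (ε / 2) * ((q : ℝ) ^ 10) ^ (ε / 20) := by gcongr
      _ = (q : ℝ) ^ (ε / 2) * (q : ℝ) ^ (ε / 2) := by
          rw [← Real.rpow_natCast (q : ℝ) 10, ← Real.rpow_mul hq0.le]
          congr 2
          push_cast
          ring
      _ = (q : ℝ) ^ ε := by rw [← Real.rpow_add hq0, add_halves]

/-- Moduli of weight zero are removed, so that every modulus left is well-separable. -/
lemma W_eq_twistedSum (α β θ ρ : ℝ) (b : ℤ) (lam : ℕ → ℂ) (c : ℤ → ℂ) (q : ℕ) :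
    W α β θ ρ b lam c q = twistedSum α β q b (K θ q)
      ((Finset.Icc 1 ⌊D θ ρ q⌋₊).filter fun d => lam d ≠ 0) lam c
      (fun n => ((ArithmeticFunction.vonMangoldt n : ℝ) : ℂ)) := by
  unfold W twistedSum
  symm
  refine Finset.sum_filter_of_ne fun d _ h => ?_
  exact left_ne_zero_of_mul h

lemma K_eq {θ x : ℝ} (hx : 0 < x) : K θ x = x ^ θ * Real.log x ^ 2 := by
  rw [K, delta, ← Real.rpow_neg hx.le, neg_neg]

/-- The bound for `W(q)` when `q` is a large denominator of an approximation to `α`. -/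
lemma eventually_norm_W_le (α β θ ρ : ℝ) (b : ℤ)
    (hθ₀ : 0 < θ) (hθ₁ : θ < 1 / 200) (hρ₁ : ρ < 11 / 54)
    (lam : ℝ → ℕ → ℂ) (c : ℝ → ℤ → ℂ)
    (hlam : ∃ A : ℝ, ∀ᶠ x : ℝ in atTop, ∀ d : ℕ, 1 ≤ d → (d : ℝ) ≤ D θ ρ x →
      ‖lam x d‖ ≤ A * (d.divisors.card : ℝ))
    (hsupp : ∀ᶠ x : ℝ in atTop, ∀ d : ℕ, 1 ≤ d → (d : ℝ) ≤ D θ ρ x →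
      lam x d ≠ 0 → WellSeparable (D θ ρ x) d)
    (hc : ∃ B : ℝ, ∀ᶠ x : ℝ in atTop, ∀ k : ℤ, k ≠ 0 → |(k : ℝ)| ≤ K θ x →
      ‖c x k‖ ≤ B) {ω : ℝ} (hω : 0 < ω) (hω₁ : ω < ρ / 32 - θ) :
    ∀ᶠ q : ℕ in atTop, (∃ a : ℤ, IsCoprime a (q : ℤ) ∧ |α - a / q| ≤ 1 / (q : ℝ) ^ 2) →
      ‖W α β θ ρ b (lam q) (c q) q‖ ≤ 28 * (q : ℝ) ^ (1 - ω) := by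
  obtain ⟨A, hlam⟩ := hlam
  obtain ⟨B, hc⟩ := hc
  have hρ0 : 0 < ρ := by linarith
  -- The 12 pays for `F ^ 10` and for `log² q ≤ F ^ 2` inside `K`; the second entry makes `F` small
  -- against `t`.
  set ε := min ((ρ / 32 - θ - ω) / 12) (ρ / 80000) with hεdef
  have hε : 0 < ε := lt_min (by linarith) (by linarith)
  have hε1 : 12 * ε ≤ ρ / 32 - θ - ω := by
    have := min_le_left ((ρ / 32 - θ - ω) / 12) (ρ / 80000)
    rw [← hεdef] at this
    linarith
  have hε2 : 80000 * ε ≤ ρ := by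
    have := min_le_right ((ρ / 32 - θ - ω) / 12) (ρ / 80000)
    rw [← hεdef] at this
    linarith
  obtain ⟨C, hC1, hC⟩ := exists_card_divisors_le (ε := ε / 2) (by positivity)
  have hcast : Tendsto (fun q : ℕ => (q : ℝ)) atTop atTop := tendsto_natCast_atTop_atTop
  have hlarge : ∀ᶠ y : ℝ in atTop, 1 ≤ y ∧ |A| * C ≤ y ^ (ε / 2) ∧ B ≤ y ^ ε ∧
      1 ≤ Real.log y ∧ 2 * (b.natAbs : ℝ) < y := by
    filter_upwards [eventually_ge_atTop 1,
      (tendsto_rpow_atTop (half_pos hε)).eventually_ge_atTop (|A| * C),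
      (tendsto_rpow_atTop hε).eventually_ge_atTop B,
      Real.tendsto_log_atTop.eventually_ge_atTop 1,
      eventually_gt_atTop (2 * (b.natAbs : ℝ))] with y h1 h2 h3 h4 h5
    exact ⟨h1, h2, h3, h4, h5⟩
  filter_upwards [eventually_setting α hρ₁ hε hε2, hcast.eventually hlam, hcast.eventually hsupp,
    hcast.eventually hc, hcast.eventually hlarge] with q hs hlam hsupp hc hlarge ha
  have hs := hs ha
  obtain ⟨hq1, hA, hB, hlog, hb⟩ := hlarge
  have hq0 : (0 : ℝ) < q := by linarith
  set F := (q : ℝ) ^ ε with hF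
  set t := (q : ℝ) ^ (ρ / 80) with ht
  have hF1 := hs.one_le_F
  have hlogF : Real.log q ≤ F := by linarith [hs.log_le]
  have hKeq : K θ q = (q : ℝ) ^ θ * Real.log q ^ 2 := K_eq hq0
  have hKle : K θ q ≤ (q : ℝ) ^ (θ + 2 * ε) := by
    rw [hKeq, Real.rpow_add hq0]
    gcongr
    rw [mul_comm 2 ε, Real.rpow_mul hq0.le, Real.rpow_two]
    gcongr
  have hK1 : 1 ≤ K θ q := by
    rw [hKeq]
    exact one_le_mul_of_one_le_of_one_le (Real.one_le_rpow hq1 hθ₀.le) (one_le_pow₀ hlog)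
  have hKq : K θ q ≤ q := by
    refine hKle.trans ((Real.rpow_le_rpow_of_exponent_le hq1 (z := 1) ?_).trans_eq
      (Real.rpow_one _))
    linarith
  rw [W_eq_twistedSum]
  by_cases hD : 1 ≤ D θ ρ q
  swap
  · have : ⌊D θ ρ q⌋₊ = 0 := Nat.floor_eq_zero.2 (not_le.1 hD)
    rw [this]
    simp only [twistedSum, Finset.Icc_eq_empty (by norm_num : ¬ 1 ≤ 0), Finset.filter_empty,
      Finset.sum_empty, norm_zero]
    positivity
  have hDle : D θ ρ q ≤ (q : ℝ) ^ (1 / 2 - ρ) := by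
    rw [D, Delta, Real.rpow_sub hq0]
    gcongr
    exact le_mul_of_one_le_right (by positivity) (one_le_pow₀ hK1)
  -- With `D ≤ q ^ (1 / 2 - ρ)` the exponents add up to exactly 1: this fixes `t = q ^ (ρ / 80)`.
  have hDq : D θ ρ q ^ 2 * t ^ 160 ≤ q := by
    calc D θ ρ q ^ 2 * t ^ 160 ≤ ((q : ℝ) ^ (1 / 2 - ρ)) ^ 2 * t ^ 160 := by gcongr
      _ = (q : ℝ) ^ ((1 / 2 - ρ) * 2 + ρ / 80 * 160) := by
          rw [ht, ← Real.rpow_natCast, ← Real.rpow_natCast, ← Real.rpow_mul hq0.le,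
            ← Real.rpow_mul hq0.le, ← Real.rpow_add hq0]
          norm_num
      _ = (q : ℝ) ^ (1 : ℝ) := by congr 1; ring
      _ = q := Real.rpow_one _
  have hmem : ∀ d ∈ (Finset.Icc 1 ⌊D θ ρ q⌋₊).filter (fun d => lam q d ≠ 0),
      1 ≤ d ∧ (d : ℝ) ≤ D θ ρ q ∧ lam q d ≠ 0 := by
    intro d hd
    obtain ⟨h1, h2⟩ := Finset.mem_filter.1 hd
    obtain ⟨h3, h4⟩ := Finset.mem_Icc.1 h1
    exact ⟨h3, (Nat.le_floor_iff (by linarith)).1 h4, h2⟩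
  have hmain := twistedSum_le α β hs hK1 hKq (b := b) (by exact_mod_cast hb) hD hDq
    ((Finset.Icc 1 ⌊D θ ρ q⌋₊).filter fun d => lam q d ≠ 0) (lam := lam q) (c := c q)
    (fun d hd => by
      obtain ⟨h1, h2, h3⟩ := hmem d hd
      exact ⟨h1, h2, hsupp d h1 h2 h3⟩)
    (fun d hd => by
      obtain ⟨h1, h2, h3⟩ := hmem d hd
      have hdq : (d : ℝ) ≤ q := by
        refine h2.trans (hDle.trans ((Real.rpow_le_rpow_of_exponent_le hq1 (z := 1) ?_).trans_eq
          (Real.rpow_one _)))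
        linarith
      calc ‖lam q d‖ ≤ A * d.divisors.card := hlam d h1 h2
        _ ≤ |A| * (C * (q : ℝ) ^ (ε / 2)) := by
            refine mul_le_mul (le_abs_self A) ((hC d h1).trans ?_) (by positivity) (abs_nonneg A)
            gcongr
        _ = |A| * C * (q : ℝ) ^ (ε / 2) := by ring
        _ ≤ (q : ℝ) ^ (ε / 2) * (q : ℝ) ^ (ε / 2) := by gcongr
        _ = F := by rw [← Real.rpow_add hq0, add_halves])
    (fun k hk => by
      rw [mem_frequencies (by linarith), Finset.mem_Icc, Nat.le_floor_iff (by linarith)] at hk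
      refine (hc k ?_ ?_).trans hB
      · intro h
        rw [h] at hk
        simp at hk
      · rw [← Int.cast_abs, Int.abs_eq_natAbs, Int.cast_natCast]
        exact hk.2)
  have hsqrt : √t ^ 5 = (q : ℝ) ^ (ρ / 32) := by
    rw [Real.sqrt_eq_rpow, ht, ← Real.rpow_mul hq0.le, ← Real.rpow_natCast,
      ← Real.rpow_mul hq0.le]
    congr 1
    push_cast
    ring
  rw [hsqrt, ← le_div_iff₀ (by positivity)] at hmain
  refine hmain.trans ?_
  rw [div_le_iff₀ (by positivity)]
  calc 28 * F ^ 10 * (K θ q * q)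
      ≤ 28 * F ^ 10 * ((q : ℝ) ^ (θ + 2 * ε) * q) := by gcongr
    _ = 28 * (q : ℝ) ^ (ε * 10 + (θ + 2 * ε) + 1) := by
        have hF10 : F ^ 10 = (q : ℝ) ^ (ε * 10) := by
          rw [hF, ← Real.rpow_natCast, ← Real.rpow_mul hq0.le, Nat.cast_ofNat]
        rw [Real.rpow_add hq0 (ε * 10 + _), Real.rpow_add hq0 (ε * 10), Real.rpow_one, hF10]
        ring
    _ ≤ 28 * (q : ℝ) ^ ((1 - ω) + ρ / 32) := by
        refine mul_le_mul_of_nonneg_left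
          (Real.rpow_le_rpow_of_exponent_le hq1 (by linarith)) (by norm_num)
    _ = 28 * (q : ℝ) ^ (1 - ω) * (q : ℝ) ^ (ρ / 32) := by
        rw [Real.rpow_add hq0]; ring

end

end WellSep

theorem lemma1
    (α β θ ρ : ℝ) (b : ℤ) (hα : Irrational α)
    (hθ₀ : 0 < θ) (hθ₁ : θ < 1 / 200) (hρ₀ : 32 * θ < ρ) (hρ₁ : ρ + 4 * θ < 11 / 54)
    (lam : ℝ → ℕ → ℂ) (c : ℝ → ℤ → ℂ)
    (hlam : ∃ A : ℝ, ∀ᶠ x : ℝ in atTop, ∀ d : ℕ, 1 ≤ d → (d : ℝ) ≤ WellSep.D θ ρ x →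
      ‖lam x d‖ ≤ A * (d.divisors.card : ℝ))
    (hsupp : ∀ᶠ x : ℝ in atTop, ∀ d : ℕ, 1 ≤ d → (d : ℝ) ≤ WellSep.D θ ρ x →
      lam x d ≠ 0 → WellSep.WellSeparable (WellSep.D θ ρ x) d)
    (hc : ∃ B : ℝ, ∀ᶠ x : ℝ in atTop, ∀ k : ℤ, k ≠ 0 → |(k : ℝ)| ≤ WellSep.K θ x →
      ‖c x k‖ ≤ B) :
    ∃ x : ℕ → ℝ, Tendsto x atTop atTop ∧
      ∀ ω : ℝ, 0 < ω → ω < ρ / 32 - θ →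
        ∃ C : ℝ, ∀ j : ℕ,
          ‖WellSep.W α β θ ρ b (lam (x j)) (c (x j)) (x j)‖ ≤ C * (x j) ^ (1 - ω) := by
  obtain ⟨φ, hφ, happrox⟩ := WellSep.exists_strictMono_approximations hα
  refine ⟨fun j => (φ j : ℝ), tendsto_natCast_atTop_atTop.comp hφ.tendsto_atTop,
    fun ω hω hω₁ => ?_⟩
  have hev := hφ.tendsto_atTop.eventually (WellSep.eventually_norm_W_le α β θ ρ b hθ₀ hθ₁
    (by linarith) lam c hlam hsupp hc hω hω₁)
  obtain ⟨J, hJ⟩ := eventually_atTop.1 hev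
  -- The sequence does not depend on `ω`, but the threshold `J` does; the finitely many earlier
  -- terms are absorbed into the constant.
  set T : ℕ → ℝ := fun j =>
    ‖WellSep.W α β θ ρ b (lam (φ j)) (c (φ j)) (φ j)‖ / (φ j : ℝ) ^ (1 - ω)
  have hT : ∀ j, 0 ≤ T j := fun j => by positivity
  have hpos : ∀ j, 0 < (φ j : ℝ) ^ (1 - ω) := fun j =>
    Real.rpow_pos_of_pos (by exact_mod_cast (happrox j).1) _
  refine ⟨28 + ∑ j ∈ Finset.range J, T j, fun j => ?_⟩
  by_cases hj : J ≤ j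
  · refine (hJ j hj (happrox j).2).trans ?_
    refine mul_le_mul_of_nonneg_right ?_ (hpos j).le
    linarith [Finset.sum_nonneg (s := Finset.range J) fun j _ => hT j]
  · rw [← div_le_iff₀ (hpos j)]
    have := Finset.single_le_sum (f := T) (fun j _ => hT j) (Finset.mem_range.2 (not_le.1 hj))
    exact this.trans (by linarith)
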